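/- **Setting.** There are $M$ sources and $N\ge M\ge 2$ channels with success probabilities $1\ge\mu_1>\mu_2>\dots>\mu_N$, and $\mu_{\min}=\mu_N>0$. Time is slotted, with slots $t\in\mathbb Z$. In every slot each source is scheduled on one channel; if several sources are scheduled on the same channel, one of them, chosen uniformly at random, acquires it, and the others fail. A source that acquires channel $n$ succeeds with probability $\mu_n$. Channel successes and winners are independent of each other, across channels and across slots. The age of information $a_m(t)$ of source $m$ in slot $t$ is $t-u$, where $u$ is the last slot before $t$ in which source $m$ succeeded. Decisions are made in the slots $t\ge 1$ without using observations from slots $t\le 0$; in the slots $t\le 0$ the sources follow arbitrary fixed schedules (possibly different for the two policies compared). The *round-robin* oracle schedules source $m\in\{1,\dots,M\}$ in slot $t\ge1$ on channel $((m+t)\bmod M)+1$; let $a^*_m(t)$ be its ages. The *DLF* policy works as follows at source $m$. It keeps for each channel $n$ an estimate $\hat\mu_n$ and a count $T_n$, all $0$ at the start. In the slots $1\le t\le N$ it uses channel $n=((m+t)\bmod L)+1$, sets $\hat\mu_n$ to the observed reward ($1$ for success, $0$ for failure) and $T_n=1$; here $L=N$ or $L=M$ (the statement holds for both). In slot $t>N$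 put $k=((m+t)\bmod M)+1$, let $\mathcal O_k$ be a set of $k$ channels with the $k$ largest values of $\hat\mu_n+\sqrt{2\log t/T_n}$, and use a channel $n\in\mathcal O_k$ that minimizes $\hat\mu_n-\sqrt{2\log t/T_n}$ (these values are $+\infty$ and $-\infty$ if $T_n=0$; ties are broken arbitrarily). If the source acquires the channel and gets reward $X\in\{0,1\}$, then $\hat\mu_n$ is replaced by $(\hat\mu_nT_n+X)/(T_n+1)$ and $T_n$ by $T_n+1$; otherwise nothing changes. Let $a^{\mathrm{DLF}}_m(t)$ be the ages under DLF and $$\mathcal R_{\mathrm{DLF}}(T)=\sum_{m=1}^M\sum_{t=1}^T\mathbb E\big[a^{\mathrm{DLF}}_m(t)-a^*_m(t)\big].$$ **Theorem 5 (Performance of DLF).** Let $\Delta=\min_{1\le i<j\le M}(\mu_i-\mu_j)$ be the minimal gap among the $M$ best channels and let $c>0$ be any constant. Then there is a $T_0$, depending only on $M,N,\mu_1,\dots,\mu_N$ and $c$, such that for all $T\ge T_0$ all the ages above are integrable and $$\mathcal R_{\mathrm{DLF}}(T)\le\frac{M^2}{\mu_{\min}}+\frac{M^2c\log T}{\mu_{\min}}\left[1+(N-1)\left(\frac{8\log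 T}{\Delta^2}+1+\frac{2\pi^2}{3}\right)\right].$$ In particular there is a constant $K$, depending only on $c$, $\mu_{\min}$ and $\Delta$, such that $\mathcal R_{\mathrm{DLF}}(T)\le K\,M^2N\log^2T$ for all $T\ge T_0$. -/

import Mathlib

/-!
Age of information with `M` sources and `N` channels.

Sources are `m : Fin M` and channels `n : Fin N`; the source with label `m` in `{1, …, M}` is the
element of `Fin M` with value `m - 1`, and likewise for channels.  Time slots are integers, and
decisions are taken in the slots `1, 2, 3, …`.
-/

namespace AoIBandit

open MeasureTheory ProbabilityTheory

/-! ### The channels and the collisions -/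

/-- The randomness of the system.  `X t n` says whether a transmission on channel `n` in slot `t`
would succeed.  `W t n S` is the source that acquires channel `n` in slot `t` if `S` is the set of
all sources that are scheduled on it: a uniformly random element of `S`.  All of this is
independent across channels and across time slots. -/
structure IsSystem {M N : ℕ} {Ω : Type*} [MeasurableSpace Ω] (P : Measure Ω) (μ : Fin N → ℝ)
    (X : ℤ → Fin N → Ω → Bool) (W : ℤ → Fin N → Ω → Finset (Fin M) → Fin M) : Prop where
  measurable_X : ∀ t n, Measurable (X t n)
  measurable_W : ∀ t n, Measurable (W t n)
  prob_X : ∀ t n, P {ω | X t n ω = true} = ENNReal.ofReal (μ n)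
  prob_W : ∀ t n (S : Finset (Fin M)), ∀ m ∈ S, P {ω | W t n ω S = m} = (S.card : ENNReal)⁻¹
  indep_X_W : ∀ t n, IndepFun (X t n) (W t n) P
  indep : iIndepFun (fun (p : ℤ × Fin N) (ω : Ω) => (X p.1 p.2 ω, W p.1 p.2 ω)) P

/-- Source `m` acquires the channel on which it is scheduled, where `a i` is the channel on which
source `i` is scheduled and `w` chooses the winners in this slot. -/
def Acquires {M N : ℕ} (w : Fin N → Finset (Fin M) → Fin M) (a : Fin M → Fin N) (m : Fin M) :
    Prop :=
  w (a m) (Finset.univ.filter fun i => a i = a m) = m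

/-- The update of source `m` succeeds. -/
def Succeeds {M N : ℕ} (x : Fin N → Bool) (w : Fin N → Finset (Fin M) → Fin M)
    (a : Fin M → Fin N) (m : Fin M) : Prop :=
  Acquires w a m ∧ x (a m) = true

/-- The age of information `t - u` of source `m` in slot `t` under the schedule `A`, where `u` is
the last slot before `t` in which the update of source `m` succeeded.  (It is `0` by convention in
the event, of probability zero, that there is no such slot.) -/
noncomputable def aoi {M N : ℕ} (x : ℤ → Fin N → Bool)
    (w : ℤ → Fin N → Finset (Fin M) → Fin M) (A : ℤ → Fin M → Fin N) (m : Fin M) (t : ℤ) : ℕ :=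
  sInf {j : ℕ | 0 < j ∧ Succeeds (x (t - j)) (w (t - j)) (A (t - j)) m}

/-! ### Round robin -/

/-- The number `(m + t) mod L` for the source with label `m`. -/
def rot {M : ℕ} (L : ℕ) (m : Fin M) (t : ℕ) : ℕ := ((m : ℕ) + 1 + t) % L

theorem rot_lt {M L : ℕ} (hL : M ≤ L) (m : Fin M) (t : ℕ) : rot L m t < L :=
  Nat.mod_lt _ (lt_of_lt_of_le m.pos hL)

/-- The channel with label `((m + t) mod L) + 1`. -/
def rrChannel {M N L : ℕ} (hML : M ≤ L) (hLN : L ≤ N) (m : Fin M) (t : ℕ) : Fin N :=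
  ⟨rot L m t, lt_of_lt_of_le (rot_lt hML m t) hLN⟩

/-- A schedule that is `past` up to slot `0` and is decided by `d` from slot `1` on. -/
def withPast {M N : ℕ} (past : ℤ → Fin M → Fin N) (d : ℕ → Fin M → Fin N) :
    ℤ → Fin M → Fin N :=
  fun t => if t ≤ 0 then past t else d t.toNat

/-! ### Distributed learning with fairness -/

/-- What a source remembers: its estimates of the success probabilities and the number of
observations on which each of them rests. -/
structure LocalState (N : ℕ) where
  est : Fin N → ℝ
  cnt : Fin N → ℕ

/-- Upper confidence index, `+∞` for a channel that was never observed. -/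
noncomputable def ucb {N : ℕ} (s : LocalState N) (t : ℕ) (n : Fin N) : EReal :=
  if s.cnt n = 0 then ⊤ else ((s.est n + √(2 * Real.log t / s.cnt n) : ℝ) : EReal)

/-- Lower confidence index, `-∞` for a channel that was never observed. -/
noncomputable def lcb {N : ℕ} (s : LocalState N) (t : ℕ) (n : Fin N) : EReal :=
  if s.cnt n = 0 then ⊥ else ((s.est n - √(2 * Real.log t / s.cnt n) : ℝ) : EReal)

/-- `n` minimizes the lower index over a set of `k` channels with the `k` largest upper indices. -/
def IsChoice {N : ℕ} (s : LocalState N) (t k : ℕ) (n : Fin N) : Prop :=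
  ∃ O : Finset (Fin N), O.card = k ∧ (∀ i ∈ O, ∀ j ∉ O, ucb s t j ≤ ucb s t i) ∧
    n ∈ O ∧ ∀ i ∈ O, lcb s t n ≤ lcb s t i

/-- A decision rule for the slots after the initialization, which breaks the ties in `IsChoice`
in an arbitrary way (that may depend on the source, the slot and what the source remembers). -/
def IsRule {M N : ℕ} (σ : Fin M → ℕ → LocalState N → Fin N) : Prop :=
  ∀ m t s, N < t → IsChoice s t (rot M m t + 1) (σ m t s)

/-- The channel that source `m` selects in slot `t ≥ 1`: one initialization of `N` slots, in which
the channels with labels `1, …, L` are taken cyclically, and the rule `σ` afterwards. -/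
def dlfSelect {M N L : ℕ} (hML : M ≤ L) (hLN : L ≤ N) (σ : Fin M → ℕ → LocalState N → Fin N)
    (t : ℕ) (s : Fin M → LocalState N) (m : Fin M) : Fin N :=
  if t ≤ N then rrChannel hML hLN m t else σ m t (s m)

/-- The states of all sources at the end of slot `t`. In the initialization, in which there are no
collisions, the last observation of a channel is kept; afterwards estimate and count are updated
exactly when the channel was acquired. -/
noncomputable def dlfState {M N L : ℕ} (hML : M ≤ L) (hLN : L ≤ N)
    (σ : Fin M → ℕ → LocalState N → Fin N) (x : ℤ → Fin N → Bool)
    (w : ℤ → Fin N → Finset (Fin M) → Fin M) : ℕ → Fin M → LocalState N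
  | 0 => fun _ => ⟨fun _ => 0, fun _ => 0⟩
  | t + 1 => fun m =>
      let prev := dlfState hML hLN σ x w t
      let a := dlfSelect hML hLN σ (t + 1) prev
      let n := a m
      let reward : ℝ := if x ((t + 1 : ℕ) : ℤ) n = true then 1 else 0
      open Classical in
      if t + 1 ≤ N then
        ⟨Function.update (prev m).est n reward, Function.update (prev m).cnt n 1⟩
      else if Acquires (w ((t + 1 : ℕ) : ℤ)) a m then
        ⟨Function.update (prev m).est n
            (((prev m).est n * (prev m).cnt n + reward) / ((prev m).cnt n + 1)),
          Function.update (prev m).cnt n ((prev m).cnt n + 1)⟩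
      else prev m

/-- The channels selected by DLF in slot `t ≥ 1`. -/
noncomputable def dlfDecision {M N L : ℕ} (hML : M ≤ L) (hLN : L ≤ N)
    (σ : Fin M → ℕ → LocalState N → Fin N) (x : ℤ → Fin N → Bool)
    (w : ℤ → Fin N → Finset (Fin M) → Fin M) (t : ℕ) (m : Fin M) : Fin N :=
  dlfSelect hML hLN σ t (dlfState hML hLN σ x w (t - 1)) m

/-! ### Ages and regret -/

/-- The age of source `m` in slot `t` under DLF. -/
noncomputable def dlfAge {M N L : ℕ} {Ω : Type*} (hML : M ≤ L) (hLN : L ≤ N)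
    (X : ℤ → Fin N → Ω → Bool) (W : ℤ → Fin N → Ω → Finset (Fin M) → Fin M)
    (σ : Fin M → ℕ → LocalState N → Fin N) (past : ℤ → Fin M → Fin N)
    (m : Fin M) (t : ℤ) (ω : Ω) : ℝ :=
  aoi (fun s n => X s n ω) (fun s n => W s n ω)
    (withPast past (dlfDecision hML hLN σ (fun s n => X s n ω) (fun s n => W s n ω))) m t

/-- The age of source `m` in slot `t` under the oracle, the round-robin policy that schedules
source `m` on channel `((m + t) mod M) + 1`. -/
noncomputable def oracleAge {M N : ℕ} {Ω : Type*} (hMN : M ≤ N)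
    (X : ℤ → Fin N → Ω → Bool) (W : ℤ → Fin N → Ω → Finset (Fin M) → Fin M)
    (past : ℤ → Fin M → Fin N) (m : Fin M) (t : ℤ) (ω : Ω) : ℝ :=
  aoi (fun s n => X s n ω) (fun s n => W s n ω)
    (withPast past fun s i => rrChannel le_rfl hMN i s) m t

/-- Regret up to slot `T` of the ages `a` against the ages `b`. -/
noncomputable def regret {M : ℕ} {Ω : Type*} [MeasurableSpace Ω] (P : Measure Ω)
    (a b : Fin M → ℤ → Ω → ℝ) (T : ℕ) : ℝ :=
  ∑ m, ∑ t ∈ Finset.Icc (1 : ℤ) T, ∫ ω, (a m t ω - b m t ω) ∂P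

end AoIBandit

namespace AoIBandit

set_option linter.unusedSectionVars false

open MeasureTheory ProbabilityTheory
open scoped ENNReal

/-! ### Ties between upper confidence indices -/

/-! The constant `c` may be arbitrarily small, so a regret of order log² T with an uncontrolled
constant is not enough. The proof shows that the regret is o(log² T); both claimed bounds follow,
the second one with constant 1.

Coupling. Let both policies see the same channel outcomes. If the schedules agree in the last slot
in which the oracle succeeded, DLF succeeded there as well and its age is no larger. An excess of
age in slot t therefore stems from a slot u in which the schedules differ and after which the oracle
only fails, and it is at most t - u plus the DLF age in u (`ageOf_le_ageOf_add`). Whatever the past,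
a run of failures has geometrically small probability. So the regret is at most a constant times the
sum over the slots s of the mean DLF age in s on the event that the schedules differ in s
(`IsSystem.regret_ageOf_le`).

Gaining a small factor. Confidence bounds yield O(log T) deviating slots, and ages are O(log T) up
to negligible tails, which only gives O(log² T). The gain comes from near independence of deviation
and age. On a typical configuration all slots after a fixed `s₁` are regular (`exists_isRegular`): a
source can deviate only when its turn is on channel M, and then it takes the channel of largest
upper index among M, ..., N. Hence the exploration after `s₁` is driven by the rewards of these
channels alone (`explore`) and is independent of the later rewards of channel 1, since M ≥ 2. A
source that has failed for h slots missed about h/M turns on channel 1, which costs a factor (1 -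
μ₁)^(h/M) independently of the deviation (`IsSystem.prob_isBad_and_fails_le`). With h a large
constant, the ages below h contribute O(log T) and the others a small multiple of log² T
(`IsSystem.sum_deviationAge_le`).

Why slots become regular. The M best channels are observed linearly often. A worse channel n must
not dominate channel M (larger upper and smaller lower index) whenever channel M is chosen, and this
happens in the second half of every interval 1, ..., s. So n has been observed often enough for its
upper index to stay below that of channel M - 1 (`GoodPath.ucb_rest_lt`).

Ties. Ties may be broken by anything a source remembers, including its data on channel 1, which
would destroy independence. They do not occur late on typical configurations: with equal counts they
would equate estimates of different means, and with different counts they would make t² the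
exponential of a nonzero real quadratic number, against Lindemann–Weierstrass
(`index_ne_of_count_ne`). -/

open Polynomial in
theorem exists_int_aeval_mul_pow (p : ℤ[X]) (D k : ℕ) (hD : p.natDegree ≤ D) (t : ℕ → ℤ)
    {ι : Type*} (s : Finset ι) (x : ι → ℂ)
    (hx : ∀ i, ∑ j ∈ s, ((k : ℂ) * x j) ^ i = t i) :
    ∃ I : ℤ, (k : ℂ) ^ D * ∑ j ∈ s, aeval (x j) p = I := by
  -- The term of degree `i` uses `k ^ i` to make the power sum of the `x j` the integer `t i`; `k ^
  -- (D - i)` is left over.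
  refine ⟨∑ i ∈ Finset.range (D + 1), p.coeff i * (k : ℤ) ^ (D - i) * t i, ?_⟩
  simp_rw [aeval_eq_sum_range' (Nat.lt_succ_of_le hD)]
  rw [Finset.sum_comm, Finset.mul_sum]
  push_cast
  refine Finset.sum_congr rfl fun i hi => ?_
  rw [← hx i, Finset.mul_sum, Finset.mul_sum]
  refine Finset.sum_congr rfl fun j _ => ?_
  have : (k : ℂ) ^ D = (k : ℂ) ^ (D - i) * (k : ℂ) ^ i := by
    rw [← pow_add, Nat.sub_add_cancel (Nat.lt_succ_iff.mp (Finset.mem_range.mp hi))]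
  rw [this, mul_pow]
  simp only [zsmul_eq_mul]
  ring

/-- Conjugation `√d ↦ -√d` respects powers. Adding the two identities makes the power sums of a
conjugate pair integers, as `exists_int_aeval_mul_pow` requires. -/
theorem exists_int_conj_pow (a b : ℤ) (d : ℕ) (i : ℕ) :
    ∃ u v : ℤ, ((a : ℝ) + b * √d) ^ i = u + v * √d ∧ ((a : ℝ) - b * √d) ^ i = u - v * √d := by
  induction i with
  | zero => exact ⟨1, 0, by simp, by simp⟩
  | succ i ih =>
    obtain ⟨u, v, h1, h2⟩ := ih
    have hd : √(d : ℝ) * √d = d := Real.mul_self_sqrt (Nat.cast_nonneg d)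
    refine ⟨u * a + v * b * d, u * b + v * a, ?_, ?_⟩
    · rw [pow_succ, h1]; push_cast; linear_combination (v : ℝ) * b * hd
    · rw [pow_succ, h2]; push_cast; linear_combination (v : ℝ) * b * hd

open Polynomial in
/-- The exponential of a real quadratic number is not a natural number. -/
theorem exp_quadratic_ne_natCast (a b : ℤ) (d k S : ℕ) (hk : 0 < k) (ha : a ≠ 0)
    (hab : a ^ 2 ≠ b ^ 2 * d) : Real.exp ((a + b * √d) / k) ≠ S := by
  intro hS
  have hS0 : S ≠ 0 := by rintro rfl; simp at hS
  have hk' : (k : ℂ) ≠ 0 := by exact_mod_cast hk.ne'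
  have hkr : (k : ℝ) ≠ 0 := by exact_mod_cast hk.ne'
  have hd : √(d : ℝ) * √d = d := Real.mul_self_sqrt (Nat.cast_nonneg d)
  set α : ℝ := (a + b * √d) / k with hα
  set α' : ℝ := (a - b * √d) / k with hα'
  set γ : ℝ := (2 * a) / k with hγ
  have hsum : α + α' = γ := by rw [hα, hα', hγ]; ring
  -- An integer polynomial that vanishes at `α`, its conjugate `α'` and their sum `γ`. The
  -- conditions on `a` and `b` say that its constant term, hence each of these roots, is nonzero.
  set f : ℤ[X] := (C ((k : ℤ) ^ 2) * X ^ 2 - C (2 * a * k) * X + C (a ^ 2 - b ^ 2 * d)) *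
    (C (k : ℤ) * X - C (2 * a)) with hf
  have hf0 : f.eval 0 ≠ 0 := by
    simp only [hf, eval_mul, eval_add, eval_sub, eval_C, eval_X, eval_pow]
    have h1 : a ^ 2 - b ^ 2 * d ≠ 0 := sub_ne_zero.mpr hab
    simp [h1, ha]
  have hfne : f ≠ 0 := by rintro h; rw [h] at hf0; simp at hf0
  have root : ∀ x : ℝ, (((k : ℝ) * x - a) ^ 2 - b ^ 2 * d) * (k * x - 2 * a) = 0 →
      (x : ℂ) ∈ f.aroots ℂ := by
    intro x hx
    rw [mem_aroots]
    refine ⟨hfne, ?_⟩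
    have hx' : ((((k : ℝ) * x - a) ^ 2 - b ^ 2 * d) * (k * x - 2 * a) : ℂ) = 0 := by
      exact_mod_cast hx
    simp only [hf, map_mul, map_add, map_sub, aeval_C, aeval_X, map_pow]
    simp only [algebraMap_int_eq, eq_intCast]
    push_cast
    rw [← hx']
    push_cast
    ring
  have hkα : (k : ℝ) * α = a + b * √d := by rw [hα]; field_simp
  have hkα' : (k : ℝ) * α' = a - b * √d := by rw [hα']; field_simp
  have hkγ : (k : ℝ) * γ = 2 * a := by rw [hγ]; field_simp
  have r1 := root α (by rw [hkα]; linear_combination (b : ℝ) ^ 2 * (a + b * √d - 2 * a) * hd)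
  have r2 := root α' (by rw [hkα']; linear_combination (b : ℝ) ^ 2 * (a - b * √d - 2 * a) * hd)
  have r3 := root γ (by rw [hkγ]; ring)
  -- Hermite's approximation: for every large prime `p` there are an integer `n` prime to `p` and an
  -- integer polynomial `gp` such that `n * exp x` is within `c ^ p / (p - 1)!` of `p * gp x` at all
  -- roots of `f`.
  obtain ⟨c, hc⟩ := LindemannWeierstrass.exp_polynomial_approx f hf0
  set nd := f.natDegree with hnd
  set B : ℝ := (k : ℝ) ^ nd * |c| with hB
  have hlim : Filter.Tendsto (fun p : ℕ => (2 * S + 1) * B * (B ^ (p - 1) / ((p - 1).factorial : ℝ)))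
      Filter.atTop (nhds 0) := by
    have := (FloorSemiring.tendsto_pow_div_factorial_atTop B).comp
      (Filter.tendsto_sub_atTop_nat 1)
    simpa using this.const_mul ((2 * S + 1) * B)
  obtain ⟨p0, hp0⟩ := Filter.eventually_atTop.mp (hlim.eventually (gt_mem_nhds one_pos))
  obtain ⟨p, hpge, hp⟩ := Nat.exists_infinite_primes (p0 + (eval 0 f).natAbs + S + k + 1)
  obtain ⟨n, hpn, gp, hgp, happ⟩ := hc p (by omega) hp
  have hD : gp.natDegree ≤ p * nd := hgp.trans (Nat.sub_le _ _)
  choose u v huv using exists_int_conj_pow a b d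
  obtain ⟨I1, hI1⟩ := exists_int_aeval_mul_pow gp (p * nd) k hD (fun i => 2 * u i) Finset.univ
    (![(α : ℂ), (α' : ℂ)]) (by
      intro i
      have h1 : ((k : ℝ) * α) ^ i + ((k : ℝ) * α') ^ i = 2 * u i := by
        rw [hkα, hkα', (huv i).1, (huv i).2]; ring
      simp only [Fin.sum_univ_two, Matrix.cons_val_zero, Matrix.cons_val_one]
      exact_mod_cast h1)
  obtain ⟨I2, hI2⟩ := exists_int_aeval_mul_pow gp (p * nd) k hD (fun i => (2 * a) ^ i)
    (Finset.univ : Finset (Fin 1)) (fun _ => (γ : ℂ)) (by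
      intro i
      have h1 : ((k : ℝ) * γ) ^ i = (2 * a) ^ i := by rw [hkγ]
      simp only [Finset.univ_unique, Finset.sum_singleton]
      exact_mod_cast h1)
  simp only [Fin.sum_univ_two, Matrix.cons_val_zero, Matrix.cons_val_one] at hI1
  simp only [Finset.univ_unique, Finset.sum_singleton] at hI2
  have hSα : Complex.exp (α : ℂ) = S := by rw [← Complex.ofReal_exp, hS]; simp
  -- With `exp α = S` and `exp γ = exp α * exp α'` this is an integer linear relation between 1 and
  -- the exponentials of the roots, symmetric in `α` and `α'`.
  have hrel : (S : ℂ) ^ 2 - S * Complex.exp (α : ℂ) - S * Complex.exp (α' : ℂ)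
      + Complex.exp (γ : ℂ) = 0 := by
    rw [← hsum, Complex.ofReal_add, Complex.exp_add, hSα]; ring
  -- The relation with the exponentials replaced by their approximations and denominators cleared by
  -- a power of `k`. This integer is nonzero because all summands but the first are divisible by
  -- `p`; yet its size tends to zero as `p` grows.
  set J : ℤ := n * (S : ℤ) ^ 2 * (k : ℤ) ^ (p * nd) - S * p * I1 + p * I2 with hJ
  set ε := c ^ p / ((p - 1).factorial : ℝ) with hε
  have e1 : ‖n • Complex.exp (α : ℂ) - p • aeval (α : ℂ) gp‖ ≤ ε := happ r1
  have e2 : ‖n • Complex.exp (α' : ℂ) - p • aeval (α' : ℂ) gp‖ ≤ ε := happ r2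
  have e3 : ‖n • Complex.exp (γ : ℂ) - p • aeval (γ : ℂ) gp‖ ≤ ε := happ r3
  have hJe : (J : ℂ) = (k : ℂ) ^ (p * nd) *
      (S * (n • Complex.exp (α : ℂ) - p • aeval (α : ℂ) gp)
        + S * (n • Complex.exp (α' : ℂ) - p • aeval (α' : ℂ) gp)
        - (n • Complex.exp (γ : ℂ) - p • aeval (γ : ℂ) gp)) := by
    simp only [hJ, zsmul_eq_mul, nsmul_eq_mul]
    push_cast
    rw [← hI1, ← hI2]
    linear_combination (n : ℂ) * (k : ℂ) ^ (p * nd) * hrel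
  have hJ0 : J ≠ 0 := by
    intro h0
    have hdvd : (p : ℤ) ∣ n * (S : ℤ) ^ 2 * (k : ℤ) ^ (p * nd) := by
      refine ⟨S * I1 - I2, ?_⟩
      linear_combination h0
    have hpp : Prime (p : ℤ) := Nat.prime_iff_prime_int.mp hp
    rcases hpp.dvd_or_dvd hdvd with h | h
    · rcases hpp.dvd_or_dvd h with h | h
      · exact hpn h
      · have := Nat.le_of_dvd (Nat.pos_of_ne_zero hS0)
          (Int.natCast_dvd_natCast.mp (hpp.dvd_of_dvd_pow h))
        omega
    · have := Nat.le_of_dvd hk (Int.natCast_dvd_natCast.mp (hpp.dvd_of_dvd_pow h))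
      omega
  have hJ1 : (1 : ℝ) ≤ ‖(J : ℂ)‖ := by
    rw [Complex.norm_intCast]
    exact_mod_cast Int.one_le_abs hJ0
  have hnormle : ‖(J : ℂ)‖ ≤ (k : ℝ) ^ (p * nd) * ((2 * S + 1) * ε) := by
    rw [hJe, norm_mul, norm_pow, Complex.norm_natCast]
    refine mul_le_mul_of_nonneg_left ?_ (by positivity)
    refine (norm_sub_le _ _).trans ?_
    refine (add_le_add (norm_add_le _ _) le_rfl).trans ?_
    rw [norm_mul, norm_mul, Complex.norm_natCast]
    have hSn : (0 : ℝ) ≤ S := Nat.cast_nonneg S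
    nlinarith [mul_le_mul_of_nonneg_left e1 hSn, mul_le_mul_of_nonneg_left e2 hSn]
  have hlt := hp0 p (by omega)
  have hp1 : p = (p - 1) + 1 := by have := hp.pos; omega
  have hεle : ε ≤ |c| ^ p / ((p - 1).factorial : ℝ) := by
    rw [hε, ← abs_pow]
    exact div_le_div_of_nonneg_right (le_abs_self _) (by positivity)
  have : (k : ℝ) ^ (p * nd) * ((2 * S + 1) * ε)
      ≤ (2 * S + 1) * B * (B ^ (p - 1) / ((p - 1).factorial : ℝ)) := by
    have hBp : B * B ^ (p - 1) = (k : ℝ) ^ (p * nd) * |c| ^ p := by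
      rw [← pow_succ', ← hp1, hB, mul_pow, ← pow_mul, mul_comm nd p]
    calc (k : ℝ) ^ (p * nd) * ((2 * S + 1) * ε)
        ≤ (k : ℝ) ^ (p * nd) * ((2 * S + 1) * (|c| ^ p / ((p - 1).factorial : ℝ))) := by
          gcongr
      _ = (2 * S + 1) * (((k : ℝ) ^ (p * nd) * |c| ^ p) / ((p - 1).factorial : ℝ)) := by ring
      _ = _ := by rw [← hBp]; ring
  linarith

/-- Two indices with rational estimates and different counts never agree. -/
theorem index_ne_of_count_ne {t c c' k k' : ℕ} (ht : 2 ≤ t) (hc : 0 < c) (hc' : 0 < c')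
    (hne : c ≠ c') {e e' : ℝ} (he : e * c = k) (he' : e' * c' = k') :
    e + √(2 * Real.log t / c) ≠ e' + √(2 * Real.log t / c') := by
  intro h
  have hcr : (0 : ℝ) < c := by exact_mod_cast hc
  have hcr' : (0 : ℝ) < c' := by exact_mod_cast hc'
  have hlog : 0 < Real.log t := Real.log_pos (by exact_mod_cast (by omega : 1 < t))
  have hner : (c : ℝ) ≠ c' := by exact_mod_cast hne
  set L := 2 * Real.log t with hL
  have hLpos : 0 < L := by positivity
  set s := √(c : ℝ) with hs
  set s' := √(c' : ℝ) with hs'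
  have hsp : 0 < s := Real.sqrt_pos.mpr hcr
  have hsp' : 0 < s' := Real.sqrt_pos.mpr hcr'
  have hss : s * s = c := Real.mul_self_sqrt hcr.le
  have hss' : s' * s' = c' := Real.mul_self_sqrt hcr'.le
  rw [Real.sqrt_div hLpos.le, Real.sqrt_div hLpos.le, ← hs, ← hs'] at h
  set l := √L with hl
  have hll : l * l = L := Real.mul_self_sqrt hLpos.le
  set m : ℤ := (k : ℤ) * c' - k' * c with hm
  have hmr : (m : ℝ) = (e - e') * c * c' := by
    rw [hm]; push_cast; rw [← he, ← he']; ring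
  have hsd : √((c * c' : ℕ) : ℝ) = s * s' := by
    rw [Nat.cast_mul, Real.sqrt_mul hcr.le]
  have h1 : (e - e') * (s * s') = l * (s - s') := by
    have : e - e' = l / s' - l / s := by linarith
    rw [this]; field_simp
  -- Squaring the tie shows that `2 * log t` is `m² (√c + √c')²` over an integer, a number of the
  -- quadratic ring generated by `√(c c')`, up to that denominator.
  have hlogL : L * (((c : ℝ) - c') ^ 2 * (c * c')) = m ^ 2 * (c + c' + 2 * (s * s')) := by
    have h2 : (e - e') ^ 2 * (c * c') * (s + s') ^ 2 = L * (c - c') ^ 2 := by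
      have : (e - e') ^ 2 * (c * c') = ((e - e') * (s * s')) ^ 2 := by
        rw [← hss, ← hss']; ring
      rw [this, h1, ← hll, ← hss, ← hss']; ring
    have h3 : (s + s') ^ 2 = c + c' + 2 * (s * s') := by rw [← hss, ← hss']; ring
    rw [← h3, hmr]
    linear_combination (-(c : ℝ) * c') * h2
  have hm0 : m ≠ 0 := by
    intro h0
    rw [h0] at hlogL
    have : 0 < L * (((c : ℝ) - c') ^ 2 * (c * c')) := by
      have := sq_pos_of_ne_zero (sub_ne_zero.mpr hner)
      positivity
    rw [hlogL] at this
    simp at this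
  have hkpos : 0 < (((c : ℤ) - c') ^ 2 * (c * c')).toNat := by
    have : 0 < ((c : ℤ) - c') ^ 2 * (c * c') := by
      have : (c : ℤ) - c' ≠ 0 := sub_ne_zero.mpr (by exact_mod_cast hne)
      positivity
    omega
  have hkcast : ((((c : ℤ) - c') ^ 2 * (c * c')).toNat : ℝ) = ((c : ℝ) - c') ^ 2 * (c * c') := by
    have : (((((c : ℤ) - c') ^ 2 * (c * c')).toNat : ℤ) : ℝ) = ((c : ℝ) - c') ^ 2 * (c * c') := by
      rw [Int.toNat_of_nonneg (by positivity)]; push_cast; ring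
    exact_mod_cast this
  refine exp_quadratic_ne_natCast (m ^ 2 * (c + c')) (2 * m ^ 2) (c * c') _ (t ^ 2) hkpos
    (mul_ne_zero (pow_ne_zero _ hm0) (by positivity)) ?_ ?_
  -- The norm of the quadratic number is a multiple of `(c + c')² - 4 c c' = (c - c')²`, so it does
  -- not vanish.
  · intro h0
    have h4 : (m ^ 2) ^ 2 * ((c : ℤ) - c') ^ 2 = 0 := by
      push_cast at h0
      linear_combination h0
    have : (c : ℤ) - c' ≠ 0 := sub_ne_zero.mpr (by exact_mod_cast hne)
    simp [hm0, this] at h4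
  · rw [hsd, hkcast]
    have : ((((m ^ 2 * (c + c') : ℤ) : ℝ) + ((2 * m ^ 2 : ℤ) : ℝ) * (s * s')) /
        (((c : ℝ) - c') ^ 2 * (c * c'))) = L := by
      rw [div_eq_iff]
      · rw [hlogL]; push_cast; ring
      · have := sq_pos_of_ne_zero (sub_ne_zero.mpr hner)
        positivity
    rw [this, hL]
    have htpos : (0 : ℝ) < t := by exact_mod_cast (by omega : 0 < t)
    rw [two_mul, Real.exp_add, Real.exp_log htpos]
    push_cast; ring

/-! ### Functions of finitely many independent discrete variables -/

section Independence

variable {Ω ι β : Type*} [MeasurableSpace Ω] {P : Measure Ω} [MeasurableSpace β] [Finite β]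
  [MeasurableSingletonClass β] {ζ : Ω → ι → β}

theorem measurable_comp_of_dependsOn {γ : Type*} [MeasurableSpace γ] [Nonempty γ]
    (hm : ∀ i, Measurable fun ω => ζ ω i) {A : Finset ι} {F : (ι → β) → γ}
    (hF : DependsOn F (A : Set ι)) : Measurable fun ω => F (ζ ω) := by
  obtain ⟨g, rfl⟩ := dependsOn_iff_exists_comp.mp hF
  exact (measurable_of_countable g).comp (measurable_pi_lambda _ fun i => hm i)

theorem measurableSet_of_dependsOn (hm : ∀ i, Measurable fun ω => ζ ω i) {A : Finset ι}
    {p : (ι → β) → Prop} (hp : DependsOn p (A : Set ι)) : MeasurableSet {ω | p (ζ ω)} :=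
  measurableSet_setOfPred.mpr (measurable_comp_of_dependsOn hm hp)

/-- Fubini for a function of a past and a present that are independent. -/
theorem lintegral_le_of_past [IsProbabilityMeasure P] (hm : ∀ i, Measurable fun ω => ζ ω i)
    (hi : iIndepFun (fun i ω => ζ ω i) P) {A B : Finset ι} (hAB : Disjoint A B) {π : Type*}
    {p : (ι → β) → π} (hp : DependsOn p (A : Set ι)) {Φ : π → (ι → β) → ℝ≥0∞}
    (hΦ : ∀ a, DependsOn (Φ a) (B : Set ι)) {G : π → ℝ≥0∞}
    (h : ∀ a, ∫⁻ ω, Φ a (ζ ω) ∂P ≤ G a) :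
    ∫⁻ ω, Φ (p (ζ ω)) (ζ ω) ∂P ≤ ∫⁻ ω, G (p (ζ ω)) ∂P := by
  classical
  have hne : Nonempty Ω := nonempty_of_isProbabilityMeasure P
  have : Nonempty π := ⟨p (ζ hne.some)⟩
  obtain ⟨p', hp'⟩ := dependsOn_iff_exists_comp.mp hp
  choose Φ' hΦ' using fun a => dependsOn_iff_exists_comp.mp (hΦ a)
  -- Past and present are functions of disjoint finite families of coordinates, whose joint law is a
  -- product; as `β` is finite, measurability of the functions is automatic.
  have hind := hi.indepFun_finset A B hAB hm
  have mA : Measurable fun ω (i : A) => ζ ω i := measurable_pi_lambda _ fun i => hm i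
  have mB : Measurable fun ω (i : B) => ζ ω i := measurable_pi_lambda _ fun i => hm i
  have hmap := (indepFun_iff_map_prod_eq_prod_map_map mA.aemeasurable mB.aemeasurable).mp hind
  let g : (A → β) × (B → β) → ℝ≥0∞ := fun q => Φ' (p' q.1) q.2
  have mg : Measurable g := measurable_of_countable g
  have e1 : ∀ ω, Φ (p (ζ ω)) (ζ ω) = g (fun i : A => ζ ω i, fun i : B => ζ ω i) := by
    intro ω
    have : Φ (p (ζ ω)) (ζ ω) = Φ' (p (ζ ω)) (fun i : B => ζ ω i) :=
      congrFun (hΦ' (p (ζ ω))) (ζ ω)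
    rw [this, hp']
    rfl
  simp_rw [e1]
  rw [← lintegral_map (f := g) (g := fun ω => ((fun i : A => ζ ω i), fun i : B => ζ ω i)) mg
    (mA.prodMk mB), hmap, lintegral_prod _ mg.aemeasurable,
    lintegral_map mg.lintegral_prod_right' mA]
  refine lintegral_mono fun ω => ?_
  rw [lintegral_map (f := fun y => g (fun i : A => ζ ω i, y)) (mg.comp measurable_prodMk_left) mB]
  refine le_trans (le_of_eq ?_) (h (p (ζ ω)))
  refine lintegral_congr fun ω' => ?_
  have : Φ (p (ζ ω)) (ζ ω') = Φ' (p (ζ ω)) (fun i : B => ζ ω' i) :=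
    congrFun (hΦ' (p (ζ ω))) (ζ ω')
  rw [this, hp']
  rfl

end Independence

/-! ### Configurations -/

/-- The outcome of a channel in a slot: its reward and its choice of the winner. -/
abbrev Outcome (M : ℕ) : Type := Bool × (Finset (Fin M) → Fin M)

/-- The outcomes of all channels in all slots. -/
abbrev Config (M N : ℕ) : Type := ℤ × Fin N → Outcome M

/-- The rewards in a configuration. -/
abbrev rewards {M N : ℕ} (z : Config M N) (t : ℤ) (n : Fin N) : Bool := (z (t, n)).1

/-- The winners in a configuration. -/
abbrev winners {M N : ℕ} (z : Config M N) (t : ℤ) (n : Fin N) : Finset (Fin M) → Fin M :=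
  (z (t, n)).2

/-- The configuration that belongs to a sample point. -/
abbrev outcomes {M N : ℕ} {Ω : Type*} (X : ℤ → Fin N → Ω → Bool)
    (W : ℤ → Fin N → Ω → Finset (Fin M) → Fin M) (ω : Ω) : Config M N :=
  fun p => (X p.1 p.2 ω, W p.1 p.2 ω)

/-- All channels in the slots from `a` to `b - 1`. -/
noncomputable def box (N : ℕ) (a b : ℤ) : Finset (ℤ × Fin N) := Finset.Ico a b ×ˢ Finset.univ

theorem mem_box {N : ℕ} {a b : ℤ} {p : ℤ × Fin N} : p ∈ box N a b ↔ a ≤ p.1 ∧ p.1 < b := by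
  simp [box]

theorem box_subset {N : ℕ} {a b a' b' : ℤ} (ha : a' ≤ a) (hb : b ≤ b') :
    (box N a b : Set (ℤ × Fin N)) ⊆ box N a' b' := by
  intro p hp
  simp only [Finset.mem_coe, mem_box] at hp ⊢
  omega

theorem disjoint_box {N : ℕ} {a b a' b' : ℤ} (h : b ≤ a') :
    Disjoint (box N a b) (box N a' b') := by
  rw [Finset.disjoint_left]
  intro p hp hp'
  rw [mem_box] at hp hp'
  omega

/-! ### Probabilities within a single slot -/

section Slot

variable {M N : ℕ} {Ω : Type*} [MeasurableSpace Ω] {P : Measure Ω} [IsProbabilityMeasure P]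
  {μ : Fin N → ℝ} {X : ℤ → Fin N → Ω → Bool} {W : ℤ → Fin N → Ω → Finset (Fin M) → Fin M}

theorem IsSystem.measurable_outcomes (hs : IsSystem P μ X W) (p : ℤ × Fin N) :
    Measurable fun ω => outcomes X W ω p :=
  (hs.measurable_X p.1 p.2).prodMk (hs.measurable_W p.1 p.2)

theorem IsSystem.measurableSet_outcomes (hs : IsSystem P μ X W) {A : Finset (ℤ × Fin N)}
    {p : Config M N → Prop} (hp : DependsOn p (A : Set (ℤ × Fin N))) :
    MeasurableSet {ω | p (outcomes X W ω)} :=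
  measurableSet_of_dependsOn hs.measurable_outcomes hp

theorem IsSystem.lintegral_le_of_past (hs : IsSystem P μ X W) {A B : Finset (ℤ × Fin N)}
    (hAB : Disjoint A B) {π : Type*} {p : Config M N → π}
    (hp : DependsOn p (A : Set (ℤ × Fin N))) {Φ : π → Config M N → ℝ≥0∞}
    (hΦ : ∀ a, DependsOn (Φ a) (B : Set (ℤ × Fin N))) {G : π → ℝ≥0∞}
    (h : ∀ a, ∫⁻ ω, Φ a (outcomes X W ω) ∂P ≤ G a) :
    ∫⁻ ω, Φ (p (outcomes X W ω)) (outcomes X W ω) ∂P ≤ ∫⁻ ω, G (p (outcomes X W ω)) ∂P :=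
  AoIBandit.lintegral_le_of_past hs.measurable_outcomes hs.indep hAB hp hΦ h

theorem IsSystem.real_prob_X (hs : IsSystem P μ X W) (hμ : ∀ n, 0 ≤ μ n) (t : ℤ) (n : Fin N) :
    P.real {ω | X t n ω = true} = μ n := by
  rw [measureReal_def, hs.prob_X, ENNReal.toReal_ofReal (hμ n)]

theorem IsSystem.measurableSet_acquires (hs : IsSystem P μ X W) (t : ℤ) (a : Fin M → Fin N)
    (m : Fin M) : MeasurableSet {ω | Acquires (fun n => W t n ω) a m} := by
  have : Measurable fun ω => W t (a m) ω (Finset.univ.filter fun i => a i = a m) :=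
    (measurable_pi_apply _).comp (hs.measurable_W t (a m))
  exact this (measurableSet_singleton m)

/-- The winner is uniform among at most `M` competitors. -/
theorem IsSystem.inv_le_prob_acquires (hs : IsSystem P μ X W) (t : ℤ) (a : Fin M → Fin N)
    (m : Fin M) : (M : ℝ)⁻¹ ≤ P.real {ω | Acquires (fun n => W t n ω) a m} := by
  have h := hs.prob_W t (a m) (Finset.univ.filter fun i => a i = a m) m (by simp)
  have hle : (Finset.univ.filter fun i => a i = a m).card ≤ M :=
    (Finset.card_le_univ _).trans (by simp)
  have hpos : 0 < (Finset.univ.filter fun i => a i = a m).card :=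
    Finset.card_pos.mpr ⟨m, by simp⟩
  have : P {ω | Acquires (fun n => W t n ω) a m} = _ := h
  rw [measureReal_def, this, ENNReal.toReal_inv, ENNReal.toReal_natCast]
  gcongr

theorem IsSystem.prob_succeeds (hs : IsSystem P μ X W) (hμ : ∀ n, 0 ≤ μ n) (t : ℤ)
    (a : Fin M → Fin N) (m : Fin M) :
    P.real {ω | Succeeds (fun n => X t n ω) (fun n => W t n ω) a m}
      = P.real {ω | Acquires (fun n => W t n ω) a m} * μ (a m) := by
  have h := (hs.indep_X_W t (a m)).measure_inter_preimage_eq_mul {true}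
    {f | f (Finset.univ.filter fun i => a i = a m) = m}
    (Set.toFinite _).measurableSet (Set.toFinite _).measurableSet
  rw [← hs.real_prob_X hμ t (a m), measureReal_def, measureReal_def, measureReal_def,
    ← ENNReal.toReal_mul, mul_comm]
  refine congrArg _ (Eq.trans ?_ h)
  congr 1
  ext ω
  simp only [Succeeds, Acquires, Set.mem_ofPred_eq, Set.mem_inter_iff, Set.mem_preimage,
    Set.mem_singleton_iff]
  exact and_comm

theorem IsSystem.measurableSet_succeeds (hs : IsSystem P μ X W) (t : ℤ) (a : Fin M → Fin N)
    (m : Fin M) :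
    MeasurableSet {ω | Succeeds (fun n => X t n ω) (fun n => W t n ω) a m} :=
  (hs.measurableSet_acquires t a m).inter (hs.measurable_X t (a m) (measurableSet_singleton true))

/-- In every slot and under every schedule a source fails with probability at most
`1 - μmin / M`. -/
theorem IsSystem.prob_not_succeeds_le (hs : IsSystem P μ X W) {μmin : ℝ} (h0 : 0 ≤ μmin)
    (hμ : ∀ n, μmin ≤ μ n) (t : ℤ) (a : Fin M → Fin N) (m : Fin M) :
    P {ω | ¬ Succeeds (fun n => X t n ω) (fun n => W t n ω) a m}
      ≤ ENNReal.ofReal (1 - μmin / M) := by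
  have hms := hs.measurableSet_succeeds t a m
  have hc : P.real {ω | ¬ Succeeds (fun n => X t n ω) (fun n => W t n ω) a m}
      = 1 - P.real {ω | Succeeds (fun n => X t n ω) (fun n => W t n ω) a m} :=
    probReal_compl_eq_one_sub hms
  rw [← ofReal_measureReal (μ := P)]
  refine ENNReal.ofReal_le_ofReal ?_
  rw [hc, hs.prob_succeeds (fun n => h0.trans (hμ n))]
  have h1 := hs.inv_le_prob_acquires t a m
  have : μmin / M ≤ P.real {ω | Acquires (fun n => W t n ω) a m} * μ (a m) := by
    rw [div_eq_inv_mul]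
    exact mul_le_mul h1 (hμ _) h0 measureReal_nonneg
  linarith

/-- Hoeffding's bound for a reward. -/
theorem IsSystem.lintegral_exp_reward_le (hs : IsSystem P μ X W) (hμ : ∀ n, 0 ≤ μ n) (t : ℤ)
    (n : Fin N) (l : ℝ) :
    ∫⁻ ω, ENNReal.ofReal (Real.exp (l * ((if X t n ω = true then 1 else 0) - μ n) - l ^ 2 / 8)) ∂P
      ≤ 1 := by
  set Y : Ω → ℝ := fun ω => if X t n ω = true then 1 else 0 with hY
  have hXm : MeasurableSet {ω | X t n ω = true} := hs.measurable_X t n (measurableSet_singleton _)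
  have hYm : Measurable Y := Measurable.ite hXm measurable_const measurable_const
  have hint : ∫ ω, Y ω ∂P = μ n := by
    have : Y = Set.indicator {ω | X t n ω = true} 1 := by
      ext ω; simp [hY, Set.indicator_apply]
    rw [this, integral_indicator_one hXm, hs.real_prob_X hμ]
  have hsub := hasSubgaussianMGF_of_mem_Icc (μ := P) (X := Y) (a := 0) (b := 1) hYm.aemeasurable
    (Filter.Eventually.of_forall fun ω => by by_cases h : X t n ω = true <;> simp [hY, h])
  rw [hint] at hsub
  have hle := hsub.mgf_le l
  have hexp : Integrable (fun ω => Real.exp (l * (Y ω - μ n))) P := hsub.integrable_exp_mul l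
  -- The sub-Gaussian constant of a variable with values in `[0, 1]` is `1 / 4`, whence the
  -- compensator `l ^ 2 / 8`.
  have hc : ((‖(1 : ℝ) - 0‖₊ / 2) ^ 2 : NNReal) * l ^ 2 / 2 = l ^ 2 / 8 := by
    push_cast; norm_num; ring
  rw [← ofReal_integral_eq_lintegral_ofReal]
  · rw [← ENNReal.ofReal_one]
    refine ENNReal.ofReal_le_ofReal ?_
    simp_rw [sub_eq_add_neg _ (l ^ 2 / 8), Real.exp_add]
    rw [integral_mul_const]
    have : ∫ ω, Real.exp (l * (Y ω - μ n)) ∂P ≤ Real.exp (l ^ 2 / 8) := by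
      rw [← hc]; exact hle
    calc _ ≤ Real.exp (l ^ 2 / 8) * Real.exp (-(l ^ 2 / 8)) :=
          mul_le_mul_of_nonneg_right this (Real.exp_pos _).le
      _ = 1 := by rw [← Real.exp_add]; simp
  · simp_rw [sub_eq_add_neg _ (l ^ 2 / 8), Real.exp_add]
    exact hexp.mul_const _
  · exact Filter.Eventually.of_forall fun ω => (Real.exp_pos _).le

/-- Hoeffding's bound for a reward that counts only if the channel is acquired. -/
theorem IsSystem.lintegral_exp_acquired_le (hs : IsSystem P μ X W) (hμ : ∀ n, 0 ≤ μ n) (t : ℤ)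
    (a : Fin M → Fin N) (m : Fin M) (l : ℝ) [∀ ω, Decidable (Acquires (fun n => W t n ω) a m)] :
    ∫⁻ ω, (if Acquires (fun n => W t n ω) a m then
        ENNReal.ofReal (Real.exp (l * ((if X t (a m) ω = true then 1 else 0) - μ (a m))
          - l ^ 2 / 8)) else 1) ∂P ≤ 1 := by
  classical
  set φ : Bool → ℝ≥0∞ := fun b =>
    ENNReal.ofReal (Real.exp (l * ((if b = true then 1 else 0) - μ (a m)) - l ^ 2 / 8)) with hφ
  set A : Set (Finset (Fin M) → Fin M) := {f | f (Finset.univ.filter fun i => a i = a m) = m}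
    with hA
  have hAm : MeasurableSet A := (Set.toFinite _).measurableSet
  -- Winner and reward of a channel are independent, so acquisition does not bias the reward that is
  -- seen.
  have hind : IndepFun (fun ω => A.indicator (fun _ => (1 : ℝ≥0∞)) (W t (a m) ω))
      (fun ω => φ (X t (a m) ω)) P :=
    (hs.indep_X_W t (a m)).symm.comp (measurable_const.indicator hAm) (measurable_of_finite φ)
  have e : ∀ ω, (if Acquires (fun n => W t n ω) a m then φ (X t (a m) ω) else 1)
      = A.indicator (fun _ => (1 : ℝ≥0∞)) (W t (a m) ω) * φ (X t (a m) ω)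
        + Aᶜ.indicator (fun _ => (1 : ℝ≥0∞)) (W t (a m) ω) := by
    intro ω
    by_cases h : W t (a m) ω ∈ A
    · have h' : Acquires (fun n => W t n ω) a m := h
      simp [h, h']
    · have h' : ¬ Acquires (fun n => W t n ω) a m := h
      simp [h, h']
  have m1 : Measurable fun ω => A.indicator (fun _ => (1 : ℝ≥0∞)) (W t (a m) ω) :=
    (measurable_const.indicator hAm).comp (hs.measurable_W t (a m))
  have m1' : Measurable fun ω => Aᶜ.indicator (fun _ => (1 : ℝ≥0∞)) (W t (a m) ω) :=
    (measurable_const.indicator hAm.compl).comp (hs.measurable_W t (a m))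
  have m2 : Measurable fun ω => φ (X t (a m) ω) :=
    (measurable_of_finite φ).comp (hs.measurable_X t (a m))
  have hmain : ∫⁻ ω, (if Acquires (fun n => W t n ω) a m then φ (X t (a m) ω) else 1) ∂P ≤ 1 := by
    simp_rw [e]
    have m12 : Measurable fun ω =>
        A.indicator (fun _ => (1 : ℝ≥0∞)) (W t (a m) ω) * φ (X t (a m) ω) := m1.mul m2
    rw [lintegral_add_left m12]
    have hprod := lintegral_mul_eq_lintegral_mul_lintegral_of_indepFun m1 m2 hind
    have hprod' : ∫⁻ ω, A.indicator (fun _ => (1 : ℝ≥0∞)) (W t (a m) ω) * φ (X t (a m) ω) ∂P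
        = (∫⁻ ω, A.indicator (fun _ => (1 : ℝ≥0∞)) (W t (a m) ω) ∂P) * ∫⁻ ω, φ (X t (a m) ω) ∂P := hprod
    rw [hprod']
    have h1 := hs.lintegral_exp_reward_le hμ t (a m) l
    calc _ ≤ (∫⁻ ω, A.indicator (fun _ => (1 : ℝ≥0∞)) (W t (a m) ω) ∂P) * 1
          + ∫⁻ ω, Aᶜ.indicator (fun _ => (1 : ℝ≥0∞)) (W t (a m) ω) ∂P := by
          gcongr
      _ = 1 := by
          rw [mul_one, ← lintegral_add_left m1]
          have : ∀ ω, A.indicator (fun _ => (1 : ℝ≥0∞)) (W t (a m) ω)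
              + Aᶜ.indicator (fun _ => (1 : ℝ≥0∞)) (W t (a m) ω) = 1 := by
            intro ω
            by_cases h : W t (a m) ω ∈ A <;> simp [h]
          simp [this]
  convert hmain using 3

/-- A function that is worth `1/2` if the channel is acquired and `1` otherwise. -/
theorem IsSystem.lintegral_half_acquired_le (hs : IsSystem P μ X W) (t : ℤ)
    (a : Fin M → Fin N) (m : Fin M) [∀ ω, Decidable (Acquires (fun n => W t n ω) a m)] :
    ∫⁻ ω, (if Acquires (fun n => W t n ω) a m then ENNReal.ofReal (1 / 2) else 1) ∂P
      ≤ ENNReal.ofReal (1 - 1 / (2 * M)) := by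
  have hA := hs.measurableSet_acquires t a m
  set A := {ω | Acquires (fun n => W t n ω) a m} with hAdef
  have e : ∀ ω, (if Acquires (fun n => W t n ω) a m then ENNReal.ofReal (1 / 2) else 1)
      = A.indicator (fun _ => ENNReal.ofReal (1 / 2)) ω + Aᶜ.indicator (fun _ => 1) ω := by
    intro ω
    by_cases h : Acquires (fun n => W t n ω) a m
    · have : ω ∈ A := h
      simp [h, this]
    · have : ω ∉ A := h
      simp [h, this]
  simp_rw [e]
  rw [lintegral_add_left (measurable_const.indicator hA), lintegral_indicator_const hA,
    lintegral_indicator_const hA.compl, one_mul, ← ofReal_measureReal (μ := P),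
    ← ofReal_measureReal (μ := P) (s := Aᶜ),
    ← ENNReal.ofReal_mul (by norm_num), ← ENNReal.ofReal_add (by positivity) (by positivity)]
  refine ENNReal.ofReal_le_ofReal ?_
  rw [probReal_compl_eq_one_sub hA]
  have := hs.inv_le_prob_acquires t a m
  have h2 : 1 / (2 * (M : ℝ)) = (M : ℝ)⁻¹ / 2 := by rw [one_div, mul_inv]; ring
  rw [h2]
  linarith

theorem IsSystem.ae_winner_singleton (hs : IsSystem P μ X W) :
    ∀ᵐ ω ∂P, ∀ t n m, W t n ω {m} = m := by
  simp_rw [ae_all_iff]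
  intro t n m
  have h := hs.prob_W t n {m} m (by simp)
  have hm : MeasurableSet {ω | W t n ω {m} = m} :=
    ((measurable_pi_apply _).comp (hs.measurable_W t n)) (measurableSet_singleton m)
  rw [Finset.card_singleton, Nat.cast_one, inv_one] at h
  exact (mem_ae_iff_prob_eq_one hm).mpr h

end Slot

/-! ### DLF as a function of the configuration -/

section Dynamics

variable {M N L : ℕ} (hML : M ≤ L) (hLN : L ≤ N) (σ : Fin M → ℕ → LocalState N → Fin N)

/-- One step of DLF. -/
noncomputable def dlfStep (t : ℕ) (prev : Fin M → LocalState N) (x : Fin N → Bool)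
    (w : Fin N → Finset (Fin M) → Fin M) (m : Fin M) : LocalState N :=
  let a := dlfSelect hML hLN σ t prev
  let n := a m
  let reward : ℝ := if x n = true then 1 else 0
  open Classical in
  if t ≤ N then
    ⟨Function.update (prev m).est n reward, Function.update (prev m).cnt n 1⟩
  else if Acquires w a m then
    ⟨Function.update (prev m).est n
        (((prev m).est n * (prev m).cnt n + reward) / ((prev m).cnt n + 1)),
      Function.update (prev m).cnt n ((prev m).cnt n + 1)⟩
  else prev m

/-- The states of DLF at the end of slot `t`. -/
noncomputable def stateOf (t : ℕ) (z : Config M N) : Fin M → LocalState N :=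
  dlfState hML hLN σ (rewards z) (winners z) t

/-- The channels selected by DLF in slot `t`. -/
noncomputable def decisionOf (t : ℕ) (z : Config M N) : Fin M → Fin N :=
  dlfDecision hML hLN σ (rewards z) (winners z) t

theorem stateOf_zero (z : Config M N) :
    stateOf hML hLN σ 0 z = fun _ => ⟨fun _ => 0, fun _ => 0⟩ := rfl

theorem stateOf_succ (t : ℕ) (z : Config M N) :
    stateOf hML hLN σ (t + 1) z = dlfStep hML hLN σ (t + 1) (stateOf hML hLN σ t z)
      (rewards z ((t + 1 : ℕ) : ℤ)) (winners z ((t + 1 : ℕ) : ℤ)) := rfl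

theorem decisionOf_succ (t : ℕ) (z : Config M N) :
    decisionOf hML hLN σ (t + 1) z = dlfSelect hML hLN σ (t + 1) (stateOf hML hLN σ t z) := rfl

theorem dependsOn_stateOf (t : ℕ) :
    DependsOn (stateOf hML hLN σ t) (box N 1 (t + 1) : Set (ℤ × Fin N)) := by
  induction t with
  | zero => intro z z' _; rfl
  | succ t ih =>
    intro z z' h
    have h1 : stateOf hML hLN σ t z = stateOf hML hLN σ t z' :=
      ih.mono (box_subset le_rfl (by push_cast; omega)) h
    have h2 : ∀ n, z (((t + 1 : ℕ) : ℤ), n) = z' (((t + 1 : ℕ) : ℤ), n) := fun n =>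
      h _ (by rw [Finset.mem_coe, mem_box]; push_cast; omega)
    rw [stateOf_succ, stateOf_succ, h1]
    congr 1 <;> funext n <;> simp only [rewards, winners, h2]

theorem dependsOn_decisionOf (t : ℕ) :
    DependsOn (decisionOf hML hLN σ t) (box N 1 t : Set (ℤ × Fin N)) := by
  intro z z' h
  cases t with
  | zero => rfl
  | succ t =>
    rw [decisionOf_succ, decisionOf_succ, dependsOn_stateOf hML hLN σ t (by simpa using h)]

end Dynamics

/-! ### Adapted schedules and ages -/

section Schedules

variable {M N : ℕ}

/-- A schedule in which the decision of slot `t` uses the outcomes of the slots `1, …, t - 1`. -/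
def IsAdapted (A : Config M N → ℤ → Fin M → Fin N) : Prop :=
  ∀ t, DependsOn (fun z => A z t) (box N 1 t : Set (ℤ × Fin N))

/-- Source `m` succeeds in slot `t` under the schedule `A`. -/
def SuccAt (A : Config M N → ℤ → Fin M → Fin N) (m : Fin M) (t : ℤ) (z : Config M N) : Prop :=
  Succeeds (rewards z t) (winners z t) (A z t) m

/-- Source `m` fails in the `l` slots that start with `r`. -/
def Fails (A : Config M N → ℤ → Fin M → Fin N) (m : Fin M) (r : ℤ) (l : ℕ) (z : Config M N) :
    Prop :=
  ∀ i < l, ¬ SuccAt A m (r + i) z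

/-- The age under the schedule `A`. -/
noncomputable def ageOf (A : Config M N → ℤ → Fin M → Fin N) (m : Fin M) (t : ℤ)
    (z : Config M N) : ℕ :=
  aoi (rewards z) (winners z) (A z) m t

/-- The schedules `A` and `O` differ in slot `s`, or `s = 0`. -/
def Deviates (A O : Config M N → ℤ → Fin M → Fin N) (s : ℕ) (z : Config M N) : Prop :=
  s = 0 ∨ A z s ≠ O z s

/-- The schedule of DLF. -/
noncomputable def dlfSchedule {L : ℕ} (hML : M ≤ L) (hLN : L ≤ N)
    (σ : Fin M → ℕ → LocalState N → Fin N) (past : ℤ → Fin M → Fin N) (z : Config M N) :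
    ℤ → Fin M → Fin N :=
  withPast past fun t => decisionOf hML hLN σ t z

/-- The schedule of the oracle. -/
def oracleSchedule (hMN : M ≤ N) (past : ℤ → Fin M → Fin N) (_z : Config M N) :
    ℤ → Fin M → Fin N :=
  withPast past fun s i => rrChannel le_rfl hMN i s

theorem isAdapted_dlfSchedule {L : ℕ} (hML : M ≤ L) (hLN : L ≤ N)
    (σ : Fin M → ℕ → LocalState N → Fin N) (past : ℤ → Fin M → Fin N) :
    IsAdapted (dlfSchedule hML hLN σ past) := by
  intro t z z' h
  simp only [dlfSchedule, withPast]
  split_ifs with ht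
  · rfl
  · refine dependsOn_decisionOf hML hLN σ t.toNat ?_
    rwa [Int.toNat_of_nonneg (by omega)]

theorem isAdapted_oracleSchedule (hMN : M ≤ N) (past : ℤ → Fin M → Fin N) :
    IsAdapted (oracleSchedule hMN past) := fun _ _ _ _ => rfl

variable {A : Config M N → ℤ → Fin M → Fin N} {m : Fin M}

theorem IsAdapted.dependsOn_succAt (hA : IsAdapted A) (t : ℤ) :
    DependsOn (SuccAt A m t) (box N (min 1 t) (t + 1) : Set (ℤ × Fin N)) := by
  intro z z' h
  have h1 : A z t = A z' t := (hA t).mono (box_subset (min_le_left _ _) (by omega)) h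
  have h2 : ∀ n, z (t, n) = z' (t, n) := fun n => h _ (by
    rw [Finset.mem_coe, mem_box]; simp)
  have h3 : rewards z t = rewards z' t := by funext n; simp only [rewards, h2]
  have h4 : winners z t = winners z' t := by funext n; simp only [winners, h2]
  simp only [SuccAt, h1, h3, h4]

theorem IsAdapted.dependsOn_fails (hA : IsAdapted A) (r : ℤ) (l : ℕ) :
    DependsOn (Fails A m r l) (box N (min 1 r) (r + l) : Set (ℤ × Fin N)) := by
  intro z z' h
  have : ∀ i < l, SuccAt A m (r + i) z = SuccAt A m (r + i) z' := fun i hi =>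
    (hA.dependsOn_succAt (r + i)).mono (box_subset (by omega) (by omega)) h
  simp only [Fails]
  exact propext (forall₂_congr fun i hi => by rw [this i hi])

theorem fails_succ {r : ℤ} {l : ℕ} {z : Config M N} :
    Fails A m r (l + 1) z ↔ Fails A m r l z ∧ ¬ SuccAt A m (r + l) z := by
  constructor
  · exact fun h => ⟨fun i hi => h i (by omega), h l (by omega)⟩
  · rintro ⟨h1, h2⟩ i hi
    rcases Nat.lt_succ_iff_lt_or_eq.mp hi with h | rfl
    · exact h1 i h
    · exact h2

theorem fails_of_lt_ageOf {t : ℤ} {j : ℕ} {z : Config M N} (h : j < ageOf A m t z) :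
    Fails A m (t - j) j z := by
  intro i hi hs
  have hle : ageOf A m t z ≤ j - i := by
    refine Nat.sInf_le ⟨by omega, ?_⟩
    have : t - (j - i : ℕ) = t - j + i := by rw [Nat.cast_sub hi.le]; ring
    rw [this]
    exact hs
  omega

theorem ageOf_le_of_succAt {t s : ℤ} {z : Config M N} (hst : s < t) (h : SuccAt A m s z) :
    (ageOf A m t z : ℤ) ≤ t - s := by
  have hle : ageOf A m t z ≤ (t - s).toNat := by
    refine Nat.sInf_le ⟨by omega, ?_⟩
    have : t - ((t - s).toNat : ℤ) = s := by omega
    rw [this]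
    exact h
  omega

/-- The age grows by at most one per slot. -/
theorem ageOf_le_add (t s : ℤ) (hst : s ≤ t) (z : Config M N) :
    (ageOf A m t z : ℤ) ≤ (t - s) + ageOf A m s z := by
  by_cases hne : {j : ℕ | 0 < j ∧ Succeeds (rewards z (t - j)) (winners z (t - j))
      (A z (t - j)) m}.Nonempty
  · by_cases hs : {j : ℕ | 0 < j ∧ Succeeds (rewards z (s - j)) (winners z (s - j))
      (A z (s - j)) m}.Nonempty
    · have := Nat.sInf_mem hs
      have h2 : SuccAt A m (s - ageOf A m s z) z := this.2
      have h3 : 0 < ageOf A m s z := this.1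
      have := ageOf_le_of_succAt (t := t) (by omega) h2
      omega
    -- Without a success before `s` the age there is the default `0`, and every success before `t`
    -- lies in the slots from `s` on.
    · obtain ⟨j, hj0, hj⟩ := hne
      have hjs : s ≤ t - j := by
        by_contra hcon
        refine hs ⟨(s - (t - j)).toNat, by omega, ?_⟩
        have : s - ((s - (t - j)).toNat : ℤ) = t - j := by omega
        rw [this]
        exact hj
      have := ageOf_le_of_succAt (A := A) (m := m) (t := t) (s := t - j) (z := z) (by omega) hj
      omega
  · have : ageOf A m t z = 0 := by
      rw [Set.not_nonempty_iff_eq_empty] at hne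
      simp only [ageOf, aoi, hne, Nat.sInf_empty]
    omega

-- An age above `j` means failure in the `j` slots before `t`, so the age is bounded by a sum of
-- indicators of runs of failures.
open Classical in
theorem ageOf_le_tsum (A : Config M N → ℤ → Fin M → Fin N) (m : Fin M) (t : ℤ) (z : Config M N) :
    (ageOf A m t z : ℝ≥0∞) ≤ ∑' j : ℕ, if Fails A m (t - j) j z then 1 else 0 := by
  calc (ageOf A m t z : ℝ≥0∞) = ∑ j ∈ Finset.range (ageOf A m t z), (1 : ℝ≥0∞) := by simp
    _ = ∑ j ∈ Finset.range (ageOf A m t z), (if Fails A m (t - j) j z then 1 else 0) := by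
        refine Finset.sum_congr rfl fun j hj => ?_
        rw [if_pos (fails_of_lt_ageOf (Finset.mem_range.mp hj))]
    _ ≤ _ := ENNReal.sum_le_tsum _

open Classical in
/-- The comparison of two schedules in a fixed configuration. -/
theorem ageOf_le_ageOf_add (A O : Config M N → ℤ → Fin M → Fin N) (m : Fin M) (t : ℕ)
    (ht : 1 ≤ t) (z : Config M N) :
    (ageOf A m t z : ℝ≥0∞) ≤ ageOf O m t z +
      ∑ s ∈ Finset.range t, if Deviates A O s z ∧ Fails O m (s + 1) (t - 1 - s) z then
        ((t - s : ℕ) : ℝ≥0∞) + ageOf A m s z else 0 := by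
  have key : ∀ s < t, Deviates A O s z → Fails O m (s + 1) (t - 1 - s) z →
      (ageOf A m t z : ℝ≥0∞) ≤ ageOf O m t z +
      ∑ s ∈ Finset.range t, if Deviates A O s z ∧ Fails O m (s + 1) (t - 1 - s) z then
        ((t - s : ℕ) : ℝ≥0∞) + ageOf A m s z else 0 := by
    intro s hst hb hf
    refine le_trans ?_ le_add_self
    refine le_trans ?_ (Finset.single_le_sum (f := fun s : ℕ =>
      if Deviates A O s z ∧ Fails O m (s + 1) (t - 1 - s) z then
        ((t - s : ℕ) : ℝ≥0∞) + ageOf A m s z else 0) (fun _ _ => zero_le)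
        (Finset.mem_range.mpr hst))
    simp only [if_pos (And.intro hb hf)]
    have := ageOf_le_add (A := A) (m := m) t s (by omega) z
    have h2 : ageOf A m t z ≤ (t - s) + ageOf A m s z := by omega
    exact_mod_cast h2
  by_cases hex : ∃ u : ℕ, 1 ≤ u ∧ u < t ∧ SuccAt O m u z
  -- `u` is the last success of the schedule `O` in the slots `1, …, t - 1`.
  · obtain ⟨u, ⟨hu1, hut, hus⟩, hmax⟩ : ∃ u : ℕ, (1 ≤ u ∧ u < t ∧ SuccAt O m u z) ∧
        ∀ v : ℕ, u < v → v < t → ¬ SuccAt O m v z := by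
      let p : ℕ → Prop := fun u => 1 ≤ u ∧ u < t ∧ SuccAt O m u z
      obtain ⟨u0, hu0⟩ := hex
      have hp : p (Nat.findGreatest p t) := Nat.findGreatest_spec (P := p) hu0.2.1.le hu0
      refine ⟨Nat.findGreatest p t, hp, fun v hv hvt hs => ?_⟩
      exact Nat.findGreatest_is_greatest hv hvt.le ⟨by omega, hvt, hs⟩
    have hf : Fails O m (u + 1) (t - 1 - u) z := by
      intro i hi
      have := hmax (u + 1 + i) (by omega) (by omega)
      push_cast at this
      exact this
    -- If the schedules agree in `u`, then `A` succeeds there too, because acquisition depends on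
    -- the whole schedule of the slot and on nothing else that differs.
    by_cases hg : A z u = O z u
    · refine le_trans ?_ le_self_add
      have h1 : SuccAt A m u z := by
        have : SuccAt O m u z := hus
        simpa only [SuccAt, hg] using this
      have h2 := ageOf_le_of_succAt (t := t) (by exact_mod_cast hut) h1
      have h3 : (t - u : ℤ) ≤ ageOf O m t z := by
        by_contra hcon
        have hne : {j : ℕ | 0 < j ∧ Succeeds (rewards z (t - j)) (winners z (t - j))
            (O z (t - j)) m}.Nonempty :=
          ⟨t - u, by omega, by
            have : (t : ℤ) - ((t - u : ℕ) : ℤ) = u := by omega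
            rw [this]; exact hus⟩
        have hmem := Nat.sInf_mem hne
        have h4 : SuccAt O m (t - ageOf O m t z) z := hmem.2
        have h5 : 0 < ageOf O m t z := hmem.1
        refine hmax (t - ageOf O m t z) (by omega) (by omega) ?_
        rwa [Nat.cast_sub (by omega)]
      have h6 : ageOf A m t z ≤ ageOf O m t z := by omega
      exact_mod_cast h6
    · exact key u hut (Or.inr hg) hf
  -- No success of `O` since slot `1`: slot `0` counts as deviating by definition, which absorbs the
  -- different pasts.
  · refine key 0 (by omega) (Or.inl rfl) ?_
    intro i hi hs
    refine hex ⟨1 + i, by omega, by omega, ?_⟩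
    push_cast at hs ⊢
    simpa using hs

end Schedules

/-! ### Geometric tails and integrability of the ages -/

section Ages

variable {M N : ℕ} {Ω : Type*} [MeasurableSpace Ω] {P : Measure Ω} [IsProbabilityMeasure P]
  {μ : Fin N → ℝ} {X : ℤ → Fin N → Ω → Bool} {W : ℤ → Fin N → Ω → Finset (Fin M) → Fin M}

open Classical in
/-- An event of the present that has probability at most `c` given the past. -/
theorem IsSystem.prob_le_of_past (hs : IsSystem P μ X W) {A B : Finset (ℤ × Fin N)}
    (hAB : Disjoint A B) {π : Type*} {p : Config M N → π}
    (hp : DependsOn p (A : Set (ℤ × Fin N))) {E : π → Config M N → Prop}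
    (hE : ∀ a, DependsOn (E a) (B : Set (ℤ × Fin N))) (Q : π → Prop) {c : ℝ≥0∞}
    (h : ∀ a, Q a → P {ω | E a (outcomes X W ω)} ≤ c) :
    P {ω | Q (p (outcomes X W ω)) ∧ E (p (outcomes X W ω)) (outcomes X W ω)}
      ≤ c * P {ω | Q (p (outcomes X W ω))} := by
  have hQ : MeasurableSet {ω | Q (p (outcomes X W ω))} :=
    hs.measurableSet_outcomes (A := A) (p := fun z => Q (p z)) fun z z' h => by
      simp only [hp h]
  have hEm : ∀ a, MeasurableSet {ω | E a (outcomes X W ω)} := fun a =>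
    hs.measurableSet_outcomes (hE a)
  have hQE : MeasurableSet {ω | Q (p (outcomes X W ω)) ∧ E (p (outcomes X W ω)) (outcomes X W ω)} := by
    refine hs.measurableSet_outcomes (A := A ∪ B) (p := fun z => Q (p z) ∧ E (p z) z) ?_
    intro z z' h
    have h1 : p z = p z' := hp fun i hi => h i (by
      simp only [Finset.coe_union, Set.mem_union]; exact Or.inl hi)
    have h2 : E (p z') z = E (p z') z' := hE _ fun i hi => h i (by
      simp only [Finset.coe_union, Set.mem_union]; exact Or.inr hi)
    simp only [h1, h2]
  have main := hs.lintegral_le_of_past hAB hp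
    (Φ := fun a z => if Q a ∧ E a z then (1 : ℝ≥0∞) else 0)
    (fun a z z' h => by simp only [hE a h]) (G := fun a => if Q a then c else 0) (by
      intro a
      by_cases hq : Q a
      · simp only [hq, true_and, if_true]
        have : ∀ ω, (if E a (outcomes X W ω) then (1 : ℝ≥0∞) else 0)
            = Set.indicator {ω | E a (outcomes X W ω)} (fun _ => 1) ω := fun ω => by
          simp [Set.indicator_apply]
        simp_rw [this]
        rw [lintegral_indicator_const (hEm a), one_mul]
        exact h a hq
      · simp [hq])
  have e1 : ∀ ω, (if Q (p (outcomes X W ω)) ∧ E (p (outcomes X W ω)) (outcomes X W ω)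
      then (1 : ℝ≥0∞) else 0) = Set.indicator {ω | Q (p (outcomes X W ω)) ∧
        E (p (outcomes X W ω)) (outcomes X W ω)} (fun _ => 1) ω := fun ω => by
    simp [Set.indicator_apply]
  have e2 : ∀ ω, (if Q (p (outcomes X W ω)) then c else 0)
      = Set.indicator {ω | Q (p (outcomes X W ω))} (fun _ => c) ω := fun ω => by
    simp [Set.indicator_apply]
  simp_rw [e1, e2] at main
  rwa [lintegral_indicator_const hQE, lintegral_indicator_const hQ, one_mul] at main

variable {A : Config M N → ℤ → Fin M → Fin N} {m : Fin M} {μmin : ℝ}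

/-- Whatever the past, a run of `l` failures has probability at most `q ^ l`. -/
theorem IsSystem.prob_and_fails_le (hs : IsSystem P μ X W) (h0 : 0 ≤ μmin)
    (hμ : ∀ n, μmin ≤ μ n) (hA : IsAdapted A) (m : Fin M) {a r : ℤ} {p : Config M N → Prop}
    (hp : DependsOn p (box N a r : Set (ℤ × Fin N))) (l : ℕ) :
    P {ω | p (outcomes X W ω) ∧ Fails A m r l (outcomes X W ω)}
      ≤ ENNReal.ofReal (1 - μmin / M) ^ l * P {ω | p (outcomes X W ω)} := by
  induction l with
  | zero => simpa using measure_mono fun ω hω => hω.1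
  | succ l ih =>
    -- The past records the schedule of slot `r + l` besides the event, so the next failure is one
    -- under a fixed schedule.
    have h1 := hs.prob_le_of_past (A := box N (min a (min 1 r)) (r + l))
      (B := box N (r + l) (r + l + 1)) (disjoint_box le_rfl)
      (p := fun z => (p z ∧ Fails A m r l z, A z (r + l)))
      (by
        intro z z' h
        have e1 : p z = p z' := hp.mono (box_subset (by omega) (by omega)) h
        have e2 : Fails A m r l z = Fails A m r l z' :=
          (hA.dependsOn_fails r l).mono (box_subset (by omega) (by omega)) h
        have e3 : A z (r + l) = A z' (r + l) :=
          (hA (r + l)).mono (box_subset (by omega) le_rfl) h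
        simp only [e1, e2, e3])
      (E := fun q z => ¬ Succeeds (rewards z (r + l)) (winners z (r + l)) q.2 m)
      (by
        intro q z z' h
        have h2 : ∀ n, z (r + l, n) = z' (r + l, n) := fun n => h _ (by
          rw [Finset.mem_coe, mem_box]; simp)
        have h3 : rewards z (r + l) = rewards z' (r + l) := by funext n; simp only [rewards, h2]
        have h4 : winners z (r + l) = winners z' (r + l) := by funext n; simp only [winners, h2]
        simp only [h3, h4])
      (fun q => q.1) (c := ENNReal.ofReal (1 - μmin / M))
      (fun q _ => hs.prob_not_succeeds_le h0 hμ (r + l) q.2 m)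
    calc P {ω | p (outcomes X W ω) ∧ Fails A m r (l + 1) (outcomes X W ω)}
        = P {ω | (p (outcomes X W ω) ∧ Fails A m r l (outcomes X W ω)) ∧
          ¬ Succeeds (rewards (outcomes X W ω) (r + l)) (winners (outcomes X W ω) (r + l))
            (A (outcomes X W ω) (r + l)) m} := by
          congr 1; ext ω; simp only [Set.mem_ofPred_eq, fails_succ, SuccAt, and_assoc]
      _ ≤ _ := h1
      _ ≤ ENNReal.ofReal (1 - μmin / M) *
          (ENNReal.ofReal (1 - μmin / M) ^ l * P {ω | p (outcomes X W ω)}) := by gcongr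
      _ = _ := by rw [pow_succ]; ring

theorem IsSystem.prob_fails_le (hs : IsSystem P μ X W) (h0 : 0 ≤ μmin)
    (hμ : ∀ n, μmin ≤ μ n) (hA : IsAdapted A) (m : Fin M) (r : ℤ) (l : ℕ) :
    P {ω | Fails A m r l (outcomes X W ω)} ≤ ENNReal.ofReal (1 - μmin / M) ^ l := by
  have := hs.prob_and_fails_le h0 hμ hA m (a := r) (r := r) (p := fun _ => True)
    (fun _ _ _ => rfl) l
  simpa using this

theorem IsSystem.measurableSet_succAt (hs : IsSystem P μ X W) (hA : IsAdapted A) (m : Fin M)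
    (t : ℤ) : MeasurableSet {ω | SuccAt A m t (outcomes X W ω)} :=
  hs.measurableSet_outcomes (hA.dependsOn_succAt t)

theorem IsSystem.measurableSet_fails (hs : IsSystem P μ X W) (hA : IsAdapted A) (m : Fin M)
    (t : ℤ) (l : ℕ) : MeasurableSet {ω | Fails A m t l (outcomes X W ω)} :=
  hs.measurableSet_outcomes (hA.dependsOn_fails t l)

theorem IsSystem.measurable_ageOf (hs : IsSystem P μ X W) (hA : IsAdapted A) (m : Fin M)
    (t : ℤ) : Measurable fun ω => ageOf A m t (outcomes X W ω) := by
  refine measurable_of_Ici fun k => ?_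
  -- The existence of some success must be demanded separately, since the age is `0` when there is
  -- none.
  have hset : {ω | k ≤ ageOf A m t (outcomes X W ω)} =
      {ω | k = 0 ∨ ((∃ j : ℕ, 0 < j ∧ SuccAt A m (t - j) (outcomes X W ω)) ∧
        ∀ j : ℕ, j < k → 0 < j → ¬ SuccAt A m (t - j) (outcomes X W ω))} := by
    ext ω
    simp only [Set.mem_ofPred_eq]
    rcases Nat.eq_zero_or_pos k with rfl | hk
    · simp
    · simp only [hk.ne', false_or]
      constructor
      · intro h
        have hne : {j : ℕ | 0 < j ∧ SuccAt A m (t - j) (outcomes X W ω)}.Nonempty := by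
          by_contra hcon
          rw [Set.not_nonempty_iff_eq_empty] at hcon
          have : ageOf A m t (outcomes X W ω) = sInf
            {j : ℕ | 0 < j ∧ SuccAt A m (t - j) (outcomes X W ω)} := rfl
          rw [this, hcon, Nat.sInf_empty] at h
          omega
        exact ⟨hne, fun j hj h0 hsucc => by
          have : ageOf A m t (outcomes X W ω) ≤ j := Nat.sInf_le ⟨h0, hsucc⟩
          omega⟩
      · rintro ⟨⟨j, hj0, hj⟩, h⟩
        have hne : {j : ℕ | 0 < j ∧ SuccAt A m (t - j) (outcomes X W ω)}.Nonempty := ⟨j, hj0, hj⟩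
        have hmem := Nat.sInf_mem hne
        by_contra hcon
        exact h _ (not_le.mp hcon) hmem.1 hmem.2
  have hms : MeasurableSet {ω | k ≤ ageOf A m t (outcomes X W ω)} := by
    rw [hset]
    have hS := hs.measurableSet_succAt hA m
    have h1 : MeasurableSet {ω | ∃ j : ℕ, 0 < j ∧ SuccAt A m (t - j) (outcomes X W ω)} := by
      have : {ω | ∃ j : ℕ, 0 < j ∧ SuccAt A m (t - j) (outcomes X W ω)}
          = ⋃ j : ℕ, {ω | 0 < j ∧ SuccAt A m (t - j) (outcomes X W ω)} := by ext; simp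
      rw [this]
      exact MeasurableSet.iUnion fun j => (MeasurableSet.const _).inter (hS _)
    have h2 : MeasurableSet {ω | ∀ j : ℕ, j < k → 0 < j →
        ¬ SuccAt A m (t - j) (outcomes X W ω)} := by
      have : {ω | ∀ j : ℕ, j < k → 0 < j → ¬ SuccAt A m (t - j) (outcomes X W ω)}
          = ⋂ j : ℕ, {ω | j < k → 0 < j → ¬ SuccAt A m (t - j) (outcomes X W ω)} := by ext; simp
      rw [this]
      refine MeasurableSet.iInter fun j => ?_
      by_cases h1 : j < k
      · by_cases h2 : 0 < j
        · simp only [h1, h2, forall_const]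
          exact (hS (t - j)).compl
        · simp [h2]
      · simp [h1]
    exact (MeasurableSet.const _).union (h1.inter h2)
  exact hms

open Classical in
theorem IsSystem.lintegral_ageOf_le (hs : IsSystem P μ X W) (hA : IsAdapted A) (m : Fin M)
    (t : ℤ) (p : Config M N → Prop) :
    ∫⁻ ω in {ω | p (outcomes X W ω)}, (ageOf A m t (outcomes X W ω) : ℝ≥0∞) ∂P
      ≤ ∑' j : ℕ, P {ω | p (outcomes X W ω) ∧ Fails A m (t - j) j (outcomes X W ω)} := by
  calc _ ≤ ∫⁻ ω in {ω | p (outcomes X W ω)},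
        ∑' j : ℕ, (if Fails A m (t - j) j (outcomes X W ω) then (1 : ℝ≥0∞) else 0) ∂P :=
        lintegral_mono fun ω => ageOf_le_tsum A m t _
    _ = ∑' j : ℕ, ∫⁻ ω in {ω | p (outcomes X W ω)},
        Set.indicator {ω | Fails A m (t - j) j (outcomes X W ω)} (fun _ => (1 : ℝ≥0∞)) ω ∂P := by
        rw [← lintegral_tsum fun j : ℕ => (measurable_const.indicator
          (hs.measurableSet_fails hA m (t - j) j)).aemeasurable]
        refine lintegral_congr fun ω => tsum_congr fun j => ?_
        simp [Set.indicator_apply]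
    _ = _ := by
        refine tsum_congr fun j => ?_
        have hm := hs.measurableSet_fails hA m (t - j) j
        rw [lintegral_indicator_const hm, one_mul, Measure.restrict_apply hm]
        congr 1
        ext ω
        exact and_comm

theorem IsSystem.integrable_ageOf (hs : IsSystem P μ X W) (h0 : 0 < μmin)
    (hμ : ∀ n, μmin ≤ μ n) (hA : IsAdapted A) (m : Fin M) (t : ℤ) :
    Integrable (fun ω => (ageOf A m t (outcomes X W ω) : ℝ)) P := by
  have hm := hs.measurable_ageOf hA m t
  refine ⟨(measurable_of_countable _ |>.comp hm).aestronglyMeasurable, ?_⟩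
  rw [hasFiniteIntegral_iff_norm]
  have e : ∀ ω, ENNReal.ofReal ‖(ageOf A m t (outcomes X W ω) : ℝ)‖
      = (ageOf A m t (outcomes X W ω) : ℝ≥0∞) := fun ω => by
    rw [Real.norm_natCast, ENNReal.ofReal_natCast]
  simp_rw [e]
  have h1 := hs.lintegral_ageOf_le hA m t fun _ => True
  simp only [Set.ofPred_true, Measure.restrict_univ, true_and] at h1
  refine h1.trans_lt ?_
  refine (ENNReal.tsum_le_tsum fun j : ℕ => hs.prob_fails_le h0.le hμ hA m (t - j) j).trans_lt ?_
  rw [ENNReal.tsum_geometric]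
  refine ENNReal.inv_lt_top.mpr (tsub_pos_of_lt ?_)
  rw [← ENNReal.ofReal_one]
  have hM : (0 : ℝ) < M := by exact_mod_cast m.pos
  exact (ENNReal.ofReal_lt_ofReal_iff one_pos).mpr (by have := div_pos h0 hM; linarith)

end Ages

/-! ### Reduction of the regret to the ages in deviating slots -/

section Reduction

variable {M N : ℕ} {Ω : Type*} [MeasurableSpace Ω] {P : Measure Ω} [IsProbabilityMeasure P]
  {μ : Fin N → ℝ} {X : ℤ → Fin N → Ω → Bool} {W : ℤ → Fin N → Ω → Finset (Fin M) → Fin M}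

/-- An upper bound for the mean age in slot `s` if the schedules differ there. -/
noncomputable def deviationAge (P : Measure Ω) (X : ℤ → Fin N → Ω → Bool)
    (W : ℤ → Fin N → Ω → Finset (Fin M) → Fin M) (A O : Config M N → ℤ → Fin M → Fin N)
    (m : Fin M) (s : ℕ) : ℝ≥0∞ :=
  ∑' j : ℕ, P {ω | Deviates A O s (outcomes X W ω) ∧ Fails A m (s - j) j (outcomes X W ω)}

/-- The weight of a slot in which the schedules differ. -/
noncomputable def deviationWeight (q : ℝ≥0∞) : ℝ≥0∞ := ∑' d : ℕ, ((d : ℝ≥0∞) + 2) * q ^ d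

theorem deviationWeight_ne_top {r : ℝ} (h0 : 0 ≤ r) (h1 : r < 1) :
    deviationWeight (ENNReal.ofReal r) ≠ ⊤ := by
  have hsum : Summable fun d : ℕ => ((d : ℝ) + 2) * r ^ d := by
    have a := summable_pow_mul_geometric_of_norm_lt_one 1
      (show ‖r‖ < 1 by rwa [Real.norm_of_nonneg h0])
    have b := (summable_geometric_of_lt_one h0 h1).mul_left 2
    refine (a.add b).congr fun d => ?_
    ring
  have e : ∀ d : ℕ, ((d : ℝ≥0∞) + 2) * ENNReal.ofReal r ^ d
      = ENNReal.ofReal (((d : ℝ) + 2) * r ^ d) := by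
    intro d
    rw [ENNReal.ofReal_mul (by positivity), ENNReal.ofReal_pow h0,
      ENNReal.ofReal_add (by positivity) (by norm_num), ENNReal.ofReal_natCast]
    norm_num
  rw [deviationWeight]
  simp_rw [e]
  exact hsum.tsum_ofReal_ne_top

variable {A O : Config M N → ℤ → Fin M → Fin N} {m : Fin M} {μmin : ℝ}

theorem IsAdapted.dependsOn_deviates (hA : IsAdapted A) (hO : IsAdapted O) (s : ℕ) :
    DependsOn (Deviates A O s) (box N 1 s : Set (ℤ × Fin N)) := by
  intro z z' h
  have h1 : A z s = A z' s := hA s h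
  have h2 : O z s = O z' s := hO s h
  simp only [Deviates, h1, h2]

theorem prob_deviates_le_deviationAge (m : Fin M) (s : ℕ) :
    P {ω | Deviates A O s (outcomes X W ω)} ≤ deviationAge P X W A O m s := by
  refine le_trans ?_ (ENNReal.le_tsum 0)
  refine measure_mono fun ω hω => ⟨hω, ?_⟩
  intro i hi
  omega

-- The `d = t - 1 - s` failures of `O` lie in the future of both the deviation and the age in slot
-- `s`, hence contribute `q ^ d`. The factor `d + 2` is `t - s = d + 1` for the elapsed time plus
-- `1` for the age.
open Classical in
theorem IsSystem.lintegral_deviation_le (hs : IsSystem P μ X W) (h0 : 0 ≤ μmin)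
    (hμ : ∀ n, μmin ≤ μ n) (hA : IsAdapted A) (hO : IsAdapted O) (m : Fin M) {s t : ℕ}
    (hst : s < t) :
    ∫⁻ ω, (if Deviates A O s (outcomes X W ω) ∧ Fails O m (s + 1) (t - 1 - s) (outcomes X W ω) then
        ((t - s : ℕ) : ℝ≥0∞) + ageOf A m s (outcomes X W ω) else 0) ∂P
      ≤ (((t - 1 - s : ℕ) : ℝ≥0∞) + 2) * ENNReal.ofReal (1 - μmin / M) ^ (t - 1 - s)
        * deviationAge P X W A O m s := by
  set q := ENNReal.ofReal (1 - μmin / M) with hq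
  set d := t - 1 - s with hd
  have htd : t - s = d + 1 := by omega
  have hdev := hA.dependsOn_deviates hO s
  have hE : MeasurableSet {ω | Deviates A O s (outcomes X W ω) ∧
      Fails O m (s + 1) d (outcomes X W ω)} :=
    (hs.measurableSet_outcomes hdev).inter (hs.measurableSet_fails hO m _ _)
  have e : ∀ ω, (if Deviates A O s (outcomes X W ω) ∧ Fails O m (s + 1) d (outcomes X W ω) then
        ((t - s : ℕ) : ℝ≥0∞) + ageOf A m s (outcomes X W ω) else 0)
      = Set.indicator {ω | Deviates A O s (outcomes X W ω) ∧ Fails O m (s + 1) d (outcomes X W ω)}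
        (fun ω => ((t - s : ℕ) : ℝ≥0∞) + ageOf A m s (outcomes X W ω)) ω := by
    intro ω; simp [Set.indicator_apply]
  simp_rw [e]
  rw [lintegral_indicator hE, lintegral_add_left measurable_const, lintegral_const,
    Measure.restrict_apply_univ]
  have h1 : P {ω | Deviates A O s (outcomes X W ω) ∧ Fails O m (s + 1) d (outcomes X W ω)}
      ≤ q ^ d * deviationAge P X W A O m s := by
    refine (hs.prob_and_fails_le h0 hμ hO m (a := 1) (r := s + 1)
      (hdev.mono (box_subset le_rfl (by omega))) d).trans ?_
    gcongr
    exact prob_deviates_le_deviationAge m s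
  have h2 : ∫⁻ ω in {ω | Deviates A O s (outcomes X W ω) ∧ Fails O m (s + 1) d (outcomes X W ω)},
      (ageOf A m s (outcomes X W ω) : ℝ≥0∞) ∂P ≤ q ^ d * deviationAge P X W A O m s := by
    refine (hs.lintegral_ageOf_le hA m s
      (fun z => Deviates A O s z ∧ Fails O m (s + 1) d z)).trans ?_
    rw [deviationAge, ← ENNReal.tsum_mul_left]
    refine ENNReal.tsum_le_tsum fun j : ℕ => ?_
    refine le_trans (measure_mono ?_) (hs.prob_and_fails_le h0 hμ hO m
      (a := min 1 (s - j)) (r := s + 1)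
      (p := fun z => Deviates A O s z ∧ Fails A m (s - j) j z) ?_ d)
    · rintro ω ⟨⟨h1, h2⟩, h3⟩
      exact ⟨⟨h1, h3⟩, h2⟩
    · intro z z' h
      have e1 : Deviates A O s z = Deviates A O s z' :=
        hdev.mono (box_subset (by omega) (by omega)) h
      have e2 : Fails A m (s - j) j z = Fails A m (s - j) j z' :=
        (hA.dependsOn_fails (s - j) j).mono (box_subset le_rfl (by omega)) h
      simp only [e1, e2]
  calc _ ≤ ((t - s : ℕ) : ℝ≥0∞) * (q ^ d * deviationAge P X W A O m s)
        + q ^ d * deviationAge P X W A O m s := by gcongr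
    _ = _ := by rw [htd]; push_cast; ring

theorem IsSystem.sum_lintegral_ageOf_le (hs : IsSystem P μ X W) (h0 : 0 ≤ μmin)
    (hμ : ∀ n, μmin ≤ μ n) (hA : IsAdapted A) (hO : IsAdapted O) (m : Fin M) (T : ℕ) :
    ∑ t ∈ Finset.Icc 1 T, ∫⁻ ω, (ageOf A m t (outcomes X W ω) : ℝ≥0∞) ∂P
      ≤ ∑ t ∈ Finset.Icc 1 T, ∫⁻ ω, (ageOf O m t (outcomes X W ω) : ℝ≥0∞) ∂P
        + deviationWeight (ENNReal.ofReal (1 - μmin / M)) *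
          ∑ s ∈ Finset.range T, deviationAge P X W A O m s := by
  classical
  set q := ENNReal.ofReal (1 - μmin / M) with hq
  have h1 : ∀ t ∈ Finset.Icc 1 T, ∫⁻ ω, (ageOf A m t (outcomes X W ω) : ℝ≥0∞) ∂P
      ≤ ∫⁻ ω, (ageOf O m t (outcomes X W ω) : ℝ≥0∞) ∂P + ∑ s ∈ Finset.range t,
        (((t - 1 - s : ℕ) : ℝ≥0∞) + 2) * q ^ (t - 1 - s) * deviationAge P X W A O m s := by
    intro t ht
    have ht1 := (Finset.mem_Icc.mp ht).1
    refine (lintegral_mono fun ω => ageOf_le_ageOf_add A O m t ht1 (outcomes X W ω)).trans ?_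
    have hOm : Measurable fun ω => (ageOf O m t (outcomes X W ω) : ℝ≥0∞) :=
      (measurable_of_countable _).comp (hs.measurable_ageOf hO m t)
    rw [lintegral_add_left hOm]
    gcongr
    rw [lintegral_finsetSum']
    · refine Finset.sum_le_sum fun s hs' => ?_
      exact hs.lintegral_deviation_le h0 hμ hA hO m (Finset.mem_range.mp hs')
    · intro s _
      refine (Measurable.ite ?_ ?_ measurable_const).aemeasurable
      · exact (hs.measurableSet_outcomes (hA.dependsOn_deviates hO s)).inter
          (hs.measurableSet_fails hO m _ _)
      · have hAm : Measurable fun ω => (ageOf A m s (outcomes X W ω) : ℝ≥0∞) :=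
          (measurable_of_countable _).comp (hs.measurable_ageOf hA m s)
        exact measurable_const.add hAm
  refine (Finset.sum_le_sum h1).trans ?_
  rw [Finset.sum_add_distrib]
  gcongr
  -- After exchanging the sums, each deviating slot `s` is charged for all later `t`; the geometric
  -- weights add up to at most `deviationWeight`.
  calc ∑ t ∈ Finset.Icc 1 T, ∑ s ∈ Finset.range t,
        (((t - 1 - s : ℕ) : ℝ≥0∞) + 2) * q ^ (t - 1 - s) * deviationAge P X W A O m s
      = ∑ s ∈ Finset.range T, ∑ t ∈ Finset.Ioc s T,
        (((t - 1 - s : ℕ) : ℝ≥0∞) + 2) * q ^ (t - 1 - s) * deviationAge P X W A O m s := by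
        refine Finset.sum_comm' fun t s => ?_
        simp only [Finset.mem_Icc, Finset.mem_range, Finset.mem_Ioc]
        omega
    _ ≤ ∑ s ∈ Finset.range T, deviationWeight q * deviationAge P X W A O m s := by
        refine Finset.sum_le_sum fun s _ => ?_
        rw [← Finset.sum_mul]
        gcongr
        calc ∑ t ∈ Finset.Ioc s T, (((t - 1 - s : ℕ) : ℝ≥0∞) + 2) * q ^ (t - 1 - s)
            = ∑ d ∈ (Finset.Ioc s T).image (fun t => t - 1 - s), ((d : ℝ≥0∞) + 2) * q ^ d := by
              rw [Finset.sum_image]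
              intro t ht t' ht' h
              simp only [Finset.coe_Ioc, Set.mem_Ioc] at ht ht'
              simp only at h
              omega
          _ ≤ _ := ENNReal.sum_le_tsum _
    _ = _ := by rw [Finset.mul_sum]

theorem sum_Icc_intCast (T : ℕ) (f : ℤ → ℝ) :
    ∑ t ∈ Finset.Icc (1 : ℤ) T, f t = ∑ t ∈ Finset.Icc 1 T, f (t : ℤ) := by
  refine Finset.sum_nbij' (fun t => t.toNat) (fun t => (t : ℤ)) ?_ ?_ ?_ ?_ ?_
  · intro t ht
    simp only [Finset.mem_Icc] at ht ⊢
    omega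
  · intro t ht
    simp only [Finset.mem_Icc] at ht ⊢
    omega
  · intro t ht
    simp only [Finset.mem_Icc] at ht
    omega
  · intro t ht
    simp
  · intro t ht
    simp only [Finset.mem_Icc] at ht
    rw [Int.toNat_of_nonneg (by omega)]

/-- The regret is controlled by the mean ages in the slots in which the schedules differ. -/
theorem IsSystem.regret_ageOf_le (hs : IsSystem P μ X W) (h0 : 0 < μmin)
    (hμ : ∀ n, μmin ≤ μ n) (hA : IsAdapted A) (hO : IsAdapted O) (T : ℕ) {B : ℝ} (hB : 0 ≤ B)
    (hM : μmin / M ≤ 1)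
    (h : ∀ m, ∑ s ∈ Finset.range T, deviationAge P X W A O m s ≤ ENNReal.ofReal B) :
    regret P (fun m t ω => (ageOf A m t (outcomes X W ω) : ℝ))
        (fun m t ω => (ageOf O m t (outcomes X W ω) : ℝ)) T
      ≤ M * ((deviationWeight (ENNReal.ofReal (1 - μmin / M))).toReal * B) := by
  have hone : ∀ m : Fin M, ∑ t ∈ Finset.Icc (1 : ℤ) T,
      ∫ ω, ((ageOf A m t (outcomes X W ω) : ℝ) - (ageOf O m t (outcomes X W ω) : ℝ)) ∂P
        ≤ (deviationWeight (ENNReal.ofReal (1 - μmin / M))).toReal * B := by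
    intro m
    have hMpos : (0 : ℝ) < M := by exact_mod_cast m.pos
    have hw : deviationWeight (ENNReal.ofReal (1 - μmin / M)) ≠ ⊤ :=
      deviationWeight_ne_top (by linarith) (by have := div_pos h0 hMpos; linarith)
    have hint : ∀ (S : Config M N → ℤ → Fin M → Fin N), IsAdapted S → ∀ t : ℤ,
        ∫⁻ ω, (ageOf S m t (outcomes X W ω) : ℝ≥0∞) ∂P
          = ENNReal.ofReal (∫ ω, (ageOf S m t (outcomes X W ω) : ℝ) ∂P) := by
      intro S hS t
      rw [ofReal_integral_eq_lintegral_ofReal (hs.integrable_ageOf h0 hμ hS m t)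
        (Filter.Eventually.of_forall fun ω => Nat.cast_nonneg _)]
      simp
    have hnn : ∀ (S : Config M N → ℤ → Fin M → Fin N) (t : ℤ),
        0 ≤ ∫ ω, (ageOf S m t (outcomes X W ω) : ℝ) ∂P := fun S t =>
      integral_nonneg fun ω => Nat.cast_nonneg _
    have main := hs.sum_lintegral_ageOf_le h0.le hμ hA hO m T
    simp_rw [hint A hA, hint O hO] at main
    rw [← ENNReal.ofReal_sum_of_nonneg (fun (t : ℕ) _ => hnn A t),
      ← ENNReal.ofReal_sum_of_nonneg (fun (t : ℕ) _ => hnn O t)] at main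
    have main2 := main.trans (add_le_add le_rfl (mul_le_mul_right (h m) _))
    rw [← ENNReal.ofReal_toReal hw, ← ENNReal.ofReal_mul ENNReal.toReal_nonneg,
      ← ENNReal.ofReal_add (Finset.sum_nonneg fun (t : ℕ) _ => hnn O t) (by positivity),
      ENNReal.ofReal_le_ofReal_iff (add_nonneg (Finset.sum_nonneg fun (t : ℕ) _ => hnn O t)
        (by positivity))] at main2
    rw [sum_Icc_intCast T (fun t => ∫ ω, ((ageOf A m t (outcomes X W ω) : ℝ)
      - (ageOf O m t (outcomes X W ω) : ℝ)) ∂P)]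
    have e : ∀ t : ℕ, ∫ ω, ((ageOf A m t (outcomes X W ω) : ℝ)
        - (ageOf O m t (outcomes X W ω) : ℝ)) ∂P
        = ∫ ω, (ageOf A m t (outcomes X W ω) : ℝ) ∂P
          - ∫ ω, (ageOf O m t (outcomes X W ω) : ℝ) ∂P := fun t =>
      integral_sub (hs.integrable_ageOf h0 hμ hA m t) (hs.integrable_ageOf h0 hμ hO m t)
    simp_rw [e]
    rw [Finset.sum_sub_distrib]
    linarith
  calc _ ≤ ∑ _m : Fin M, (deviationWeight (ENNReal.ofReal (1 - μmin / M))).toReal * B :=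
        Finset.sum_le_sum fun m _ => hone m
    _ = _ := by simp

end Reduction

/-! ### Supermartingales -/

section Supermartingale

variable {M N : ℕ} {Ω : Type*} [MeasurableSpace Ω] {P : Measure Ω} [IsProbabilityMeasure P]
  {μ : Fin N → ℝ} {X : ℤ → Fin N → Ω → Bool} {W : ℤ → Fin N → Ω → Finset (Fin M) → Fin M}

theorem IsSystem.lintegral_slot_le (hs : IsSystem P μ X W) {a r : ℤ} {π : Type*}
    {p : Config M N → π} (hp : DependsOn p (box N a r : Set (ℤ × Fin N)))
    (Φ : π → (Fin N → Bool) → (Fin N → Finset (Fin M) → Fin M) → ℝ≥0∞) (G : π → ℝ≥0∞)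
    (h : ∀ a, ∫⁻ ω, Φ a (fun n => X r n ω) (fun n => W r n ω) ∂P ≤ G a) :
    ∫⁻ ω, Φ (p (outcomes X W ω)) (fun n => X r n ω) (fun n => W r n ω) ∂P
      ≤ ∫⁻ ω, G (p (outcomes X W ω)) ∂P := by
  refine hs.lintegral_le_of_past (A := box N a r) (B := box N r (r + 1)) (disjoint_box le_rfl) hp
    (Φ := fun a z => Φ a (rewards z r) (winners z r)) ?_ h
  intro a z z' h
  have h2 : ∀ n, z (r, n) = z' (r, n) := fun n => h _ (by
    rw [Finset.mem_coe, mem_box]; simp)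
  have h3 : rewards z r = rewards z' r := by funext n; simp only [rewards, h2]
  have h4 : winners z r = winners z' r := by funext n; simp only [winners, h2]
  simp only [h3, h4]

/-- A nonnegative process, adapted to the slots `1, …, t`, that decreases in the mean from time
`t₀` on. -/
structure IsSuper (P : Measure Ω) (X : ℤ → Fin N → Ω → Bool)
    (W : ℤ → Fin N → Ω → Finset (Fin M) → Fin M) (t₀ : ℕ) (V : ℕ → Config M N → ℝ≥0∞) :
    Prop where
  dependsOn : ∀ t, DependsOn (V t) (box N 1 (t + 1) : Set (ℤ × Fin N))
  step : ∀ t, t₀ ≤ t → ∀ Q : Config M N → Prop,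
    DependsOn Q (box N 1 (t + 1) : Set (ℤ × Fin N)) →
    ∫⁻ ω in {ω | Q (outcomes X W ω)}, V (t + 1) (outcomes X W ω) ∂P
      ≤ ∫⁻ ω in {ω | Q (outcomes X W ω)}, V t (outcomes X W ω) ∂P

variable {V : ℕ → Config M N → ℝ≥0∞} {t₀ : ℕ}

theorem IsSuper.lintegral_le (hV : IsSuper P X W t₀ V) {t : ℕ} (ht : t₀ ≤ t) :
    ∫⁻ ω, V t (outcomes X W ω) ∂P ≤ ∫⁻ ω, V t₀ (outcomes X W ω) ∂P := by
  induction t, ht using Nat.le_induction with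
  | base => exact le_rfl
  | succ t ht ih =>
    have := hV.step t ht (fun _ => True) (fun _ _ _ => rfl)
    simp only [Set.ofPred_true, Measure.restrict_univ] at this
    exact this.trans ih

/-- Ville's inequality. -/
theorem IsSystem.ville (hs : IsSystem P μ X W) (hV : IsSuper P X W t₀ V) (a : ℝ≥0∞) (T : ℕ) :
    a * P {ω | ∃ t, t₀ ≤ t ∧ t ≤ T ∧ a ≤ V t (outcomes X W ω)}
      ≤ ∫⁻ ω, V t₀ (outcomes X W ω) ∂P := by
  let H : ℕ → Config M N → Prop := fun T z => ∃ t, t₀ ≤ t ∧ t ≤ T ∧ a ≤ V t z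
  have hH : ∀ T, DependsOn (H T) (box N 1 (T + 1) : Set (ℤ × Fin N)) := by
    intro T z z' h
    refine propext (exists_congr fun t => and_congr_right fun _ => and_congr_right fun ht => ?_)
    rw [(hV.dependsOn t).mono (box_subset le_rfl (by omega)) h]
  have hHm : ∀ T, MeasurableSet {ω | H T (outcomes X W ω)} := fun T => hs.measurableSet_outcomes (hH T)
  have hVm : ∀ t, Measurable fun ω => V t (outcomes X W ω) := fun t =>
    measurable_comp_of_dependsOn hs.measurable_outcomes (hV.dependsOn t)
  have hGm : ∀ t, MeasurableSet {ω | a ≤ V t (outcomes X W ω)} := fun t =>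
    measurableSet_le measurable_const (hVm t)
  -- The process is stopped when it first reaches the level `a`: stopped mass is counted with `a`,
  -- the rest with the current value, and the total does not increase with `T`.
  have key : ∀ T, t₀ ≤ T → a * P {ω | H T (outcomes X W ω)}
      + ∫⁻ ω in {ω | ¬ H T (outcomes X W ω)}, V T (outcomes X W ω) ∂P
      ≤ ∫⁻ ω, V t₀ (outcomes X W ω) ∂P := by
    intro T hT
    induction T, hT using Nat.le_induction with
    | base =>
      have hc : {ω | ¬ H t₀ (outcomes X W ω)} = {ω | H t₀ (outcomes X W ω)}ᶜ := rfl
      rw [← lintegral_add_compl (μ := P) (fun ω => V t₀ (outcomes X W ω)) (hHm t₀), hc]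
      gcongr
      rw [← setLIntegral_const]
      refine setLIntegral_mono (hVm t₀) fun ω hω => ?_
      obtain ⟨t, h1, h2, h3⟩ : H t₀ (outcomes X W ω) := hω
      rwa [show t = t₀ by omega] at h3
    | succ T hT ih =>
      refine le_trans ?_ ih
      have hsplit : P {ω | H (T + 1) (outcomes X W ω)} ≤ P {ω | H T (outcomes X W ω)}
          + P ({ω | a ≤ V (T + 1) (outcomes X W ω)} ∩ {ω | ¬ H T (outcomes X W ω)}) := by
        refine le_trans (measure_mono ?_) (measure_union_le _ _)
        rintro ω ⟨t, h1, h2, h3⟩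
        by_cases h : H T (outcomes X W ω)
        · exact Or.inl h
        · refine Or.inr ⟨?_, h⟩
          rcases Nat.lt_or_ge T t with h4 | h4
          · rwa [show t = T + 1 by omega] at h3
          · exact absurd ⟨t, h1, h4, h3⟩ h
      have hstep := hV.step T hT (fun z => ¬ H T z) (fun z z' h => by simp only [hH T h])
      have hmono : ∫⁻ ω in {ω | ¬ H (T + 1) (outcomes X W ω)}, V (T + 1) (outcomes X W ω) ∂P
          ≤ ∫⁻ ω in {ω | ¬ H T (outcomes X W ω)} \ {ω | a ≤ V (T + 1) (outcomes X W ω)},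
            V (T + 1) (outcomes X W ω) ∂P := by
        refine lintegral_mono_set fun ω hω => ⟨fun ⟨t, h1, h2, h3⟩ => hω ⟨t, h1, by omega, h3⟩,
          fun h => hω ⟨T + 1, by omega, le_rfl, h⟩⟩
      have hmain : a * P ({ω | a ≤ V (T + 1) (outcomes X W ω)} ∩ {ω | ¬ H T (outcomes X W ω)})
          + ∫⁻ ω in {ω | ¬ H T (outcomes X W ω)} \ {ω | a ≤ V (T + 1) (outcomes X W ω)},
            V (T + 1) (outcomes X W ω) ∂P
          ≤ ∫⁻ ω in {ω | ¬ H T (outcomes X W ω)}, V (T + 1) (outcomes X W ω) ∂P := by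
        rw [← lintegral_inter_add_sdiff _ {ω | ¬ H T (outcomes X W ω)} (hGm (T + 1))]
        refine add_le_add ?_ le_rfl
        rw [← setLIntegral_const, Set.inter_comm]
        exact setLIntegral_mono (hVm _) fun ω hω => hω.2
      calc _ ≤ a * (P {ω | H T (outcomes X W ω)}
            + P ({ω | a ≤ V (T + 1) (outcomes X W ω)} ∩ {ω | ¬ H T (outcomes X W ω)}))
            + ∫⁻ ω in {ω | ¬ H T (outcomes X W ω)} \ {ω | a ≤ V (T + 1) (outcomes X W ω)},
              V (T + 1) (outcomes X W ω) ∂P := by gcongr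
        _ = a * P {ω | H T (outcomes X W ω)} +
            (a * P ({ω | a ≤ V (T + 1) (outcomes X W ω)} ∩ {ω | ¬ H T (outcomes X W ω)})
            + ∫⁻ ω in {ω | ¬ H T (outcomes X W ω)} \ {ω | a ≤ V (T + 1) (outcomes X W ω)},
              V (T + 1) (outcomes X W ω) ∂P) := by ring
        _ ≤ _ := by gcongr; exact hmain.trans hstep
  rcases Nat.lt_or_ge T t₀ with h | h
  · have : {ω | ∃ t, t₀ ≤ t ∧ t ≤ T ∧ a ≤ V t (outcomes X W ω)} = ∅ := by
      ext ω
      simp only [Set.mem_ofPred_eq, Set.mem_empty_iff_false, iff_false]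
      rintro ⟨t, h1, h2, -⟩
      omega
    simp [this]
  · exact le_self_add.trans (key T h)

/-- A function of the state that decreases in the mean in a slot. -/
theorem IsSystem.setLIntegral_slot_le (hs : IsSystem P μ X W) {r : ℤ} {π : Type*}
    {p : Config M N → π} (hp : DependsOn p (box N 1 r : Set (ℤ × Fin N)))
    {Q : Config M N → Prop} (hQ : DependsOn Q (box N 1 r : Set (ℤ × Fin N)))
    (Φ : π → (Fin N → Bool) → (Fin N → Finset (Fin M) → Fin M) → ℝ≥0∞) (G : π → ℝ≥0∞)
    (h : ∀ a, ∫⁻ ω, Φ a (fun n => X r n ω) (fun n => W r n ω) ∂P ≤ G a) :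
    ∫⁻ ω in {ω | Q (outcomes X W ω)}, Φ (p (outcomes X W ω)) (fun n => X r n ω) (fun n => W r n ω) ∂P
      ≤ ∫⁻ ω in {ω | Q (outcomes X W ω)}, G (p (outcomes X W ω)) ∂P := by
  classical
  have hQm := hs.measurableSet_outcomes hQ
  have main := hs.lintegral_slot_le (a := 1) (r := r) (p := fun z => (Q z, p z))
    (fun z z' h => by simp only [hQ h, hp h])
    (fun b x w => if b.1 then Φ b.2 x w else 0) (fun b => if b.1 then G b.2 else 0) (by
      rintro ⟨b1, b2⟩
      by_cases hb : b1
      · simpa [hb] using h b2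
      · simp [hb])
  rw [← lintegral_indicator hQm, ← lintegral_indicator hQm]
  convert main using 3
  · simp [Set.indicator_apply]
  · simp [Set.indicator_apply]

end Supermartingale

/-! ### Concentration of the estimates -/

section Concentration

variable {M N L : ℕ} {Ω : Type*} [MeasurableSpace Ω] {P : Measure Ω} [IsProbabilityMeasure P]
  {μ : Fin N → ℝ} {X : ℤ → Fin N → Ω → Bool} {W : ℤ → Fin N → Ω → Finset (Fin M) → Fin M}
  (hML : M ≤ L) (hLN : L ≤ N) (σ : Fin M → ℕ → LocalState N → Fin N)

/-- The exponential weight of the estimate of channel `n`. -/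
noncomputable def expWeight (ν l : ℝ) (n : Fin N) (s : LocalState N) : ℝ≥0∞ :=
  ENNReal.ofReal (Real.exp (l * ((s.est n - ν) * s.cnt n) - s.cnt n * (l ^ 2 / 8)))

theorem dlfStep_of_le {t : ℕ} (ht : t ≤ N) (prev : Fin M → LocalState N) (x : Fin N → Bool)
    (w : Fin N → Finset (Fin M) → Fin M) (m : Fin M) :
    dlfStep hML hLN σ t prev x w m =
      ⟨Function.update (prev m).est (rrChannel hML hLN m t)
          (if x (rrChannel hML hLN m t) = true then 1 else 0),
        Function.update (prev m).cnt (rrChannel hML hLN m t) 1⟩ := by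
  simp only [dlfStep, dlfSelect, ht, if_true]

theorem dlfStep_of_acquires {t : ℕ} (ht : N < t) (prev : Fin M → LocalState N) (x : Fin N → Bool)
    (w : Fin N → Finset (Fin M) → Fin M) (m : Fin M)
    (h : Acquires w (dlfSelect hML hLN σ t prev) m) :
    dlfStep hML hLN σ t prev x w m =
      ⟨Function.update (prev m).est (dlfSelect hML hLN σ t prev m)
          (((prev m).est (dlfSelect hML hLN σ t prev m) *
            (prev m).cnt (dlfSelect hML hLN σ t prev m) +
            (if x (dlfSelect hML hLN σ t prev m) = true then 1 else 0)) /
            ((prev m).cnt (dlfSelect hML hLN σ t prev m) + 1)),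
        Function.update (prev m).cnt (dlfSelect hML hLN σ t prev m)
          ((prev m).cnt (dlfSelect hML hLN σ t prev m) + 1)⟩ := by
  simp only [dlfStep, not_le.mpr ht, if_false, h, if_true]

theorem dlfStep_of_not_acquires {t : ℕ} (ht : N < t) (prev : Fin M → LocalState N)
    (x : Fin N → Bool) (w : Fin N → Finset (Fin M) → Fin M) (m : Fin M)
    (h : ¬ Acquires w (dlfSelect hML hLN σ t prev) m) :
    dlfStep hML hLN σ t prev x w m = prev m := by
  simp only [dlfStep, not_le.mpr ht, if_false, h]

/-- The product of estimate and count is the sum of the rewards, so an observation multiplies the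
weight by one Hoeffding factor. -/
theorem expWeight_update (ν l : ℝ) (n : Fin N) (s : LocalState N) (y : ℝ) :
    expWeight ν l n ⟨Function.update s.est n ((s.est n * s.cnt n + y) / (s.cnt n + 1)),
        Function.update s.cnt n (s.cnt n + 1)⟩
      = expWeight ν l n s * ENNReal.ofReal (Real.exp (l * (y - ν) - l ^ 2 / 8)) := by
  rw [expWeight, expWeight, ← ENNReal.ofReal_mul (Real.exp_pos _).le, ← Real.exp_add]
  congr 2
  simp only [Function.update_self]
  have : (s.cnt n : ℝ) + 1 ≠ 0 := by positivity
  push_cast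
  field_simp
  ring

/-- During the initialization a channel is unobserved, or its estimate is its last single reward;
the weight is `1` or a single Hoeffding factor. -/
theorem IsSystem.lintegral_expWeight_le (hs : IsSystem P μ X W) (hμ : ∀ n, 0 ≤ μ n) (l : ℝ)
    (m : Fin M) (n : Fin N) {t : ℕ} (ht : t ≤ N) :
    ∫⁻ ω, expWeight (μ n) l n (stateOf hML hLN σ t (outcomes X W ω) m) ∂P ≤ 1 := by
  induction t with
  | zero => simp [stateOf_zero, expWeight]
  | succ t ih =>
    by_cases h : rrChannel hML hLN m (t + 1) = n
    · have e : ∀ ω, expWeight (μ n) l n (stateOf hML hLN σ (t + 1) (outcomes X W ω) m)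
          = ENNReal.ofReal (Real.exp (l * ((if X ((t + 1 : ℕ) : ℤ) n ω = true then 1 else 0) - μ n)
            - l ^ 2 / 8)) := by
        intro ω
        rw [stateOf_succ, dlfStep_of_le hML hLN σ ht, expWeight, h]
        simp [rewards]
      simp_rw [e]
      exact hs.lintegral_exp_reward_le hμ _ n l
    · have e : ∀ ω, expWeight (μ n) l n (stateOf hML hLN σ (t + 1) (outcomes X W ω) m)
          = expWeight (μ n) l n (stateOf hML hLN σ t (outcomes X W ω) m) := by
        intro ω
        rw [stateOf_succ, dlfStep_of_le hML hLN σ ht, expWeight, expWeight]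
        simp [Function.update_of_ne (Ne.symm h)]
      simp_rw [e]
      exact ih (by omega)

/-- Given the state, the selected channel is fixed, and the estimate changes only if the channel is
acquired, which is independent of its reward. So neither adaptive sampling nor collisions spoil
concentration. -/
theorem IsSystem.isSuper_expWeight (hs : IsSystem P μ X W) (hμ : ∀ n, 0 ≤ μ n) (l : ℝ)
    (m : Fin M) (n : Fin N) :
    IsSuper P X W N fun t z => expWeight (μ n) l n (stateOf hML hLN σ t z m) where
  dependsOn t z z' h := by simp only [dependsOn_stateOf hML hLN σ t h]
  step t ht Q hQ := by
    refine hs.setLIntegral_slot_le (r := ((t + 1 : ℕ) : ℤ)) (p := stateOf hML hLN σ t)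
      (by exact_mod_cast dependsOn_stateOf hML hLN σ t) (by exact_mod_cast hQ)
      (fun st x w => expWeight (μ n) l n (dlfStep hML hLN σ (t + 1) st x w m))
      (fun st => expWeight (μ n) l n (st m)) ?_
    intro st
    classical
    have ht' : N < t + 1 := by omega
    by_cases hn : dlfSelect hML hLN σ (t + 1) st m = n
    · have e : ∀ ω, expWeight (μ n) l n (dlfStep hML hLN σ (t + 1) st
            (fun n => X ((t + 1 : ℕ) : ℤ) n ω) (fun n => W ((t + 1 : ℕ) : ℤ) n ω) m)
          = expWeight (μ n) l n (st m) * (if Acquires (fun n => W ((t + 1 : ℕ) : ℤ) n ω)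
              (dlfSelect hML hLN σ (t + 1) st) m then ENNReal.ofReal (Real.exp (l *
                ((if X ((t + 1 : ℕ) : ℤ) (dlfSelect hML hLN σ (t + 1) st m) ω = true
                  then 1 else 0) - μ (dlfSelect hML hLN σ (t + 1) st m)) - l ^ 2 / 8))
              else 1) := by
        intro ω
        by_cases hacq : Acquires (fun n => W ((t + 1 : ℕ) : ℤ) n ω)
            (dlfSelect hML hLN σ (t + 1) st) m
        · rw [dlfStep_of_acquires hML hLN σ ht' _ _ _ _ hacq, if_pos hacq, hn,
            expWeight_update]
        · rw [dlfStep_of_not_acquires hML hLN σ ht' _ _ _ _ hacq, if_neg hacq, mul_one]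
      simp_rw [e]
      rw [lintegral_const_mul' (expWeight (μ n) l n (st m)) _ ENNReal.ofReal_ne_top]
      exact mul_le_of_le_one_right' (hs.lintegral_exp_acquired_le hμ _ _ m l)
    · have e : ∀ ω, expWeight (μ n) l n (dlfStep hML hLN σ (t + 1) st
            (fun n => X ((t + 1 : ℕ) : ℤ) n ω) (fun n => W ((t + 1 : ℕ) : ℤ) n ω) m)
          = expWeight (μ n) l n (st m) := by
        intro ω
        by_cases hacq : Acquires (fun n => W ((t + 1 : ℕ) : ℤ) n ω)
            (dlfSelect hML hLN σ (t + 1) st) m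
        · rw [dlfStep_of_acquires hML hLN σ ht' _ _ _ _ hacq]
          simp [expWeight, Function.update_of_ne (Ne.symm hn)]
        · rw [dlfStep_of_not_acquires hML hLN σ ht' _ _ _ _ hacq]
      simp_rw [e]
      simp

/-- The number of selections of channel `n` by source `m` in the slots `N + 1, …, t`. -/
noncomputable def selections (m : Fin M) (n : Fin N) (t : ℕ) (z : Config M N) : ℕ :=
  ((Finset.Ioc N t).filter fun r => decisionOf hML hLN σ r z m = n).card

theorem dependsOn_selections (m : Fin M) (n : Fin N) (t : ℕ) :
    DependsOn (selections hML hLN σ m n t) (box N 1 t : Set (ℤ × Fin N)) := by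
  intro z z' h
  simp only [selections]
  congr 1
  refine Finset.filter_congr fun r hr => ?_
  have hr' := (Finset.mem_Ioc.mp hr).2
  rw [(dependsOn_decisionOf hML hLN σ r).mono (box_subset le_rfl (by exact_mod_cast hr')) h]

theorem selections_succ (m : Fin M) (n : Fin N) {t : ℕ} (ht : N ≤ t) (z : Config M N) :
    selections hML hLN σ m n (t + 1) z = selections hML hLN σ m n t z +
      (if decisionOf hML hLN σ (t + 1) z m = n then 1 else 0) := by
  have : Finset.Ioc N (t + 1) = insert (t + 1) (Finset.Ioc N t) := by
    ext r; simp only [Finset.mem_Ioc, Finset.mem_insert]; omega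
  simp only [selections]
  rw [this, Finset.filter_insert]
  split_ifs with h
  · rw [Finset.card_insert_of_notMem (by simp)]
  · rfl

/-- The weight by which selections without acquisition are controlled. -/
noncomputable def selWeight (M : ℕ) (y c : ℕ) : ℝ≥0∞ :=
  ENNReal.ofReal ((1 - 1 / (2 * M) : ℝ)⁻¹ ^ y * (1 / 2) ^ c)

/-- A selection leads to an acquisition with probability at least `1 / M`. Halving upon acquisition
therefore has mean factor at most `1 - 1 / (2 * M)`, which the inverse power compensates. -/
theorem IsSystem.isSuper_selWeight (hs : IsSystem P μ X W) (m : Fin M) (n : Fin N) :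
    IsSuper P X W N fun t z => selWeight M (selections hML hLN σ m n t z)
      ((stateOf hML hLN σ t z m).cnt n) where
  dependsOn t z z' h := by
    simp only [dependsOn_stateOf hML hLN σ t h,
      (dependsOn_selections hML hLN σ m n t).mono (box_subset le_rfl (by omega)) h]
  step t ht Q hQ := by
    have hM1 : (1 : ℝ) ≤ M := by exact_mod_cast m.pos
    have hκ : (0 : ℝ) < 1 - 1 / (2 * M) := by
      have : 1 / (2 * (M : ℝ)) ≤ 1 / 2 := by
        apply one_div_le_one_div_of_le <;> linarith
      linarith
    have ht' : N < t + 1 := by omega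
    have e : ∀ ω, selWeight M (selections hML hLN σ m n (t + 1) (outcomes X W ω))
        ((stateOf hML hLN σ (t + 1) (outcomes X W ω) m).cnt n)
        = selWeight M (selections hML hLN σ m n t (outcomes X W ω) +
            if dlfSelect hML hLN σ (t + 1) (stateOf hML hLN σ t (outcomes X W ω)) m = n then 1 else 0)
            ((dlfStep hML hLN σ (t + 1) (stateOf hML hLN σ t (outcomes X W ω))
              (fun n => X ((t + 1 : ℕ) : ℤ) n ω) (fun n => W ((t + 1 : ℕ) : ℤ) n ω) m).cnt n) := by
      intro ω
      rw [selections_succ hML hLN σ m n ht, stateOf_succ, decisionOf_succ]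
    simp_rw [e]
    refine hs.setLIntegral_slot_le (r := ((t + 1 : ℕ) : ℤ))
      (p := fun z => (stateOf hML hLN σ t z, selections hML hLN σ m n t z))
      (by
        intro z z' h
        simp only [dependsOn_stateOf hML hLN σ t (by exact_mod_cast h),
          (dependsOn_selections hML hLN σ m n t).mono (box_subset le_rfl (by simp)) h])
      (by exact_mod_cast hQ)
      (fun q x w => selWeight M (q.2 + if dlfSelect hML hLN σ (t + 1) q.1 m = n then 1 else 0)
        ((dlfStep hML hLN σ (t + 1) q.1 x w m).cnt n))
      (fun q => selWeight M q.2 ((q.1 m).cnt n)) ?_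
    rintro ⟨st, y⟩
    classical
    by_cases hn : dlfSelect hML hLN σ (t + 1) st m = n
    · have e : ∀ ω, selWeight M (y + if dlfSelect hML hLN σ (t + 1) st m = n then 1 else 0)
            ((dlfStep hML hLN σ (t + 1) st
            (fun n => X ((t + 1 : ℕ) : ℤ) n ω) (fun n => W ((t + 1 : ℕ) : ℤ) n ω) m).cnt n)
          = (selWeight M y ((st m).cnt n) * ENNReal.ofReal (1 - 1 / (2 * M) : ℝ)⁻¹) *
            (if Acquires (fun n => W ((t + 1 : ℕ) : ℤ) n ω)
              (dlfSelect hML hLN σ (t + 1) st) m then ENNReal.ofReal (1 / 2) else 1) := by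
        intro ω
        rw [if_pos hn]
        have hA : ∀ c, selWeight M (y + 1) c
            = selWeight M y c * ENNReal.ofReal (1 - 1 / (2 * M) : ℝ)⁻¹ := by
          intro c
          rw [selWeight, selWeight, ← ENNReal.ofReal_mul (by positivity)]
          congr 1
          rw [pow_succ]
          ring
        by_cases hacq : Acquires (fun n => W ((t + 1 : ℕ) : ℤ) n ω)
            (dlfSelect hML hLN σ (t + 1) st) m
        · rw [dlfStep_of_acquires hML hLN σ ht' _ _ _ _ hacq, if_pos hacq, hn, hA]
          simp only [Function.update_self]
          have hB : selWeight M y ((st m).cnt n + 1)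
              = selWeight M y ((st m).cnt n) * ENNReal.ofReal (1 / 2) := by
            rw [selWeight, selWeight, ← ENNReal.ofReal_mul (by positivity)]
            congr 1
            rw [pow_succ]
            ring
          rw [hB]
          ring
        · rw [dlfStep_of_not_acquires hML hLN σ ht' _ _ _ _ hacq, if_neg hacq, mul_one, hA]
      simp_rw [e]
      rw [lintegral_const_mul' (selWeight M y ((st m).cnt n) *
          ENNReal.ofReal (1 - 1 / (2 * M) : ℝ)⁻¹) _ (ENNReal.mul_ne_top ENNReal.ofReal_ne_top ENNReal.ofReal_ne_top),
        mul_assoc]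
      refine mul_le_of_le_one_right' ?_
      calc _ ≤ ENNReal.ofReal (1 - 1 / (2 * M) : ℝ)⁻¹ * ENNReal.ofReal (1 - 1 / (2 * M) : ℝ) := by
            gcongr
            exact hs.lintegral_half_acquired_le _ _ m
        _ = 1 := by
            rw [← ENNReal.ofReal_mul (by positivity), inv_mul_cancel₀ hκ.ne', ENNReal.ofReal_one]
    · have e : ∀ ω, selWeight M (y + if dlfSelect hML hLN σ (t + 1) st m = n then 1 else 0)
            ((dlfStep hML hLN σ (t + 1) st
            (fun n => X ((t + 1 : ℕ) : ℤ) n ω) (fun n => W ((t + 1 : ℕ) : ℤ) n ω) m).cnt n)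
          = selWeight M y ((st m).cnt n) := by
        intro ω
        rw [if_neg hn, add_zero]
        by_cases hacq : Acquires (fun n => W ((t + 1 : ℕ) : ℤ) n ω)
            (dlfSelect hML hLN σ (t + 1) st) m
        · rw [dlfStep_of_acquires hML hLN σ ht' _ _ _ _ hacq]
          simp [Function.update_of_ne (Ne.symm hn)]
        · rw [dlfStep_of_not_acquires hML hLN σ ht' _ _ _ _ hacq]
      simp_rw [e]
      simp

end Concentration

theorem le_ofReal_of_mul_le_one {u v : ℝ} (hu : 0 ≤ u) (huv : u * v = 1) {p : ℝ≥0∞}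
    (h : ENNReal.ofReal v * p ≤ 1) : p ≤ ENNReal.ofReal u := by
  calc p = ENNReal.ofReal u * (ENNReal.ofReal v * p) := by
        rw [← mul_assoc, ← ENNReal.ofReal_mul hu, huv]
        simp
    _ ≤ ENNReal.ofReal u * 1 := by gcongr
    _ = _ := mul_one _

section States

variable {M N L : ℕ} (hML : M ≤ L) (hLN : L ≤ N) (σ : Fin M → ℕ → LocalState N → Fin N)

/-! ### Elementary properties of the states -/

/-- The integrality of estimate times count is the rationality on which the exclusion of ties rests.
-/
theorem est_bounds (t : ℕ) (z : Config M N) (m : Fin M) (n : Fin N) :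
    0 ≤ (stateOf hML hLN σ t z m).est n ∧ (stateOf hML hLN σ t z m).est n ≤ 1 ∧
      ∃ k : ℕ, (stateOf hML hLN σ t z m).est n * (stateOf hML hLN σ t z m).cnt n = k := by
  induction t with
  | zero => exact ⟨by simp [stateOf_zero], by simp [stateOf_zero], 0, by simp [stateOf_zero]⟩
  | succ t ih =>
    rw [stateOf_succ]
    rcases Nat.lt_or_ge N (t + 1) with ht | ht
    · by_cases hacq : Acquires (winners z ((t + 1 : ℕ) : ℤ))
        (dlfSelect hML hLN σ (t + 1) (stateOf hML hLN σ t z)) m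
      · rw [dlfStep_of_acquires hML hLN σ ht _ _ _ _ hacq]
        by_cases hn : n = dlfSelect hML hLN σ (t + 1) (stateOf hML hLN σ t z) m
        · rw [← hn]
          simp only [Function.update_self]
          obtain ⟨h0, h1, k, hk⟩ := ih
          set e := (stateOf hML hLN σ t z m).est n
          set c := (stateOf hML hLN σ t z m).cnt n
          have hc : (0 : ℝ) < (c : ℝ) + 1 := by positivity
          have hc0 : (0 : ℝ) ≤ c := Nat.cast_nonneg c
          refine ⟨?_, ?_, ?_⟩
          · split_ifs <;> positivity
          · rw [div_le_one hc]
            split_ifs <;> nlinarith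
          · split_ifs
            · refine ⟨k + 1, ?_⟩
              push_cast
              rw [div_mul_cancel₀ _ hc.ne', hk]
            · refine ⟨k, ?_⟩
              push_cast
              rw [div_mul_cancel₀ _ hc.ne', hk, add_zero]
        · simpa only [Function.update_of_ne hn] using ih
      · rw [dlfStep_of_not_acquires hML hLN σ ht _ _ _ _ hacq]
        exact ih
    · rw [dlfStep_of_le hML hLN σ ht]
      by_cases hn : n = rrChannel hML hLN m (t + 1)
      · rw [← hn]
        simp only [Function.update_self]
        refine ⟨by split_ifs <;> norm_num, by split_ifs <;> norm_num, ?_⟩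
        split_ifs
        · exact ⟨1, by norm_num⟩
        · exact ⟨0, by norm_num⟩
      · simpa only [Function.update_of_ne hn] using ih

theorem cnt_le_one (t : ℕ) (ht : t ≤ N) (z : Config M N) (m : Fin M) (n : Fin N) :
    (stateOf hML hLN σ t z m).cnt n ≤ 1 := by
  induction t with
  | zero => simp [stateOf_zero]
  | succ t ih =>
    rw [stateOf_succ, dlfStep_of_le hML hLN σ ht]
    by_cases hn : n = rrChannel hML hLN m (t + 1)
    · rw [← hn]; simp
    · simpa only [Function.update_of_ne hn] using ih (by omega)

theorem cnt_step (t : ℕ) (z : Config M N) (m : Fin M) (n : Fin N) :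
    (stateOf hML hLN σ t z m).cnt n ≤ (stateOf hML hLN σ (t + 1) z m).cnt n ∧
      (stateOf hML hLN σ (t + 1) z m).cnt n ≤ (stateOf hML hLN σ t z m).cnt n + 1 := by
  rw [stateOf_succ]
  rcases Nat.lt_or_ge N (t + 1) with ht | ht
  · by_cases hacq : Acquires (winners z ((t + 1 : ℕ) : ℤ))
      (dlfSelect hML hLN σ (t + 1) (stateOf hML hLN σ t z)) m
    · rw [dlfStep_of_acquires hML hLN σ ht _ _ _ _ hacq]
      by_cases hn : n = dlfSelect hML hLN σ (t + 1) (stateOf hML hLN σ t z) m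
      · rw [← hn]; simp
      · simp [Function.update_of_ne hn]
    · rw [dlfStep_of_not_acquires hML hLN σ ht _ _ _ _ hacq]
      simp
  · rw [dlfStep_of_le hML hLN σ ht]
    by_cases hn : n = rrChannel hML hLN m (t + 1)
    · rw [← hn]
      have := cnt_le_one hML hLN σ t (by omega) z m n
      simp only [Function.update_self]
      omega
    · simp [Function.update_of_ne hn]

theorem cnt_mono {t t' : ℕ} (h : t ≤ t') (z : Config M N) (m : Fin M) (n : Fin N) :
    (stateOf hML hLN σ t z m).cnt n ≤ (stateOf hML hLN σ t' z m).cnt n := by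
  induction t', h using Nat.le_induction with
  | base => exact le_rfl
  | succ t' _ ih => exact ih.trans (cnt_step hML hLN σ t' z m n).1

theorem cnt_le (t : ℕ) (z : Config M N) (m : Fin M) (n : Fin N) :
    (stateOf hML hLN σ t z m).cnt n ≤ t := by
  induction t with
  | zero => simp [stateOf_zero]
  | succ t ih => exact (cnt_step hML hLN σ t z m n).2.trans (by omega)

end States

section Events

variable {M N L : ℕ} {Ω : Type*} [MeasurableSpace Ω] {P : Measure Ω} [IsProbabilityMeasure P]
  {μ : Fin N → ℝ} {X : ℤ → Fin N → Ω → Bool} {W : ℤ → Fin N → Ω → Finset (Fin M) → Fin M}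
  (hML : M ≤ L) (hLN : L ≤ N) (σ : Fin M → ℕ → LocalState N → Fin N)

/-! ### Probabilities of the exceptional events -/

/-- In slot `s` some estimate is off by more than its confidence radius. -/
def ConfFail (μ : Fin N → ℝ) (s : ℕ) (z : Config M N) : Prop :=
  ∃ m n, 0 < (stateOf hML hLN σ (s - 1) z m).cnt n ∧
    √(2 * Real.log s / (stateOf hML hLN σ (s - 1) z m).cnt n)
      < |(stateOf hML hLN σ (s - 1) z m).est n - μ n|

/-- Some estimate that rests on at least `τ` observations is off by more than `η`. -/
def EstFail (μ : Fin N → ℝ) (τ η : ℝ) (T : ℕ) (z : Config M N) : Prop :=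
  ∃ t, N ≤ t ∧ t ≤ T ∧ ∃ m n, τ ≤ (stateOf hML hLN σ t z m).cnt n ∧
    η < |(stateOf hML hLN σ t z m).est n - μ n|

/-- The number of selections of channel `n` by source `m` in the slots `N + 1, …, T` that rest on
at most `l` observations. -/
noncomputable def lowCount (l T : ℕ) (m : Fin M) (n : Fin N) (z : Config M N) : ℕ :=
  ((Finset.Ioc N T).filter fun r => decisionOf hML hLN σ r z m = n ∧
    (stateOf hML hLN σ (r - 1) z m).cnt n ≤ l).card

theorem IsSystem.prob_expWeight_ge_le (hs : IsSystem P μ X W) (hμ : ∀ n, 0 ≤ μ n) (l b : ℝ)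
    (m : Fin M) (n : Fin N) {t : ℕ} (ht : N ≤ t) :
    P {ω | b ≤ l * (((stateOf hML hLN σ t (outcomes X W ω) m).est n - μ n) *
        (stateOf hML hLN σ t (outcomes X W ω) m).cnt n)
        - (stateOf hML hLN σ t (outcomes X W ω) m).cnt n * (l ^ 2 / 8)}
      ≤ ENNReal.ofReal (Real.exp (-b)) := by
  have hV := hs.isSuper_expWeight hML hLN σ hμ l m n
  have hE := (hV.lintegral_le ht).trans (hs.lintegral_expWeight_le hML hLN σ hμ l m n le_rfl)
  have hm : Measurable fun ω => expWeight (μ n) l n (stateOf hML hLN σ t (outcomes X W ω) m) :=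
    measurable_comp_of_dependsOn hs.measurable_outcomes (hV.dependsOn t)
  have hmk := mul_meas_ge_le_lintegral (μ := P) hm (ENNReal.ofReal (Real.exp b))
  have hset : {ω | b ≤ l * (((stateOf hML hLN σ t (outcomes X W ω) m).est n - μ n) *
        (stateOf hML hLN σ t (outcomes X W ω) m).cnt n)
        - (stateOf hML hLN σ t (outcomes X W ω) m).cnt n * (l ^ 2 / 8)}
      ⊆ {ω | ENNReal.ofReal (Real.exp b)
        ≤ expWeight (μ n) l n (stateOf hML hLN σ t (outcomes X W ω) m)} := fun ω hω =>
    ENNReal.ofReal_le_ofReal (Real.exp_le_exp.mpr hω)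
  have h1 : ENNReal.ofReal (Real.exp b) * P {ω | b ≤ l * (((stateOf hML hLN σ t (outcomes X W ω)
        m).est n - μ n) * (stateOf hML hLN σ t (outcomes X W ω) m).cnt n)
        - (stateOf hML hLN σ t (outcomes X W ω) m).cnt n * (l ^ 2 / 8)} ≤ 1 :=
    (mul_le_mul_right (measure_mono hset) _).trans (hmk.trans hE)
  exact le_ofReal_of_mul_le_one (Real.exp_pos _).le (by rw [← Real.exp_add]; simp) h1

/-- The suitable exponent is four times the radius and depends on the random count. A union over all
counts up to `s` makes it deterministic and turns `s ^ (-4)` into `s ^ (-3)`, which is summable. -/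
theorem IsSystem.prob_confFail_le (hs : IsSystem P μ X W) (hμ : ∀ n, 0 ≤ μ n) {s : ℕ}
    (hsN : N < s) :
    P {ω | ConfFail hML hLN σ μ s (outcomes X W ω)}
      ≤ ENNReal.ofReal (2 * M * N / (s : ℝ) ^ 3) := by
  have hspos : (0 : ℝ) < s := by exact_mod_cast (by omega : 0 < s)
  have hs1 : (1 : ℝ) ≤ s := by exact_mod_cast (by omega : 1 ≤ s)
  have hlog : 0 ≤ Real.log s := Real.log_nonneg hs1
  -- With radius `r` and count `c`, the exponent `l = 4 r` gives at least `4 r² c - 2 r² c = 2 r² c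
  -- = 4 log s`.
  let b := 4 * Real.log s
  let E : Fin M → Fin N → ℝ → Set Ω := fun m n l =>
    {ω | b ≤ l * (((stateOf hML hLN σ (s - 1) (outcomes X W ω) m).est n - μ n) *
        (stateOf hML hLN σ (s - 1) (outcomes X W ω) m).cnt n)
        - (stateOf hML hLN σ (s - 1) (outcomes X W ω) m).cnt n * (l ^ 2 / 8)}
  have hE : ∀ m n l, P (E m n l) ≤ ENNReal.ofReal (1 / (s : ℝ) ^ 4) := by
    intro m n l
    have := hs.prob_expWeight_ge_le hML hLN σ hμ l b m n (t := s - 1) (by omega)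
    have e : Real.exp (-b) = 1 / (s : ℝ) ^ 4 := by
      have : b = Real.log ((s : ℝ) ^ 4) := by rw [Real.log_pow]; norm_num [b]
      rw [this, Real.exp_neg, Real.exp_log (by positivity), one_div]
    rwa [e] at this
  let r : ℕ → ℝ := fun c => √(2 * Real.log s / c)
  have hsub : {ω | ConfFail hML hLN σ μ s (outcomes X W ω)} ⊆
      ⋃ m ∈ (Finset.univ : Finset (Fin M)), ⋃ n ∈ (Finset.univ : Finset (Fin N)),
        ⋃ c ∈ Finset.Icc 1 s, (E m n (4 * r c) ∪ E m n (-(4 * r c))) := by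
    rintro ω ⟨m, n, hc, hlt⟩
    simp only [Finset.mem_univ, Set.iUnion_true, Set.mem_iUnion]
    set st := stateOf hML hLN σ (s - 1) (outcomes X W ω) m with hst
    have hcr : (0 : ℝ) < st.cnt n := by exact_mod_cast hc
    refine ⟨m, n, st.cnt n, Finset.mem_Icc.mpr ⟨hc, ?_⟩, ?_⟩
    · have := cnt_le hML hLN σ (s - 1) (outcomes X W ω) m n
      rw [← hst] at this
      omega
    · have hr0 : 0 ≤ r (st.cnt n) := Real.sqrt_nonneg _
      have hrr : r (st.cnt n) * r (st.cnt n) * st.cnt n = 2 * Real.log s := by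
        rw [Real.mul_self_sqrt (by positivity)]; field_simp
      rcases lt_abs.mp hlt with h | h
      · left
        change b ≤ 4 * r (st.cnt n) * ((st.est n - μ n) * st.cnt n)
          - st.cnt n * ((4 * r (st.cnt n)) ^ 2 / 8)
        have : r (st.cnt n) * (r (st.cnt n) * st.cnt n)
            ≤ r (st.cnt n) * ((st.est n - μ n) * st.cnt n) := by
          gcongr
        simp only [b]
        nlinarith
      · right
        change b ≤ -(4 * r (st.cnt n)) * ((st.est n - μ n) * st.cnt n)
          - st.cnt n * ((-(4 * r (st.cnt n))) ^ 2 / 8)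
        have : r (st.cnt n) * (r (st.cnt n) * st.cnt n)
            ≤ r (st.cnt n) * (-(st.est n - μ n) * st.cnt n) := by
          gcongr
        simp only [b]
        nlinarith
  calc P {ω | ConfFail hML hLN σ μ s (outcomes X W ω)}
      ≤ ∑ m : Fin M, ∑ n : Fin N, ∑ c ∈ Finset.Icc 1 s,
        (ENNReal.ofReal (1 / (s : ℝ) ^ 4) + ENNReal.ofReal (1 / (s : ℝ) ^ 4)) := by
        refine (measure_mono hsub).trans ?_
        refine (measure_biUnion_finset_le _ _).trans (Finset.sum_le_sum fun m _ => ?_)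
        refine (measure_biUnion_finset_le _ _).trans (Finset.sum_le_sum fun n _ => ?_)
        refine (measure_biUnion_finset_le _ _).trans (Finset.sum_le_sum fun c _ => ?_)
        exact (measure_union_le _ _).trans (add_le_add (hE _ _ _) (hE _ _ _))
    _ = _ := by
        rw [← ENNReal.ofReal_add (by positivity) (by positivity)]
        simp only [Finset.sum_const, Finset.card_univ, Fintype.card_fin, Nat.card_Icc,
          nsmul_eq_mul]
        rw [← ENNReal.ofReal_natCast, ← ENNReal.ofReal_natCast, ← ENNReal.ofReal_natCast,
          ← ENNReal.ofReal_mul (by positivity), ← ENNReal.ofReal_mul (by positivity),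
          ← ENNReal.ofReal_mul (by positivity)]
        congr 1
        have : ((s + 1 - 1 : ℕ) : ℝ) = s := by simp
        rw [this]
        field_simp
        ring

/-- Here the error `η` is fixed, so the single exponent `4 η` serves all counts and Ville's
inequality covers all slots at once; the bound does not depend on `T`. -/
theorem IsSystem.prob_estFail_le (hs : IsSystem P μ X W) (hμ : ∀ n, 0 ≤ μ n) {τ η : ℝ}
    (hη : 0 < η) (T : ℕ) :
    P {ω | EstFail hML hLN σ μ τ η T (outcomes X W ω)}
      ≤ ENNReal.ofReal (2 * M * N * Real.exp (-(2 * η ^ 2 * τ))) := by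
  let a := ENNReal.ofReal (Real.exp (2 * η ^ 2 * τ))
  let E : Fin M → Fin N → ℝ → Set Ω := fun m n l =>
    {ω | ∃ t, N ≤ t ∧ t ≤ T ∧ a ≤ expWeight (μ n) l n (stateOf hML hLN σ t (outcomes X W ω) m)}
  have hE : ∀ m n l, P (E m n l) ≤ ENNReal.ofReal (Real.exp (-(2 * η ^ 2 * τ))) := by
    intro m n l
    have h1 := (hs.ville (hs.isSuper_expWeight hML hLN σ hμ l m n) a T).trans
      (hs.lintegral_expWeight_le hML hLN σ hμ l m n le_rfl)
    exact le_ofReal_of_mul_le_one (Real.exp_pos _).le (by rw [← Real.exp_add]; simp) h1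
  have hsub : {ω | EstFail hML hLN σ μ τ η T (outcomes X W ω)} ⊆
      ⋃ m ∈ (Finset.univ : Finset (Fin M)), ⋃ n ∈ (Finset.univ : Finset (Fin N)),
        (E m n (4 * η) ∪ E m n (-(4 * η))) := by
    rintro ω ⟨t, h1, h2, m, n, hτ, hlt⟩
    simp only [Finset.mem_univ, Set.iUnion_true, Set.mem_iUnion]
    refine ⟨m, n, ?_⟩
    set st := stateOf hML hLN σ t (outcomes X W ω) m with hst
    have hc0 : (0 : ℝ) ≤ st.cnt n := Nat.cast_nonneg _
    rcases lt_abs.mp hlt with h | h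
    · left
      refine ⟨t, h1, h2, ENNReal.ofReal_le_ofReal (Real.exp_le_exp.mpr ?_)⟩
      have h3 : η * (η * st.cnt n) ≤ η * ((st.est n - μ n) * st.cnt n) := by gcongr
      have h4 : η ^ 2 * τ ≤ η ^ 2 * st.cnt n := by gcongr
      nlinarith
    · right
      refine ⟨t, h1, h2, ENNReal.ofReal_le_ofReal (Real.exp_le_exp.mpr ?_)⟩
      have h3 : η * (η * st.cnt n) ≤ η * (-(st.est n - μ n) * st.cnt n) := by gcongr
      have h4 : η ^ 2 * τ ≤ η ^ 2 * st.cnt n := by gcongr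
      nlinarith
  calc P {ω | EstFail hML hLN σ μ τ η T (outcomes X W ω)}
      ≤ ∑ m : Fin M, ∑ n : Fin N, (ENNReal.ofReal (Real.exp (-(2 * η ^ 2 * τ)))
        + ENNReal.ofReal (Real.exp (-(2 * η ^ 2 * τ)))) := by
        refine (measure_mono hsub).trans ?_
        refine (measure_biUnion_finset_le _ _).trans (Finset.sum_le_sum fun m _ => ?_)
        refine (measure_biUnion_finset_le _ _).trans (Finset.sum_le_sum fun n _ => ?_)
        exact (measure_union_le _ _).trans (add_le_add (hE _ _ _) (hE _ _ _))
    _ = _ := by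
        rw [← ENNReal.ofReal_add (by positivity) (by positivity)]
        simp only [Finset.sum_const, Finset.card_univ, Fintype.card_fin, nsmul_eq_mul]
        rw [← ENNReal.ofReal_natCast, ← ENNReal.ofReal_natCast,
          ← ENNReal.ofReal_mul (by positivity), ← ENNReal.ofReal_mul (by positivity)]
        congr 1
        ring

/-- At the last selection made with low count there have been at least `y` selections but at most `l
+ 1` observations. The selection weight is then large, which Ville's inequality makes unlikely. -/
theorem IsSystem.prob_lowCount_ge_le (hs : IsSystem P μ X W) (l T y : ℕ) :
    P {ω | ∃ m n, y ≤ lowCount hML hLN σ l T m n (outcomes X W ω)}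
      ≤ ENNReal.ofReal (M * N * ((1 - 1 / (2 * M) : ℝ) ^ y * 2 ^ (l + 1))) := by
  let a := selWeight M y (l + 1)
  let E : Fin M → Fin N → Set Ω := fun m n =>
    {ω | ∃ t, N ≤ t ∧ t ≤ T ∧ a ≤ selWeight M (selections hML hLN σ m n t (outcomes X W ω))
      ((stateOf hML hLN σ t (outcomes X W ω) m).cnt n)}
  have hκ : ∀ m : Fin M, (0 : ℝ) < 1 - 1 / (2 * M) := by
    intro m
    have hM1 : (1 : ℝ) ≤ M := by exact_mod_cast m.pos
    have : 1 / (2 * (M : ℝ)) ≤ 1 / 2 := by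
      apply one_div_le_one_div_of_le <;> linarith
    linarith
  have hκ1 : ∀ m : Fin M, 1 ≤ (1 - 1 / (2 * M) : ℝ)⁻¹ := by
    intro m
    rw [one_le_inv₀ (hκ m)]
    have : (0 : ℝ) ≤ 1 / (2 * (M : ℝ)) := by positivity
    linarith
  have hE : ∀ m n, P (E m n) ≤ ENNReal.ofReal ((1 - 1 / (2 * M) : ℝ) ^ y * 2 ^ (l + 1)) := by
    intro m n
    have hκ := hκ m
    have hκ1 := hκ1 m
    have h1 := hs.ville (hs.isSuper_selWeight hML hLN σ m n) a T
    have h2 : ∫⁻ ω, selWeight M (selections hML hLN σ m n N (outcomes X W ω))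
        ((stateOf hML hLN σ N (outcomes X W ω) m).cnt n) ∂P ≤ 1 := by
      calc _ ≤ ∫⁻ _ω, (1 : ℝ≥0∞) ∂P := by
            refine lintegral_mono fun ω => ?_
            simp only [selections, Finset.Ioc_self, Finset.filter_empty, Finset.card_empty,
              selWeight, pow_zero, one_mul]
            rw [← ENNReal.ofReal_one]
            exact ENNReal.ofReal_le_ofReal (pow_le_one₀ (by norm_num) (by norm_num))
        _ = 1 := by simp
    refine le_ofReal_of_mul_le_one (by positivity) ?_ (h1.trans h2)
    rw [inv_pow, one_div_pow]
    have hne := pow_ne_zero y hκ.ne'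
    generalize (1 - 1 / (2 * (M : ℝ))) ^ y = u at hne ⊢
    field_simp
  -- For `y = 0` there need not be a last selection, but then the event is empty or the bound is at
  -- least `1`.
  rcases Nat.eq_zero_or_pos y with rfl | hy
  · rcases isEmpty_or_nonempty (Fin M × Fin N) with hempty | ⟨⟨m, n⟩⟩
    · have : {ω | ∃ m n, 0 ≤ lowCount hML hLN σ l T m n (outcomes X W ω)} = ∅ := by
        ext ω
        simp only [Set.mem_ofPred_eq, Set.mem_empty_iff_false, iff_false]
        rintro ⟨m, n, -⟩
        exact hempty.false (m, n)
      rw [this]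
      simp
    · refine prob_le_one.trans ?_
      rw [← ENNReal.ofReal_one]
      refine ENNReal.ofReal_le_ofReal ?_
      have h1 : (1 : ℝ) ≤ M := by exact_mod_cast m.pos
      have h2 : (1 : ℝ) ≤ N := by exact_mod_cast n.pos
      have h3 : (1 : ℝ) ≤ 2 ^ (l + 1) := one_le_pow₀ (by norm_num)
      rw [pow_zero, one_mul]
      calc (1 : ℝ) = 1 * 1 * 1 := by norm_num
        _ ≤ _ := by gcongr
  have hsub : {ω | ∃ m n, y ≤ lowCount hML hLN σ l T m n (outcomes X W ω)} ⊆
      ⋃ m ∈ (Finset.univ : Finset (Fin M)), ⋃ n ∈ (Finset.univ : Finset (Fin N)), E m n := by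
    rintro ω ⟨m, n, hle⟩
    simp only [Finset.mem_univ, Set.iUnion_true, Set.mem_iUnion]
    refine ⟨m, n, ?_⟩
    set S := (Finset.Ioc N T).filter fun r => decisionOf hML hLN σ r (outcomes X W ω) m = n ∧
      (stateOf hML hLN σ (r - 1) (outcomes X W ω) m).cnt n ≤ l with hS
    have hcard : y ≤ S.card := hle
    have hne : S.Nonempty := Finset.card_pos.mp (by omega)
    obtain ⟨h1, h2⟩ := Finset.mem_filter.mp (Finset.max'_mem S hne)
    set r := S.max' hne with hr
    have hr1 := Finset.mem_Ioc.mp h1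
    refine ⟨r, hr1.1.le, hr1.2, ENNReal.ofReal_le_ofReal ?_⟩
    have hcnt : (stateOf hML hLN σ r (outcomes X W ω) m).cnt n ≤ l + 1 := by
      have := (cnt_step hML hLN σ (r - 1) (outcomes X W ω) m n).2
      rw [show r - 1 + 1 = r by omega] at this
      omega
    have hsel : y ≤ selections hML hLN σ m n r (outcomes X W ω) := by
      refine hcard.trans (Finset.card_le_card fun s hs' => ?_)
      obtain ⟨h3, h4⟩ := Finset.mem_filter.mp hs'
      refine Finset.mem_filter.mpr ⟨Finset.mem_Ioc.mpr ⟨(Finset.mem_Ioc.mp h3).1,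
        Finset.le_max' S s hs'⟩, h4.1⟩
    have hκ1 := hκ1 m
    refine mul_le_mul (pow_le_pow_right₀ hκ1 hsel)
      (pow_le_pow_of_le_one (by norm_num) (by norm_num) hcnt) (by positivity) (by positivity)
  calc P {ω | ∃ m n, y ≤ lowCount hML hLN σ l T m n (outcomes X W ω)}
      ≤ ∑ m : Fin M, ∑ n : Fin N,
          ENNReal.ofReal ((1 - 1 / (2 * M) : ℝ) ^ y * 2 ^ (l + 1)) := by
        refine (measure_mono hsub).trans ?_
        refine (measure_biUnion_finset_le _ _).trans (Finset.sum_le_sum fun m _ => ?_)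
        exact (measure_biUnion_finset_le _ _).trans (Finset.sum_le_sum fun n _ => hE m n)
    _ = _ := by
        simp only [Finset.sum_const, Finset.card_univ, Fintype.card_fin, nsmul_eq_mul]
        rw [← ENNReal.ofReal_natCast, ← ENNReal.ofReal_natCast,
          ← ENNReal.ofReal_mul (by positivity), ← ENNReal.ofReal_mul (by positivity)]
        congr 1
        ring

end Events

/-! ### The choice of a channel -/

section Choice

variable {N : ℕ} {μ : Fin N → ℝ} {s : LocalState N} {t : ℕ}

theorem ucb_of_pos {n : Fin N} (h : 0 < s.cnt n) :
    ucb s t n = ((s.est n + √(2 * Real.log t / s.cnt n) : ℝ) : EReal) := by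
  rw [ucb, if_neg h.ne']

theorem lcb_of_pos {n : Fin N} (h : 0 < s.cnt n) :
    lcb s t n = ((s.est n - √(2 * Real.log t / s.cnt n) : ℝ) : EReal) := by
  rw [lcb, if_neg h.ne']

theorem lcb_le_ucb (n : Fin N) : lcb s t n ≤ ucb s t n := by
  rcases Nat.eq_zero_or_pos (s.cnt n) with h | h
  · simp [ucb, h]
  · rw [ucb_of_pos h, lcb_of_pos h, EReal.coe_le_coe_iff]
    have := Real.sqrt_nonneg (2 * Real.log t / s.cnt n)
    linarith

theorem exists_not_mem_of_card {O : Finset (Fin N)} {k n : Fin N} (hO : O.card = k + 1)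
    (hn : n ∈ O) (hkn : k < n) : ∃ j ≤ k, j ∉ O := by
  by_contra hcon
  push Not at hcon
  have hsub : insert n (Finset.Iic k) ⊆ O := by
    intro i hi
    rcases Finset.mem_insert.mp hi with rfl | hi
    · exact hn
    · exact hcon i (Finset.mem_Iic.mp hi)
  have := Finset.card_le_card hsub
  rw [Finset.card_insert_of_notMem (by simpa using hkn), Fin.card_Iic] at this
  omega

theorem exists_mem_of_card {O : Finset (Fin N)} {k : Fin N} (hO : O.card = k + 1) :
    ∃ i ∈ O, k ≤ i := by
  by_contra hcon
  push Not at hcon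
  have hsub : O ⊆ Finset.Iio k := fun i hi => Finset.mem_Iio.mpr (hcon i hi)
  have := Finset.card_le_card hsub
  rw [Fin.card_Iio] at this
  omega

/-- If all estimates are within their confidence radii, then a channel other than the desired one
is chosen only if it has been observed rarely. -/
theorem cnt_le_of_isChoice {g : ℝ} (hg : 0 < g) (hgap : ∀ i j, i < j → g ≤ μ i - μ j)
    (ht : 1 ≤ t)
    (hconf : ∀ i, 0 < s.cnt i → |s.est i - μ i| ≤ √(2 * Real.log t / s.cnt i))
    {k n : Fin N} (hch : IsChoice s t (k + 1) n) (hne : n ≠ k) :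
    (s.cnt n : ℝ) ≤ 8 * Real.log t / g ^ 2 := by
  obtain ⟨O, hcard, hO, hnO, hmin⟩ := hch
  have hlog : 0 ≤ Real.log t := Real.log_nonneg (by exact_mod_cast ht)
  rcases Nat.eq_zero_or_pos (s.cnt n) with h0 | hpos
  · rw [h0, Nat.cast_zero]; positivity
  have hu : ∀ i, ((μ i : ℝ) : EReal) ≤ ucb s t i := by
    intro i
    rcases Nat.eq_zero_or_pos (s.cnt i) with h | h
    · simp [ucb, h]
    · rw [ucb_of_pos h, EReal.coe_le_coe_iff]
      have := abs_le.mp (hconf i h)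
      linarith
  have hl : ∀ i, lcb s t i ≤ ((μ i : ℝ) : EReal) := by
    intro i
    rcases Nat.eq_zero_or_pos (s.cnt i) with h | h
    · simp [lcb, h]
    · rw [lcb_of_pos h, EReal.coe_le_coe_iff]
      have := abs_le.mp (hconf i h)
      linarith
  have hanti : ∀ i j, i ≤ j → μ j ≤ μ i := by
    intro i j hij
    rcases eq_or_lt_of_le hij with rfl | h
    · exact le_rfl
    · have := hgap i j h; linarith
  have hn := abs_le.mp (hconf n hpos)
  have hcr : (0 : ℝ) < s.cnt n := by exact_mod_cast hpos
  -- If `n` precedes `k`, then `O` also contains some `i ≥ k`, whose lower index is not smaller than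
  -- that of `n`. If `n` follows `k`, it has displaced some `j ≤ k` from `O` and has an upper index
  -- at least as large. Either way twice the radius of `n` spans a gap between means.
  have key : g ≤ 2 * √(2 * Real.log t / s.cnt n) := by
    rcases lt_or_gt_of_ne hne with h | h
    · obtain ⟨i, hi, hki⟩ := exists_mem_of_card hcard
      have h1 := (hmin i hi).trans (hl i)
      rw [lcb_of_pos hpos, EReal.coe_le_coe_iff] at h1
      have h2 := hgap n k h
      have h3 := hanti k i hki
      linarith
    · obtain ⟨j, hj, hjO⟩ := exists_not_mem_of_card hcard hnO h
      have h1 := (hu j).trans (hO n hnO j hjO)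
      rw [ucb_of_pos hpos, EReal.coe_le_coe_iff] at h1
      have h2 := hgap k n h
      have h3 := hanti j k hj
      linarith
  have hsq : g ^ 2 ≤ 4 * (2 * Real.log t / s.cnt n) := by
    have h1 : √(2 * Real.log t / s.cnt n) ^ 2 = 2 * Real.log t / s.cnt n :=
      Real.sq_sqrt (by positivity)
    nlinarith [Real.sqrt_nonneg (2 * Real.log t / s.cnt n)]
  rw [le_div_iff₀ (by positivity)]
  have : 4 * (2 * Real.log t / s.cnt n) = 8 * Real.log t / s.cnt n := by ring
  rw [this, le_div_iff₀ hcr] at hsq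
  linarith

/-- A channel that is chosen is not dominated by a channel with a larger upper index and a smaller
lower index. -/
theorem not_dominated_of_isChoice {k : ℕ} {j n : Fin N} (hch : IsChoice s t k j)
    (hu : ucb s t j < ucb s t n) : lcb s t j ≤ lcb s t n := by
  obtain ⟨O, -, hO, hjO, hmin⟩ := hch
  by_cases hn : n ∈ O
  · exact hmin n hn
  · exact absurd (hO j hjO n hn) (not_le.mpr hu)

/-- The choice if the `M` best channels are known up to `η` and the upper indices of all other
channels are below the index of the channel with label `M - 1`. -/
theorem isChoice_of_close {M : ℕ} {g η : ℝ} (hη : 0 < η) (hηg : 16 * η ≤ g)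
    (hgap : ∀ i j, i < j → g ≤ μ i - μ j) {p : Fin N} (hp : (p : ℕ) + 2 = M)
    (htop : ∀ i : Fin N, (i : ℕ) < M → 0 < s.cnt i ∧ √(2 * Real.log t / s.cnt i) ≤ η ∧
      |s.est i - μ i| ≤ √(2 * Real.log t / s.cnt i))
    (hrest : ∀ n : Fin N, M ≤ (n : ℕ) → ucb s t n < ((μ p - 2 * η : ℝ) : EReal))
    {k n : Fin N} (hkM : (k : ℕ) < M) (hch : IsChoice s t (k + 1) n) :
    ((k : ℕ) + 1 < M → n = k) ∧ ((k : ℕ) + 1 = M → M ≤ (n : ℕ) + 1 ∧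
      ∀ n' : Fin N, M ≤ (n' : ℕ) + 1 → n' ≠ n → ucb s t n' ≤ ucb s t n) := by
  obtain ⟨O, hcard, hO, hnO, hmin⟩ := hch
  have hanti : ∀ i j, i ≤ j → μ j ≤ μ i := by
    intro i j hij
    rcases eq_or_lt_of_le hij with rfl | h
    · exact le_rfl
    · have := hgap i j h; linarith
  have hu1 : ∀ i : Fin N, (i : ℕ) < M → ((μ i : ℝ) : EReal) ≤ ucb s t i := by
    intro i hi
    obtain ⟨h1, h2, h3⟩ := htop i hi
    rw [ucb_of_pos h1, EReal.coe_le_coe_iff]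
    have := abs_le.mp h3
    linarith
  have hu2 : ∀ i : Fin N, (i : ℕ) < M → ucb s t i ≤ ((μ i + 2 * η : ℝ) : EReal) := by
    intro i hi
    obtain ⟨h1, h2, h3⟩ := htop i hi
    rw [ucb_of_pos h1, EReal.coe_le_coe_iff]
    have := abs_le.mp h3
    linarith
  have hl1 : ∀ i : Fin N, (i : ℕ) < M → ((μ i - 2 * η : ℝ) : EReal) ≤ lcb s t i := by
    intro i hi
    obtain ⟨h1, h2, h3⟩ := htop i hi
    rw [lcb_of_pos h1, EReal.coe_le_coe_iff]
    have := abs_le.mp h3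
    linarith
  have hl2 : ∀ i : Fin N, (i : ℕ) < M → lcb s t i ≤ ((μ i : ℝ) : EReal) := by
    intro i hi
    obtain ⟨h1, h2, h3⟩ := htop i hi
    rw [lcb_of_pos h1, EReal.coe_le_coe_iff]
    have := abs_le.mp h3
    linarith
  have hlast : ∀ i : Fin N, M ≤ (i : ℕ) + 1 → ucb s t i < ((μ p - 2 * η : ℝ) : EReal) := by
    intro i hi
    rcases Nat.lt_or_ge (i : ℕ) M with h | h
    · refine (hu2 i h).trans_lt ?_
      rw [EReal.coe_lt_coe_iff]
      have := hgap p i (by rw [Fin.lt_def]; omega)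
      linarith
    · exact hrest i h
  constructor
  · intro hk
    -- The upper indices rank the best channels correctly, so `O` consists of exactly the first `k +
    -- 1` channels, and the lower indices single out the last one.
    have hsub : ∀ i ∈ O, i ≤ k := by
      intro i hi
      by_contra hcon
      rw [not_le] at hcon
      obtain ⟨j, hj, hjO⟩ := exists_not_mem_of_card hcard hi hcon
      have h1 := (hu1 j (lt_of_le_of_lt (Fin.le_def.mp hj) hkM)).trans (hO i hi j hjO)
      have h2 := hanti j k hj
      rcases Nat.lt_or_ge (i : ℕ) M with h | h
      · have h3 := h1.trans (hu2 i h)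
        rw [EReal.coe_le_coe_iff] at h3
        have := hgap k i hcon
        linarith
      · have h3 := h1.trans_lt (hrest i h)
        rw [EReal.coe_lt_coe_iff] at h3
        have := hanti k p (by rw [Fin.le_def]; omega)
        linarith
    have hOeq : O = Finset.Iic k := by
      refine Finset.eq_of_subset_of_card_le (fun i hi => Finset.mem_Iic.mpr (hsub i hi)) ?_
      rw [Fin.card_Iic, hcard]
    by_contra hne
    have hlt : n < k := lt_of_le_of_ne (hsub n hnO) hne
    have h1 := (hl1 n (lt_trans (Fin.lt_def.mp hlt) hkM)).trans
      ((hmin k (by rw [hOeq]; simp)).trans (hl2 k hkM))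
    rw [EReal.coe_le_coe_iff] at h1
    have := hgap n k hlt
    linarith
  · intro hk
    -- Now `O` has `M` elements: the `M - 1` best channels and one more. The latter owes its place
    -- to its upper index, and even this index is below the lower indices of the others, so it is
    -- the choice.
    have hall : ∀ j : Fin N, j ≤ p → j ∈ O := by
      intro j hj
      by_contra hjO
      obtain ⟨i, hi, hki⟩ := exists_mem_of_card hcard
      have h1 := (hu1 j (by have := Fin.le_def.mp hj; omega)).trans (hO i hi j hjO)
      have h2 := h1.trans_lt (hlast i (by have := Fin.le_def.mp hki; omega))
      rw [EReal.coe_lt_coe_iff] at h2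
      have := hanti j p hj
      linarith
    obtain ⟨i, hi, hki⟩ := exists_mem_of_card hcard
    have hnk : M ≤ (n : ℕ) + 1 := by
      by_contra hcon
      have hnp : n ≤ p := by rw [Fin.le_def]; omega
      have h1 := (hl1 n (by omega)).trans ((hmin i hi).trans (lcb_le_ucb i))
      have h2 := h1.trans_lt (hlast i (by have := Fin.le_def.mp hki; omega))
      rw [EReal.coe_lt_coe_iff] at h2
      have := hanti n p hnp
      linarith
    refine ⟨hnk, fun n' hn' hne => ?_⟩
    refine hO n hnO n' fun hn'O => ?_
    have hsub : insert n' (insert n (Finset.Iic p)) ⊆ O := by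
      intro i hi
      simp only [Finset.mem_insert, Finset.mem_Iic] at hi
      rcases hi with rfl | rfl | hi
      · exact hn'O
      · exact hnO
      · exact hall i hi
    have h1 : n ∉ Finset.Iic p := by
      rw [Finset.mem_Iic, Fin.le_def]; omega
    have h2 : n' ∉ insert n (Finset.Iic p) := by
      simp only [Finset.mem_insert, Finset.mem_Iic, Fin.le_def, not_or]
      exact ⟨hne, by omega⟩
    have := Finset.card_le_card hsub
    rw [Finset.card_insert_of_notMem h2, Finset.card_insert_of_notMem h1, Fin.card_Iic] at this
    omega

end Choice

/-! ### Rotation -/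

/-- Among `M` consecutive slots exactly one is the turn of the source on a given channel. -/
theorem le_card_filter_rot {M : ℕ} (m : Fin M) {i : ℕ} (hi : i < M) (a b : ℕ) :
    (b - a) / M ≤ ((Finset.Ioc a b).filter fun r => rot M m r = i).card := by
  have hM := m.pos
  -- `e` is the offset, from slot `a + 1`, of the first turn on `i`.
  obtain ⟨e, heM, he⟩ : ∃ e < M, ((m : ℕ) + 1 + (a + 1) + e) % M = i := by
    refine ⟨(i + (M - ((m : ℕ) + 1 + (a + 1)) % M)) % M, Nat.mod_lt _ hM, ?_⟩
    set x := (m : ℕ) + 1 + (a + 1)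
    have hx := Nat.mod_lt x hM
    rw [Nat.add_mod, Nat.mod_mod, ← Nat.add_mod_mod, Nat.mod_mod, ← Nat.add_mod,
      Nat.add_mod x]
    have : (x % M + (i + (M - x % M)) % M) % M = (i + M) % M := by
      rw [Nat.add_mod_mod]
      congr 1
      omega
    simp only [Nat.add_mod_mod, Nat.mod_add_mod] at this ⊢
    rw [this, Nat.add_mod_right, Nat.mod_eq_of_lt hi]
  calc (b - a) / M = (Finset.range ((b - a) / M)).card := by simp
    _ ≤ _ := by
      refine Finset.card_le_card_of_injOn (fun j => a + 1 + e + j * M) ?_ ?_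
      · intro j hj
        have hj' : j + 1 ≤ (b - a) / M := by simpa using hj
        have h1 : (j + 1) * M ≤ b - a := by
          calc (j + 1) * M ≤ (b - a) / M * M := Nat.mul_le_mul_right _ hj'
            _ ≤ b - a := Nat.div_mul_le_self _ _
        have h2 : (j + 1) * M = j * M + M := by ring
        simp only [Finset.coe_filter, Finset.mem_Ioc, Set.mem_ofPred_eq]
        refine ⟨⟨by omega, by omega⟩, ?_⟩
        rw [rot, ← he, show (m : ℕ) + 1 + (a + 1 + e + j * M) = (m : ℕ) + 1 + (a + 1) + e + j * M by
          ring, Nat.add_mul_mod_self_right]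
      · intro j _ j' _ h
        have : j * M = j' * M := by
          have : a + 1 + e + j * M = a + 1 + e + j' * M := h
          omega
        exact Nat.eq_of_mul_eq_mul_right hM this

theorem rrChannel_injective {M N : ℕ} (hMN : M ≤ N) (t : ℕ) :
    Function.Injective fun m : Fin M => rrChannel le_rfl hMN m t := by
  intro m m' h
  have h1 : ((m : ℕ) + 1 + t) % M = ((m' : ℕ) + 1 + t) % M := by
    simpa only [rrChannel, rot, Fin.mk.injEq] using h
  have h2 : (m : ℕ) ≡ m' [MOD M] := by
    have : (m : ℕ) + (1 + t) ≡ m' + (1 + t) [MOD M] := by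
      rw [← add_assoc, ← add_assoc]; exact h1
    exact Nat.ModEq.add_right_cancel' _ this
  exact Fin.ext (Nat.ModEq.eq_of_lt_of_lt h2 (Fin.isLt _) (Fin.isLt _))

/-! ### The course of DLF on a typical configuration -/

section Path

variable {M N L : ℕ} (hML : M ≤ L) (hLN : L ≤ N) (hMN : M ≤ N)
  (σ : Fin M → ℕ → LocalState N → Fin N)

/-- In slot `s` some source does not follow the round robin. -/
def IsBad (s : ℕ) (z : Config M N) : Prop :=
  decisionOf hML hLN σ s z ≠ fun m => rrChannel le_rfl hMN m s

open Classical in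
/-- The number of slots among `N + 1, …, T` in which DLF differs from the round robin. -/
noncomputable def badCount (T : ℕ) (z : Config M N) : ℕ :=
  ((Finset.Ioc N T).filter fun s => IsBad hML hLN hMN σ s z).card

theorem badCount_mono {T T' : ℕ} (h : T ≤ T') (z : Config M N) :
    badCount hML hLN hMN σ T z ≤ badCount hML hLN hMN σ T' z := by
  classical
  exact Finset.card_le_card (Finset.filter_subset_filter _ (Finset.Ioc_subset_Ioc_right h))

variable {hML hLN hMN σ} {μ : Fin N → ℝ} {g : ℝ} {z : Config M N}

theorem decisionOf_of_lt {s : ℕ} (hs : N < s) (m : Fin M) :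
    decisionOf hML hLN σ s z m = σ m s (stateOf hML hLN σ (s - 1) z m) := by
  obtain ⟨t, rfl⟩ : ∃ t, s = t + 1 := ⟨s - 1, by omega⟩
  rw [decisionOf_succ, dlfSelect, if_neg (by omega)]
  simp

theorem isChoice_decisionOf (hσ : IsRule σ) {s : ℕ} (hs : N < s) (m : Fin M) :
    IsChoice (stateOf hML hLN σ (s - 1) z m) s ((rrChannel le_rfl hMN m s : ℕ) + 1)
      (decisionOf hML hLN σ s z m) := by
  rw [decisionOf_of_lt hs]
  exact hσ m s _ hs

theorem conf_of_not_confFail {s : ℕ} (h : ¬ ConfFail hML hLN σ μ s z) (m : Fin M) (n : Fin N)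
    (hc : 0 < (stateOf hML hLN σ (s - 1) z m).cnt n) :
    |(stateOf hML hLN σ (s - 1) z m).est n - μ n|
      ≤ √(2 * Real.log s / (stateOf hML hLN σ (s - 1) z m).cnt n) := by
  by_contra hcon
  exact h ⟨m, n, hc, not_le.mp hcon⟩

theorem IsBad.exists_low (hσ : IsRule σ) (hg : 0 < g) (hgap : ∀ i j, i < j → g ≤ μ i - μ j)
    {s l : ℕ} (hs : N < s) (hl : 8 * Real.log s / g ^ 2 ≤ l)
    (hconf : ¬ ConfFail hML hLN σ μ s z) (hbad : IsBad hML hLN hMN σ s z) :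
    ∃ m n, decisionOf hML hLN σ s z m = n ∧ (stateOf hML hLN σ (s - 1) z m).cnt n ≤ l := by
  obtain ⟨m, hm⟩ := Function.ne_iff.mp hbad
  refine ⟨m, _, rfl, ?_⟩
  have := cnt_le_of_isChoice hg hgap (by omega) (conf_of_not_confFail hconf m)
    (isChoice_decisionOf (hMN := hMN) hσ hs m) hm
  exact_mod_cast this.trans hl

-- A deviating slot has a failing confidence interval or contains a selection of some channel by
-- some source at low count.
open Classical in
theorem badCount_le (hσ : IsRule σ) (hg : 0 < g) (hgap : ∀ i j, i < j → g ≤ μ i - μ j)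
    {T l y : ℕ} (hl : 8 * Real.log T / g ^ 2 ≤ l)
    (hlow : ∀ m n, lowCount hML hLN σ l T m n z ≤ y) :
    badCount hML hLN hMN σ T z
      ≤ ((Finset.Ioc N T).filter fun s => ConfFail hML hLN σ μ s z).card + M * N * y := by
  have hsub : ((Finset.Ioc N T).filter fun s => IsBad hML hLN hMN σ s z) ⊆
      ((Finset.Ioc N T).filter fun s => ConfFail hML hLN σ μ s z) ∪
        (Finset.univ : Finset (Fin M × Fin N)).biUnion fun q =>
        (Finset.Ioc N T).filter fun r => decisionOf hML hLN σ r z q.1 = q.2 ∧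
          (stateOf hML hLN σ (r - 1) z q.1).cnt q.2 ≤ l := by
    intro s hs
    obtain ⟨hs1, hbad⟩ := Finset.mem_filter.mp hs
    have hs2 := Finset.mem_Ioc.mp hs1
    rw [Finset.mem_union]
    by_cases h : ConfFail hML hLN σ μ s z
    · exact Or.inl (Finset.mem_filter.mpr ⟨hs1, h⟩)
    · right
      have hl' : 8 * Real.log s / g ^ 2 ≤ l := by
        refine le_trans ?_ hl
        have h0 : (0 : ℝ) < s := by exact_mod_cast (by omega : 0 < s)
        have : Real.log s ≤ Real.log T := Real.log_le_log h0 (by exact_mod_cast hs2.2)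
        gcongr
      obtain ⟨m, n, h1, h2⟩ := hbad.exists_low hσ hg hgap hs2.1 hl' h
      rw [Finset.mem_biUnion]
      exact ⟨(m, n), Finset.mem_univ _, Finset.mem_filter.mpr ⟨hs1, h1, h2⟩⟩
  calc badCount hML hLN hMN σ T z ≤ _ := Finset.card_le_card hsub
    _ ≤ _ := Finset.card_union_le _ _
    _ ≤ ((Finset.Ioc N T).filter fun s => ConfFail hML hLN σ μ s z).card
        + ∑ q : Fin M × Fin N, y := by
        gcongr
        exact (Finset.card_biUnion_le).trans (Finset.sum_le_sum fun q _ => hlow q.1 q.2)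
    _ = _ := by simp

variable (hML hLN hMN σ) in
/-- The properties of a typical configuration up to slot `T`. -/
structure GoodPath (μ : Fin N → ℝ) (K τ η : ℝ) (b T : ℕ) (z : Config M N) : Prop where
  conf : ∀ s, b ≤ s → s ≤ T → ¬ ConfFail hML hLN σ μ s z
  bad : ∀ s, b ≤ s → s ≤ T → (badCount hML hLN hMN σ s z : ℝ) ≤ K * Real.log s
  est : ¬ EstFail hML hLN σ μ τ η T z
  win : ∀ t n m, winners z t n {m} = m

theorem acquires_of_alone {w : Fin N → Finset (Fin M) → Fin M} {a : Fin M → Fin N} {m : Fin M}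
    (hw : ∀ n m, w n {m} = m) (h : ∀ i, a i = a m → i = m) : Acquires w a m := by
  have : (Finset.univ.filter fun i => a i = a m) = {m} := by
    ext i
    simp only [Finset.mem_filter, Finset.mem_univ, true_and, Finset.mem_singleton]
    exact ⟨h i, fun hi => by rw [hi]⟩
  rw [Acquires, this, hw]

/-- In a slot in which all sources follow the round robin, all of them acquire their channels. -/
theorem cnt_succ_of_not_isBad (hwin : ∀ t n m, winners z t n {m} = m) {t : ℕ} (ht : N ≤ t)
    (h : ¬ IsBad hML hLN hMN σ (t + 1) z) (m : Fin M) :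
    (stateOf hML hLN σ (t + 1) z m).cnt (rrChannel le_rfl hMN m (t + 1))
      = (stateOf hML hLN σ t z m).cnt (rrChannel le_rfl hMN m (t + 1)) + 1 := by
  rw [IsBad, not_not, decisionOf_succ] at h
  rw [stateOf_succ, dlfStep_of_acquires hML hLN σ (by omega)]
  · simp [h]
  · rw [h]
    exact acquires_of_alone (hwin _) fun i hi => rrChannel_injective hMN (t + 1) hi

/-- In a slot without deviation there are no collisions and every turn yields an observation; the
missing observations are charged to deviating slots. -/
theorem card_sub_badCount_le_cnt (hwin : ∀ t n m, winners z t n {m} = m) (m : Fin M) (i : Fin N)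
    {t : ℕ} (ht : N ≤ t) :
    ((Finset.Ioc N t).filter fun r => rot M m r = i).card
      ≤ (stateOf hML hLN σ t z m).cnt i + badCount hML hLN hMN σ t z := by
  classical
  induction t, ht using Nat.le_induction with
  | base => simp
  | succ t ht ih =>
    have hI : Finset.Ioc N (t + 1) = insert (t + 1) (Finset.Ioc N t) := by
      ext r; simp only [Finset.mem_Ioc, Finset.mem_insert]; omega
    have hmono := (cnt_step hML hLN σ t z m i).1
    by_cases hb : IsBad hML hLN hMN σ (t + 1) z
    · have h1 : badCount hML hLN hMN σ (t + 1) z = badCount hML hLN hMN σ t z + 1 := by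
        rw [badCount, badCount, hI, Finset.filter_insert, if_pos hb,
          Finset.card_insert_of_notMem (by simp)]
      have h2 : ((Finset.Ioc N (t + 1)).filter fun r => rot M m r = i).card
          ≤ ((Finset.Ioc N t).filter fun r => rot M m r = i).card + 1 := by
        rw [hI, Finset.filter_insert]
        split_ifs
        · exact Finset.card_insert_le _ _
        · omega
      omega
    · have h1 : badCount hML hLN hMN σ t z ≤ badCount hML hLN hMN σ (t + 1) z :=
        badCount_mono hML hLN hMN σ (by omega) z
      rw [hI, Finset.filter_insert]
      split_ifs with hr
      · have hc := cnt_succ_of_not_isBad hwin ht hb m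
        have : rrChannel le_rfl hMN m (t + 1) = i := Fin.ext hr
        rw [this] at hc
        rw [Finset.card_insert_of_notMem (by simp)]
        omega
      · omega

/-- There is a slot in the second half of `1, …, s` in which source `m` takes its turn on channel
`i` and all sources follow the round robin. -/
theorem exists_not_isBad (m : Fin M) {i s : ℕ} (hi : i < M) (hsN : N ≤ s / 2)
    (h : badCount hML hLN hMN σ s z < (s - s / 2) / M) :
    ∃ r, s / 2 < r ∧ r ≤ s ∧ rot M m r = i ∧ ¬ IsBad hML hLN hMN σ r z := by
  classical
  by_contra hcon
  push Not at hcon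
  have h1 := le_card_filter_rot m hi (s / 2) s
  have h2 : ((Finset.Ioc (s / 2) s).filter fun r => rot M m r = i).card
      ≤ badCount hML hLN hMN σ s z := by
    refine Finset.card_le_card fun r hr => ?_
    obtain ⟨hr1, hr2⟩ := Finset.mem_filter.mp hr
    rw [Finset.mem_Ioc] at hr1
    exact Finset.mem_filter.mpr ⟨Finset.mem_Ioc.mpr ⟨by omega, hr1.2⟩,
      hcon r hr1.1 hr1.2 hr2⟩
  omega

theorem eventually_log_add_le (D E : ℝ) (hM : 0 < M) :
    ∀ᶠ s : ℕ in Filter.atTop, D * Real.log s + E ≤ s / (4 * M) := by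
  have hMr : (0 : ℝ) < M := by exact_mod_cast hM
  have hlim : Filter.Tendsto (fun x : ℝ => (D * Real.log x + E) / x) Filter.atTop (nhds 0) := by
    have h1 : Filter.Tendsto (fun x : ℝ => Real.log x / x) Filter.atTop (nhds 0) := by
      simpa using Real.isLittleO_log_id_atTop.tendsto_div_nhds_zero
    have h2 : Filter.Tendsto (fun x : ℝ => E / x) Filter.atTop (nhds 0) :=
      tendsto_const_nhds.div_atTop Filter.tendsto_id
    have := (h1.const_mul D).add h2
    simp only [mul_zero, add_zero] at this
    refine this.congr fun x => ?_
    ring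
  have hc : (0 : ℝ) < 1 / (4 * M) := by positivity
  have := (hlim.comp tendsto_natCast_atTop_atTop).eventually (gt_mem_nhds hc)
  filter_upwards [this, Filter.eventually_gt_atTop 0] with s hs hs0
  have hs0' : (0 : ℝ) < s := by exact_mod_cast hs0
  simp only [Function.comp_apply] at hs
  rw [div_lt_iff₀ hs0'] at hs
  have : (s : ℝ) / (4 * M) = 1 / (4 * M) * s := by ring
  rw [this]
  exact hs.le

theorem eventually_half_log (η : ℝ) (hη : 0 < η) (hη1 : η < 1) :
    ∀ᶠ s : ℕ in Filter.atTop, (1 - η) ^ 2 * Real.log s ≤ Real.log ((s : ℝ) / 2) := by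
  have h : Filter.Tendsto (fun s : ℕ => Real.log s) Filter.atTop Filter.atTop :=
    Real.tendsto_log_atTop.comp tendsto_natCast_atTop_atTop
  filter_upwards [h.eventually_ge_atTop (Real.log 2 / (1 - (1 - η) ^ 2)),
    Filter.eventually_gt_atTop 0] with s hs hs0
  have hs0' : (s : ℝ) ≠ 0 := by exact_mod_cast hs0.ne'
  have hpos : 0 < 1 - (1 - η) ^ 2 := by nlinarith
  rw [Real.log_div hs0' (by norm_num)]
  rw [div_le_iff₀ hpos] at hs
  linarith

/-! ### Late slots of a typical configuration -/

section Late

variable {K τ η : ℝ} {b T s : ℕ}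

/-- Each of the `M` best channels is observed at about `s / M` slots, up to `K * log s` deviating
ones; `hlate` makes this exceed the `2 * log s / η ^ 2` observations that bring the radius down to
`η`. -/
theorem GoodPath.top_close (hG : GoodPath hML hLN hMN σ μ K τ η b T z) (hη : 0 < η)
    (hsN : N < s) (hbs : b ≤ s) (hsT : s ≤ T)
    (hlate : (K + 2 / η ^ 2) * Real.log s + (N + 4) ≤ s / (4 * M)) (m : Fin M) {i : Fin N}
    (hi : (i : ℕ) < M) :
    0 < (stateOf hML hLN σ (s - 1) z m).cnt i ∧
      √(2 * Real.log s / (stateOf hML hLN σ (s - 1) z m).cnt i) ≤ η ∧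
      |(stateOf hML hLN σ (s - 1) z m).est i - μ i|
        ≤ √(2 * Real.log s / (stateOf hML hLN σ (s - 1) z m).cnt i) := by
  have hM : 0 < M := m.pos
  have hMr : (1 : ℝ) ≤ M := by exact_mod_cast hM
  have hs1 : (1 : ℝ) ≤ s := by exact_mod_cast (by omega : 1 ≤ s)
  have hlog : 0 ≤ Real.log s := Real.log_nonneg hs1
  have h1 := le_card_filter_rot m hi N (s - 1)
  have h2 := card_sub_badCount_le_cnt (hML := hML) (hLN := hLN) (hMN := hMN) (σ := σ) hG.win m i
    (show N ≤ s - 1 by omega)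
  have h3 : badCount hML hLN hMN σ (s - 1) z ≤ badCount hML hLN hMN σ s z :=
    badCount_mono hML hLN hMN σ (by omega) z
  have h4 := hG.bad s hbs hsT
  set c := (stateOf hML hLN σ (s - 1) z m).cnt i
  set d := (s - 1 - N) / M with hd
  have h5 : d ≤ c + badCount hML hLN hMN σ s z := by omega
  have h6 : s ≤ M * d + M + 1 + N := by
    have e1 := Nat.div_add_mod (s - 1 - N) M
    have e2 := Nat.mod_lt (s - 1 - N) hM
    rw [← hd] at e1
    omega
  have h5r : (d : ℝ) ≤ c + badCount hML hLN hMN σ s z := by exact_mod_cast h5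
  have h6r : (s : ℝ) ≤ M * d + M + 1 + N := by exact_mod_cast h6
  have h7 : (s : ℝ) / (4 * M) ≤ d + 2 + N := by
    rw [div_le_iff₀ (by positivity)]
    have : (N : ℝ) ≤ N * M := le_mul_of_one_le_right (by positivity) hMr
    have hd0 : (0 : ℝ) ≤ d * M := by positivity
    nlinarith
  have h8 : 2 / η ^ 2 * Real.log s + 1 ≤ c := by nlinarith
  have h9 : 0 ≤ 2 / η ^ 2 * Real.log s := by positivity
  have hcr : (0 : ℝ) < c := by linarith
  have hc : 0 < c := by exact_mod_cast hcr
  refine ⟨hc, ?_, conf_of_not_confFail (hG.conf s hbs hsT) m i hc⟩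
  rw [Real.sqrt_le_left hη.le, div_le_iff₀ hcr]
  have : 2 * Real.log s = η ^ 2 * (2 / η ^ 2 * Real.log s) := by field_simp
  rw [this]
  gcongr
  linarith

/-- In the second half of `1, …, s` there is a slot in which no channel dominates the worst one of
the `M` best channels. -/
theorem GoodPath.exists_last_turn (hG : GoodPath hML hLN hMN σ μ K τ η b T z) (hσ : IsRule σ)
    (hη : 0 < η) (hK : 0 ≤ K) {p' : Fin N} (hp' : (p' : ℕ) + 1 = M) (hs2 : 1 ≤ s) (hbs : b ≤ s)
    (hsT : s ≤ T)
    (hlate : ∀ r, s / 2 < r → b ≤ r ∧ (K + 2 / η ^ 2) * Real.log r + (N + 4) ≤ r / (4 * M))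
    (m : Fin M) :
    ∃ r, s / 2 < r ∧ r ≤ s ∧ N < r ∧ ∀ n : Fin N,
      ucb (stateOf hML hLN σ (r - 1) z m) r n ≤ ((μ p' + 2 * η : ℝ) : EReal) ∨
      ((μ p' - 2 * η : ℝ) : EReal) ≤ lcb (stateOf hML hLN σ (r - 1) z m) r n := by
  have hM : 0 < M := m.pos
  have hMr : (1 : ℝ) ≤ M := by exact_mod_cast hM
  have hs1 : (1 : ℝ) ≤ s := by exact_mod_cast hs2
  have hlog : 0 ≤ Real.log s := Real.log_nonneg hs1
  have hl := (hlate s (by omega)).2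
  have hKs : K * Real.log s + (N + 4) ≤ s / (4 * M) := by
    have : 0 ≤ 2 / η ^ 2 * Real.log s := by positivity
    linarith
  have hKl : 0 ≤ K * Real.log s := by positivity
  have h4 := hG.bad s hbs hsT
  rw [le_div_iff₀ (by positivity)] at hKs
  have hNs : N ≤ s / 2 := by
    have : (2 * N : ℝ) ≤ s := by nlinarith [(Nat.cast_nonneg N : (0 : ℝ) ≤ N)]
    have : 2 * N ≤ s := by exact_mod_cast this
    omega
  have hbad : badCount hML hLN hMN σ s z < (s - s / 2) / M := by
    set d := (s - s / 2) / M with hd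
    have h6 : s ≤ 2 * (M * d + M) := by
      have e1 := Nat.div_add_mod (s - s / 2) M
      have e2 := Nat.mod_lt (s - s / 2) hM
      rw [← hd] at e1
      omega
    have h6r : (s : ℝ) ≤ 2 * (M * d + M) := by exact_mod_cast h6
    have : (badCount hML hLN hMN σ s z : ℝ) < d := by
      have : (K * Real.log s) * (4 * M) < d * (4 * M) := by
        nlinarith [(Nat.cast_nonneg N : (0 : ℝ) ≤ N), (Nat.cast_nonneg d : (0 : ℝ) ≤ d)]
      have := lt_of_mul_lt_mul_right this (by positivity)
      linarith
    exact_mod_cast this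
  obtain ⟨r, hr1, hr2, hr3, hr4⟩ := exists_not_isBad m (show (p' : ℕ) < M by omega) hNs hbad
  have hrN : N < r := by omega
  refine ⟨r, hr1, hr2, hrN, fun n => ?_⟩
  obtain ⟨hc, hrad, hest⟩ := hG.top_close hη hrN (hlate r hr1).1 (hr2.trans hsT) (hlate r hr1).2 m
    (show (p' : ℕ) < M by omega)
  have hest' := abs_le.mp hest
  have hdec : decisionOf hML hLN σ r z m = p' := by
    rw [IsBad, not_not] at hr4
    rw [hr4]
    exact Fin.ext hr3
  have hch := isChoice_decisionOf (hML := hML) (hLN := hLN) (hMN := hMN) (z := z) hσ hrN m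
  rw [hdec] at hch
  rcases le_or_gt (ucb (stateOf hML hLN σ (r - 1) z m) r n)
    (ucb (stateOf hML hLN σ (r - 1) z m) r p') with h | h
  · left
    refine h.trans ?_
    rw [ucb_of_pos hc, EReal.coe_le_coe_iff]
    linarith
  · right
    refine le_trans ?_ (not_dominated_of_isChoice hch h)
    rw [lcb_of_pos hc, EReal.coe_le_coe_iff]
    linarith

/-- A channel with fewer than `τ` observations would have radius at least `3` (whence the `9`) in
the slot `r` of `exists_last_turn`. Its confidence interval would then exceed `[0, 1]` on both sides
by more than `2 * η`, and it would dominate `p'`. -/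
theorem GoodPath.le_cnt (hG : GoodPath hML hLN hMN σ μ K τ η b T z) (hσ : IsRule σ)
    (hμ0 : ∀ n, 0 ≤ μ n) (hμ1 : ∀ n, μ n ≤ 1) (hη : 0 < η) (hη1 : 16 * η ≤ 1) (hK : 0 ≤ K)
    {p' : Fin N} (hp' : (p' : ℕ) + 1 = M) (hs2 : 2 ≤ s) (hbs : b ≤ s) (hsT : s ≤ T)
    (hlate : ∀ r, s / 2 < r → b ≤ r ∧ (K + 2 / η ^ 2) * Real.log r + (N + 4) ≤ r / (4 * M))
    (hτ : 9 * τ ≤ 2 * Real.log ((s : ℝ) / 2)) (m : Fin M) (n : Fin N) :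
    τ ≤ (stateOf hML hLN σ (s - 1) z m).cnt n := by
  by_contra! hlt
  obtain ⟨r, hr1, hr2, hrN, hr⟩ := hG.exists_last_turn hσ hη hK hp' (by omega) hbs hsT hlate m
  have hle : (stateOf hML hLN σ (r - 1) z m).cnt n ≤ (stateOf hML hLN σ (s - 1) z m).cnt n :=
    cnt_mono hML hLN σ (by omega) z m n
  have hb := est_bounds hML hLN σ (r - 1) z m n
  have h1 := hμ1 p'
  have h0 := hμ0 p'
  rcases Nat.eq_zero_or_pos ((stateOf hML hLN σ (r - 1) z m).cnt n) with hc | hc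
  · rcases hr n with h | h
    · rw [ucb, if_pos hc] at h
      exact absurd h (not_le.mpr (EReal.coe_lt_top _))
    · rw [lcb, if_pos hc] at h
      exact absurd h (not_le.mpr (EReal.bot_lt_coe _))
  · have hcr : (0 : ℝ) < (stateOf hML hLN σ (r - 1) z m).cnt n := by exact_mod_cast hc
    have hler : ((stateOf hML hLN σ (r - 1) z m).cnt n : ℝ)
      ≤ (stateOf hML hLN σ (s - 1) z m).cnt n := by exact_mod_cast hle
    have hsr : (s : ℝ) / 2 ≤ r := by
      have : s ≤ 2 * r := by omega
      have : (s : ℝ) ≤ 2 * r := by exact_mod_cast this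
      linarith
    have hs0 : (0 : ℝ) < (s : ℝ) / 2 := by
      have : (0 : ℝ) < s := by exact_mod_cast (by omega : 0 < s)
      linarith
    have hlog : Real.log ((s : ℝ) / 2) ≤ Real.log r := Real.log_le_log hs0 hsr
    have hrad : 3 ≤ √(2 * Real.log r / (stateOf hML hLN σ (r - 1) z m).cnt n) := by
      apply Real.le_sqrt_of_sq_le
      rw [le_div_iff₀ hcr]
      linarith
    rcases hr n with h | h
    · rw [ucb_of_pos hc, EReal.coe_le_coe_iff] at h
      linarith
    · rw [lcb_of_pos hc, EReal.coe_le_coe_iff] at h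
      linarith

/-- In a slot `r` of the second half, `n` did not dominate `p'`. Its lower index is too small to
exceed that of `p'`, as its mean is smaller, so its upper index was at most about `μ p'`. Until `s`
the count has not decreased and the logarithm has grown by a factor close to one, so the radius grew
by at most `1 / (1 - η)`, too little to reach `μ p`. -/
theorem GoodPath.ucb_rest_lt (hG : GoodPath hML hLN hMN σ μ K τ η b T z) (hσ : IsRule σ)
    (hμ0 : ∀ n, 0 ≤ μ n) (hμ1 : ∀ n, μ n ≤ 1) (hη : 0 < η) (hηg : 16 * η ≤ g)
    (hgap : ∀ i j, i < j → g ≤ μ i - μ j) (hK : 0 ≤ K) (hτ0 : 0 < τ)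
    {p p' : Fin N} (hp : (p : ℕ) + 2 = M) (hp' : (p' : ℕ) + 1 = M) {s₀ : ℕ} (hs₀ : 2 ≤ s₀)
    (hs : 4 * s₀ ≤ s) (hsT : s ≤ T)
    (hlate : ∀ r, s₀ ≤ r → b ≤ r ∧ (K + 2 / η ^ 2) * Real.log r + (N + 4) ≤ r / (4 * M))
    (hτ : ∀ r : ℕ, s₀ ≤ r → 9 * τ ≤ 2 * Real.log ((r : ℝ) / 2))
    (hhalf : (1 - η) ^ 2 * Real.log s ≤ Real.log ((s : ℝ) / 2)) (m : Fin M) {n : Fin N}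
    (hn : M ≤ (n : ℕ)) :
    ucb (stateOf hML hLN σ (s - 1) z m) s n < ((μ p - 2 * η : ℝ) : EReal) := by
  have hpp' := hgap p p' (by rw [Fin.lt_def]; omega)
  have hp'n := hgap p' n (by rw [Fin.lt_def]; omega)
  have h0 := hμ0 n
  have h0' := hμ0 p'
  have h1 := hμ1 p
  have hη1 : 16 * η ≤ 1 := by linarith
  by_contra! hge
  obtain ⟨r, hr1, hr2, hrN, hr⟩ := hG.exists_last_turn hσ hη hK hp' (by omega)
    (hlate s (by omega)).1 hsT (fun r hr => hlate r (by omega)) m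
  have hcs := hG.le_cnt hσ hμ0 hμ1 hη hη1 hK hp' (by omega) (hlate s (by omega)).1 hsT
    (fun r hr => hlate r (by omega)) (hτ s (by omega)) m n
  have hcr := hG.le_cnt (s := r) hσ hμ0 hμ1 hη hη1 hK hp' (by omega) (hlate r (by omega)).1
    (hr2.trans hsT) (fun r hr => hlate r (by omega)) (hτ r (by omega)) m n
  have hle : (stateOf hML hLN σ (r - 1) z m).cnt n ≤ (stateOf hML hLN σ (s - 1) z m).cnt n :=
    cnt_mono hML hLN σ (by omega) z m n
  have hest : ∀ t, N ≤ t → t ≤ T → τ ≤ (stateOf hML hLN σ t z m).cnt n →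
      |(stateOf hML hLN σ t z m).est n - μ n| ≤ η := by
    intro t ht1 ht2 h
    by_contra! hcon
    exact hG.est ⟨t, ht1, ht2, m, n, h, hcon⟩
  have hes := abs_le.mp (hest (s - 1) (by omega) (by omega) hcs)
  have her := abs_le.mp (hest (r - 1) (by omega) (by omega) hcr)
  have hcs0 : (0 : ℝ) < (stateOf hML hLN σ (s - 1) z m).cnt n := by linarith
  have hcr0 : (0 : ℝ) < (stateOf hML hLN σ (r - 1) z m).cnt n := by linarith
  have hler : ((stateOf hML hLN σ (r - 1) z m).cnt n : ℝ)
    ≤ (stateOf hML hLN σ (s - 1) z m).cnt n := by exact_mod_cast hle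
  rw [ucb_of_pos (by exact_mod_cast hcs0), EReal.coe_le_coe_iff] at hge
  have hr := hr n
  rw [ucb_of_pos (by exact_mod_cast hcr0), lcb_of_pos (by exact_mod_cast hcr0),
    EReal.coe_le_coe_iff, EReal.coe_le_coe_iff] at hr
  have hs0 : (2 : ℝ) ≤ s := by exact_mod_cast (by omega : 2 ≤ s)
  have hsr : (s : ℝ) / 2 ≤ r := by
    have : s ≤ 2 * r := by omega
    have : (s : ℝ) ≤ 2 * r := by exact_mod_cast this
    linarith
  have hlog : Real.log ((s : ℝ) / 2) ≤ Real.log r := Real.log_le_log (by linarith) hsr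
  have hlog0 : 0 ≤ Real.log s := Real.log_nonneg (by linarith)
  have hrad : (1 - η) * √(2 * Real.log s / (stateOf hML hLN σ (s - 1) z m).cnt n)
      ≤ √(2 * Real.log r / (stateOf hML hLN σ (r - 1) z m).cnt n) := by
    apply Real.le_sqrt_of_sq_le
    rw [mul_pow, Real.sq_sqrt (by positivity)]
    calc (1 - η) ^ 2 * (2 * Real.log s / (stateOf hML hLN σ (s - 1) z m).cnt n)
        = 2 * ((1 - η) ^ 2 * Real.log s) / (stateOf hML hLN σ (s - 1) z m).cnt n := by ring
      _ ≤ 2 * Real.log r / (stateOf hML hLN σ (s - 1) z m).cnt n := by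
          gcongr
          linarith
      _ ≤ _ := by
          have : 0 ≤ Real.log r := le_trans (by positivity) (hhalf.trans hlog)
          gcongr
  have hD : (1 - η) * (μ p - 3 * η - μ n)
      ≤ (1 - η) * √(2 * Real.log s / (stateOf hML hLN σ (s - 1) z m).cnt n) := by
    apply mul_le_mul_of_nonneg_left <;> linarith
  have hrad0 := Real.sqrt_nonneg (2 * Real.log r / (stateOf hML hLN σ (r - 1) z m).cnt n)
  rcases hr with hr | hr
  · nlinarith
  · linarith

/-- Different channels of which the means differ by more than `2 * η` have different upper
indices. -/
theorem GoodPath.ucb_ne (hG : GoodPath hML hLN hMN σ μ K τ η b T z) (hη : 0 < η)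
    (hηg : 16 * η ≤ g) (hgap : ∀ i j, i < j → g ≤ μ i - μ j) (hτ0 : 0 < τ) (hs2 : 2 ≤ s)
    (hsN : N < s) (hsT : s ≤ T) (m : Fin M) {n n' : Fin N} (hne : n ≠ n')
    (hc : τ ≤ (stateOf hML hLN σ (s - 1) z m).cnt n)
    (hc' : τ ≤ (stateOf hML hLN σ (s - 1) z m).cnt n') :
    ucb (stateOf hML hLN σ (s - 1) z m) s n ≠ ucb (stateOf hML hLN σ (s - 1) z m) s n' := by
  have hp : 0 < (stateOf hML hLN σ (s - 1) z m).cnt n := by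
    have : (0 : ℝ) < (stateOf hML hLN σ (s - 1) z m).cnt n := by linarith
    exact_mod_cast this
  have hp' : 0 < (stateOf hML hLN σ (s - 1) z m).cnt n' := by
    have : (0 : ℝ) < (stateOf hML hLN σ (s - 1) z m).cnt n' := by linarith
    exact_mod_cast this
  rw [ucb_of_pos hp, ucb_of_pos hp', Ne, EReal.coe_eq_coe_iff]
  -- With equal counts the radii cancel and a tie would equate estimates that are within `η` of
  -- different means; with different counts transcendence applies.
  by_cases hcc : (stateOf hML hLN σ (s - 1) z m).cnt n = (stateOf hML hLN σ (s - 1) z m).cnt n'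
  · intro h
    rw [hcc] at h
    have hest : ∀ i, τ ≤ (stateOf hML hLN σ (s - 1) z m).cnt i →
        |(stateOf hML hLN σ (s - 1) z m).est i - μ i| ≤ η := by
      intro i h
      by_contra! hcon
      exact hG.est ⟨s - 1, by omega, by omega, m, i, h, hcon⟩
    have h1 := abs_le.mp (hest n hc)
    have h2 := abs_le.mp (hest n' hc')
    rcases lt_or_gt_of_ne hne with h3 | h3
    · have := hgap _ _ h3; linarith
    · have := hgap _ _ h3; linarith
  · obtain ⟨-, -, k, hk⟩ := est_bounds hML hLN σ (s - 1) z m n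
    obtain ⟨-, -, k', hk'⟩ := est_bounds hML hLN σ (s - 1) z m n'
    exact index_ne_of_count_ne hs2 hp hp' hcc hk hk'

end Late

variable (hML hLN hMN σ) in
/-- In slot `s` a source leaves the round robin only if its turn is on the worst of the `M` best
channels, and then it takes the channel of largest upper index among this channel and the `N - M`
other ones. -/
def IsRegular (s : ℕ) (z : Config M N) : Prop :=
  ∀ m : Fin M,
    (rot M m s + 1 < M → decisionOf hML hLN σ s z m = rrChannel le_rfl hMN m s) ∧
    (rot M m s + 1 = M → M ≤ (decisionOf hML hLN σ s z m : ℕ) + 1 ∧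
      ∀ n' : Fin N, M ≤ (n' : ℕ) + 1 → n' ≠ decisionOf hML hLN σ s z m →
        ucb (stateOf hML hLN σ (s - 1) z m) s n' <
          ucb (stateOf hML hLN σ (s - 1) z m) s (decisionOf hML hLN σ s z m))

/-- What matters is the order of the quantifiers: `s₁` depends neither on the rule nor on the
horizon nor on the configuration, so only a fixed number of slots is not covered. -/
theorem exists_isRegular (hMN : M ≤ N) (hμ0 : ∀ n, 0 ≤ μ n) (hμ1 : ∀ n, μ n ≤ 1) {η : ℝ}
    (hη : 0 < η) (hηg : 16 * η ≤ g) (hgap : ∀ i j, i < j → g ≤ μ i - μ j) (hM : 2 ≤ M)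
    {K τ : ℝ} (hK : 0 ≤ K) (hτ : 0 < τ) (b : ℕ) :
    ∃ s₁ : ℕ, N < s₁ ∧ b ≤ s₁ ∧ ∀ (L : ℕ) (hML : M ≤ L) (hLN : L ≤ N)
      (σ : Fin M → ℕ → LocalState N → Fin N), IsRule σ → ∀ (T : ℕ) (z : Config M N),
      GoodPath hML hLN hMN σ μ K τ η b T z → ∀ s, s₁ ≤ s → s ≤ T →
      IsRegular hML hLN hMN σ s z := by
  let p : Fin N := ⟨M - 2, by omega⟩
  let p' : Fin N := ⟨M - 1, by omega⟩
  have hp : (p : ℕ) + 2 = M := by simp only [p]; omega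
  have hp' : (p' : ℕ) + 1 = M := by simp only [p']; omega
  have hη1 : 16 * η ≤ 1 := by
    have := hgap p p' (by rw [Fin.lt_def]; omega)
    have := hμ0 p'
    have := hμ1 p
    linarith
  have hlogτ : ∀ᶠ s : ℕ in Filter.atTop, 9 * τ ≤ 2 * Real.log ((s : ℝ) / 2) := by
    have h : Filter.Tendsto (fun s : ℕ => Real.log ((s : ℝ) / 2)) Filter.atTop Filter.atTop :=
      Real.tendsto_log_atTop.comp
        (tendsto_natCast_atTop_atTop.atTop_div_const (by norm_num))
    filter_upwards [h.eventually_ge_atTop (9 * τ / 2)] with s hs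
    linarith
  obtain ⟨s₀, hs₀⟩ := Filter.eventually_atTop.mp
    ((eventually_log_add_le (M := M) (K + 2 / η ^ 2) (N + 4) (by omega)).and
      (hlogτ.and (eventually_half_log η hη (by linarith))))
  -- The factor `4` leaves room for passing to a second half twice: from `s` to `r`, and from `r` to
  -- the slot that bounds the count in `r`.
  refine ⟨4 * (s₀ + b + N + 2), by omega, by omega, ?_⟩
  intro L hML hLN σ hσ T z hG s hs hsT m
  have hlate : ∀ r, s₀ + b + N + 2 ≤ r →
      b ≤ r ∧ (K + 2 / η ^ 2) * Real.log r + (N + 4) ≤ r / (4 * M) := fun r hr =>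
    ⟨by omega, (hs₀ r (by omega)).1⟩
  have hτs : ∀ r : ℕ, s₀ + b + N + 2 ≤ r → 9 * τ ≤ 2 * Real.log ((r : ℝ) / 2) := fun r hr =>
    (hs₀ r (by omega)).2.1
  have hch := isChoice_decisionOf (hML := hML) (hLN := hLN) (hMN := hMN) (z := z) (s := s) hσ
    (by omega) m
  have key := isChoice_of_close hη hηg hgap hp
    (fun i hi => hG.top_close hη (by omega) (by omega) hsT (hs₀ s (by omega)).1 m hi)
    (fun n hn => hG.ucb_rest_lt hσ hμ0 hμ1 hη hηg hgap hK hτ hp hp' (s₀ := s₀ + b + N + 2)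
      (by omega) hs hsT hlate hτs (hs₀ s (by omega)).2.2 m hn)
    (rot_lt le_rfl m s) hch
  refine ⟨key.1, fun h => ⟨(key.2 h).1, fun n' hn' hne =>
    lt_of_le_of_ne ((key.2 h).2 n' hn' hne) ?_⟩⟩
  have hcnt : ∀ n, τ ≤ (stateOf hML hLN σ (s - 1) z m).cnt n := fun n =>
    hG.le_cnt hσ hμ0 hμ1 hη hη1 hK hp' (by omega) (by omega) hsT
      (fun r hr => hlate r (by omega)) (hτs s (by omega)) m n
  exact hG.ucb_ne hη hηg hgap hτ (by omega) (by omega) hsT m hne (hcnt _) (hcnt _)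

end Path

/-! ### Regular slots -/

section Regular

variable {M N L : ℕ} {hML : M ≤ L} {hLN : L ≤ N} {hMN : M ≤ N}
  {σ : Fin M → ℕ → LocalState N → Fin N} {z : Config M N} {s : ℕ}

/-- Turns on labels below `M` occupy distinct channels, and the only source with its turn on label
`M` stays at labels `M` and above. So a regular slot has no collisions even if there is a deviation.
-/
theorem IsRegular.injective (h : IsRegular hML hLN hMN σ s z) :
    Function.Injective (decisionOf hML hLN σ s z) := by
  have hcases : ∀ m : Fin M, rot M m s + 1 < M ∨ rot M m s + 1 = M := fun m => by
    have := rot_lt (le_refl M) m s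
    omega
  have hrr : ∀ m : Fin M, ((rrChannel le_rfl hMN m s : Fin N) : ℕ) = rot M m s := fun _ => rfl
  intro m m' he
  rcases hcases m with h1 | h1 <;> rcases hcases m' with h2 | h2
  · rw [(h m).1 h1, (h m').1 h2] at he
    exact rrChannel_injective hMN s he
  · have h3 := ((h m').2 h2).1
    rw [← he, (h m).1 h1, hrr] at h3
    omega
  · have h3 := ((h m).2 h1).1
    rw [he, (h m').1 h2, hrr] at h3
    omega
  · exact rrChannel_injective hMN s (Fin.ext (by
      change rot M m s = rot M m' s
      omega))

theorem IsRegular.acquires (h : IsRegular hML hLN hMN σ s z)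
    (hwin : ∀ t n m, winners z t n {m} = m) (m : Fin M) :
    Acquires (winners z s) (decisionOf hML hLN σ s z) m :=
  acquires_of_alone (hwin _) fun _ hi => h.injective hi

end Regular

/-! ### The exploration as a separate process -/

section Exploration

variable {M N : ℕ}

/-- The state after a new observation `x` of channel `n`. -/
noncomputable def observe (s : LocalState N) (n : Fin N) (x : Bool) : LocalState N :=
  ⟨Function.update s.est n ((s.est n * s.cnt n + if x = true then 1 else 0) / (s.cnt n + 1)),
    Function.update s.cnt n (s.cnt n + 1)⟩

open Classical in
/-- The channel of strictly largest upper index among the channels with labels `M, …, N`, if there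
is one. -/
noncomputable def leader (hM : 0 < M) (hMN : M ≤ N) (s : LocalState N) (t : ℕ) : Fin N :=
  if h : ∃ n : Fin N, M ≤ (n : ℕ) + 1 ∧ ∀ n' : Fin N, M ≤ (n' : ℕ) + 1 → n' ≠ n →
      ucb s t n' < ucb s t n then h.choose else ⟨M - 1, by omega⟩

theorem le_leader (hM : 0 < M) (hMN : M ≤ N) (s : LocalState N) (t : ℕ) :
    M ≤ (leader hM hMN s t : ℕ) + 1 := by
  unfold leader
  split_ifs with h
  · exact h.choose_spec.1
  · simp only; omega

theorem leader_eq (hM : 0 < M) (hMN : M ≤ N) {s : LocalState N} {t : ℕ} {n : Fin N}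
    (hn : M ≤ (n : ℕ) + 1)
    (h : ∀ n' : Fin N, M ≤ (n' : ℕ) + 1 → n' ≠ n → ucb s t n' < ucb s t n) :
    leader hM hMN s t = n := by
  have hex : ∃ n : Fin N, M ≤ (n : ℕ) + 1 ∧ ∀ n' : Fin N, M ≤ (n' : ℕ) + 1 → n' ≠ n →
      ucb s t n' < ucb s t n := ⟨n, hn, h⟩
  rw [leader, dif_pos hex]
  by_contra hne
  exact lt_asymm (h _ hex.choose_spec.1 hne) (hex.choose_spec.2 n hn (Ne.symm hne))

variable {L : ℕ} (hM : 0 < M) (hML : M ≤ L) (hLN : L ≤ N) (hMN : M ≤ N)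
  (σ : Fin M → ℕ → LocalState N → Fin N) (s₁ : ℕ)

/-- A process that continues the states of slot `s₁` by observations of the channels with labels
`M, …, N` only. -/
noncomputable def explore : ℕ → Config M N → Fin M → LocalState N
  | 0, z => stateOf hML hLN σ s₁ z
  | k + 1, z => fun m =>
      if rot M m (s₁ + (k + 1)) + 1 = M then
        observe (explore k z m) (leader hM hMN (explore k z m) (s₁ + (k + 1)))
          (rewards z ((s₁ + (k + 1) : ℕ) : ℤ)
            (leader hM hMN (explore k z m) (s₁ + (k + 1))))
      else explore k z m

/-- In slot `s₁ + (k + 1)` the exploration leaves the round robin. -/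
def Leaves (k : ℕ) (z : Config M N) : Prop :=
  ∃ m : Fin M, rot M m (s₁ + (k + 1)) + 1 = M ∧
    (leader hM hMN (explore hM hML hLN hMN σ s₁ k z m) (s₁ + (k + 1)) : ℕ) + 1 ≠ M

open Classical in
/-- The exploration leaves the round robin, and has done so less than `y` times before. -/
def LeavesCapped (y k : ℕ) (z : Config M N) : Prop :=
  Leaves hM hML hLN hMN σ s₁ k z ∧
    ((Finset.range k).filter fun i => Leaves hM hML hLN hMN σ s₁ i z).card < y

/-- The outcomes that the exploration uses up to slot `s₁ + k`. -/
noncomputable def exploreBox (M N s₁ k : ℕ) : Finset (ℤ × Fin N) :=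
  box N 1 (s₁ + 1) ∪ (box N (s₁ + 1) (s₁ + k + 1)).filter fun q => M ≤ (q.2 : ℕ) + 1

theorem exploreBox_mono {k k' : ℕ} (h : k ≤ k') :
    (exploreBox M N s₁ k : Set (ℤ × Fin N)) ⊆ exploreBox M N s₁ k' := by
  intro q hq
  simp only [exploreBox, Finset.mem_coe, Finset.mem_union, Finset.mem_filter, mem_box] at hq ⊢
  omega

/-- After `s₁` only outcomes of labels at least `M` enter. Winners play no role there, because every
observation is counted as acquired. -/
theorem dependsOn_explore (k : ℕ) :
    DependsOn (explore hM hML hLN hMN σ s₁ k) (exploreBox M N s₁ k : Set (ℤ × Fin N)) := by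
  induction k with
  | zero =>
    refine (dependsOn_stateOf hML hLN σ s₁).mono fun q hq => ?_
    simp only [exploreBox, Finset.mem_coe, Finset.mem_union]
    exact Or.inl hq
  | succ k ih =>
    intro z z' h
    have h1 : explore hM hML hLN hMN σ s₁ k z = explore hM hML hLN hMN σ s₁ k z' :=
      ih.mono (exploreBox_mono s₁ (by omega)) h
    have h2 : ∀ n : Fin N, M ≤ (n : ℕ) + 1 →
        z (((s₁ + (k + 1) : ℕ) : ℤ), n) = z' (((s₁ + (k + 1) : ℕ) : ℤ), n) := fun n hn =>
      h _ (by
        simp only [exploreBox, Finset.mem_coe, Finset.mem_union, Finset.mem_filter, mem_box]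
        right
        push_cast
        omega)
    funext m
    simp only [explore, rewards]
    rw [h1, h2 _ (le_leader hM hMN _ _)]

theorem dependsOn_leaves (k : ℕ) :
    DependsOn (Leaves hM hML hLN hMN σ s₁ k) (exploreBox M N s₁ k : Set (ℤ × Fin N)) := by
  intro z z' h
  simp only [Leaves, dependsOn_explore hM hML hLN hMN σ s₁ k h]

theorem dependsOn_leavesCapped (y k : ℕ) :
    DependsOn (LeavesCapped hM hML hLN hMN σ s₁ y k)
      (exploreBox M N s₁ k : Set (ℤ × Fin N)) := by
  classical
  intro z z' h
  have h1 : ∀ i ∈ Finset.range k, (Leaves hM hML hLN hMN σ s₁ i z ↔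
      Leaves hM hML hLN hMN σ s₁ i z') := fun i hi =>
    iff_of_eq ((dependsOn_leaves hM hML hLN hMN σ s₁ i).mono
      (exploreBox_mono s₁ (Finset.mem_range.mp hi).le) h)
  simp only [LeavesCapped, dependsOn_leaves hM hML hLN hMN σ s₁ k h, Finset.filter_congr h1]

-- The cap holds on every configuration. It keeps the sum of the probabilities of leaving below `y`
-- although the exploration is not controlled off typical configurations.
open Classical in
theorem card_leavesCapped_le (y k : ℕ) (z : Config M N) :
    ((Finset.range k).filter fun i => LeavesCapped hM hML hLN hMN σ s₁ y i z).card ≤ y := by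
  set S := (Finset.range k).filter fun i => LeavesCapped hM hML hLN hMN σ s₁ y i z with hS
  rcases S.eq_empty_or_nonempty with h | h
  · simp [h]
  · have hmem := (Finset.mem_filter.mp (S.max'_mem h)).2
    have hsub : S.erase (S.max' h) ⊆
        (Finset.range (S.max' h)).filter fun i => Leaves hM hML hLN hMN σ s₁ i z := by
      intro i hi
      obtain ⟨h1, h2⟩ := Finset.mem_erase.mp hi
      exact Finset.mem_filter.mpr ⟨Finset.mem_range.mpr (lt_of_le_of_ne (S.le_max' i h2) h1),
        (Finset.mem_filter.mp h2).2.1⟩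
    have h1 := Finset.card_le_card hsub
    rw [Finset.card_erase_of_mem (S.max'_mem h)] at h1
    have := hmem.2
    omega

variable {hM hML hLN hMN σ s₁} {z : Config M N}

/-- As long as all slots are regular, the exploration agrees with DLF. -/
theorem explore_eq (hsN : N < s₁) (hwin : ∀ t n m, winners z t n {m} = m) {T : ℕ}
    (hreg : ∀ s, s₁ ≤ s → s ≤ T → IsRegular hML hLN hMN σ s z) {k : ℕ} (hk : s₁ + k ≤ T)
    (m : Fin M) {n : Fin N} (hn : M ≤ (n : ℕ) + 1) :
    (explore hM hML hLN hMN σ s₁ k z m).est n = (stateOf hML hLN σ (s₁ + k) z m).est n ∧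
      (explore hM hML hLN hMN σ s₁ k z m).cnt n = (stateOf hML hLN σ (s₁ + k) z m).cnt n := by
  induction k generalizing n with
  | zero => exact ⟨rfl, rfl⟩
  | succ k ih =>
    have hr := hreg (s₁ + (k + 1)) (by omega) hk
    have hacq : Acquires (winners z ((s₁ + k + 1 : ℕ) : ℤ))
        (dlfSelect hML hLN σ (s₁ + k + 1) (stateOf hML hLN σ (s₁ + k) z)) m :=
      hr.acquires hwin m
    have hu : ∀ n' : Fin N, M ≤ (n' : ℕ) + 1 →
        ucb (explore hM hML hLN hMN σ s₁ k z m) (s₁ + (k + 1)) n'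
          = ucb (stateOf hML hLN σ (s₁ + k) z m) (s₁ + (k + 1)) n' := by
      intro n' hn'
      simp only [ucb, ih (by omega) hn']
    rw [show s₁ + (k + 1) = s₁ + k + 1 by ring, stateOf_succ, dlfStep_of_acquires hML hLN σ
      (by omega) _ _ _ _ hacq]
    have hdec : dlfSelect hML hLN σ (s₁ + k + 1) (stateOf hML hLN σ (s₁ + k) z) m
      = decisionOf hML hLN σ (s₁ + (k + 1)) z m := rfl
    rw [hdec]
    by_cases hrot : rot M m (s₁ + (k + 1)) + 1 = M
    · simp only [explore, if_pos hrot]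
      have hl := (hr m).2 hrot
      -- Regularity makes the choice a strict maximum, so it is the leader however `σ` breaks ties.
      have hlead : leader hM hMN (explore hM hML hLN hMN σ s₁ k z m) (s₁ + (k + 1))
          = decisionOf hML hLN σ (s₁ + (k + 1)) z m := by
        refine leader_eq hM hMN hl.1 fun n' hn' hne => ?_
        rw [hu _ hn', hu _ hl.1]
        exact hl.2 n' hn' hne
      rw [hlead]
      have ih' := ih (n := decisionOf hML hLN σ (s₁ + (k + 1)) z m) (by omega) hl.1
      by_cases hnn : n = decisionOf hML hLN σ (s₁ + (k + 1)) z m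
      · subst hnn
        simp only [observe, Function.update_self, ih']
        exact ⟨rfl, trivial⟩
      · simp only [observe, Function.update_of_ne hnn]
        exact ih (by omega) hn
    · simp only [explore, if_neg hrot]
      have hlt := rot_lt (le_refl M) m (s₁ + (k + 1))
      have hd := (hr m).1 (by omega)
      have hnn : n ≠ decisionOf hML hLN σ (s₁ + (k + 1)) z m := by
        rw [hd]
        intro h
        have : (n : ℕ) = rot M m (s₁ + (k + 1)) := congrArg Fin.val h
        omega
      simp only [Function.update_of_ne hnn]
      exact ih (by omega) hn

theorem isBad_iff_leaves (hsN : N < s₁) (hwin : ∀ t n m, winners z t n {m} = m) {T : ℕ}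
    (hreg : ∀ s, s₁ ≤ s → s ≤ T → IsRegular hML hLN hMN σ s z) {k : ℕ} (hk : s₁ + (k + 1) ≤ T) :
    IsBad hML hLN hMN σ (s₁ + (k + 1)) z ↔ Leaves hM hML hLN hMN σ s₁ k z := by
  have hr := hreg (s₁ + (k + 1)) (by omega) hk
  have hlead : ∀ m, rot M m (s₁ + (k + 1)) + 1 = M →
      leader hM hMN (explore hM hML hLN hMN σ s₁ k z m) (s₁ + (k + 1))
        = decisionOf hML hLN σ (s₁ + (k + 1)) z m := by
    intro m hrot
    have hl := (hr m).2 hrot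
    have hu : ∀ n' : Fin N, M ≤ (n' : ℕ) + 1 →
        ucb (explore hM hML hLN hMN σ s₁ k z m) (s₁ + (k + 1)) n'
          = ucb (stateOf hML hLN σ (s₁ + k) z m) (s₁ + (k + 1)) n' := by
      intro n' hn'
      have := explore_eq (hM := hM) hsN hwin hreg (k := k) (by omega) m hn'
      simp only [ucb, this]
    refine leader_eq hM hMN hl.1 fun n' hn' hne => ?_
    rw [hu _ hn', hu _ hl.1]
    exact hl.2 n' hn' hne
  constructor
  · intro hb
    obtain ⟨m, hm⟩ := Function.ne_iff.mp hb
    have hlt := rot_lt (le_refl M) m (s₁ + (k + 1))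
    have hrot : rot M m (s₁ + (k + 1)) + 1 = M := by
      by_contra hcon
      exact hm ((hr m).1 (by omega))
    refine ⟨m, hrot, fun h => hm (Fin.ext ?_)⟩
    rw [hlead m hrot] at h
    change _ = rot M m (s₁ + (k + 1))
    omega
  · rintro ⟨m, hrot, hne⟩ heq
    rw [hlead m hrot, heq] at hne
    exact hne hrot

theorem leavesCapped_of_isBad (hsN : N < s₁) (hwin : ∀ t n m, winners z t n {m} = m) {T y : ℕ}
    (hreg : ∀ s, s₁ ≤ s → s ≤ T → IsRegular hML hLN hMN σ s z) {k : ℕ} (hk : s₁ + (k + 1) ≤ T)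
    (hy : badCount hML hLN hMN σ T z ≤ y) (hb : IsBad hML hLN hMN σ (s₁ + (k + 1)) z) :
    LeavesCapped hM hML hLN hMN σ s₁ y k z := by
  classical
  refine ⟨(isBad_iff_leaves hsN hwin hreg hk).mp hb, lt_of_lt_of_le ?_ hy⟩
  have hsub : (insert k ((Finset.range k).filter fun i => Leaves hM hML hLN hMN σ s₁ i z)).image
      (fun i => s₁ + (i + 1)) ⊆ (Finset.Ioc N T).filter fun s => IsBad hML hLN hMN σ s z := by
    intro s hs
    obtain ⟨i, hi, rfl⟩ := Finset.mem_image.mp hs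
    rcases Finset.mem_insert.mp hi with rfl | hi
    · exact Finset.mem_filter.mpr ⟨Finset.mem_Ioc.mpr ⟨by omega, hk⟩, hb⟩
    · obtain ⟨h1, h2⟩ := Finset.mem_filter.mp hi
      have h3 := Finset.mem_range.mp h1
      exact Finset.mem_filter.mpr ⟨Finset.mem_Ioc.mpr ⟨by omega, by omega⟩,
        (isBad_iff_leaves hsN hwin hreg (by omega)).mpr h2⟩
  have h1 := Finset.card_le_card hsub
  rw [Finset.card_image_of_injective _ (fun i j h => by simpa using h),
    Finset.card_insert_of_notMem (by simp)] at h1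
  exact Nat.lt_of_succ_le h1

/-- A source that fails during a run of regular slots sees no reward of the best channel at its
turns. -/
theorem reward_eq_false_of_fails (hM2 : 2 ≤ M) (hsN : N < s₁)
    (hwin : ∀ t n m, winners z t n {m} = m) {T : ℕ}
    (hreg : ∀ s, s₁ ≤ s → s ≤ T → IsRegular hML hLN hMN σ s z) {past : ℤ → Fin M → Fin N}
    {m : Fin M} {s h : ℕ} (hs : s₁ + h ≤ s) (hsT : s ≤ T)
    (hf : Fails (dlfSchedule hML hLN σ past) m (s - h) h z) {r : ℕ} (hr1 : s ≤ r + h)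
    (hr2 : r < s) (hrot : rot M m r = 0) :
    rewards z (r : ℤ) ⟨0, by omega⟩ = false := by
  have hr := hreg r (by omega) (by omega)
  have hd : decisionOf hML hLN σ r z m = ⟨0, by omega⟩ := by
    rw [(hr m).1 (by omega)]
    exact Fin.ext hrot
  have hns := hf (r + h - s) (by omega)
  have he : (s : ℤ) - h + ((r + h - s : ℕ) : ℤ) = r := by omega
  rw [he, SuccAt] at hns
  have hA : dlfSchedule hML hLN σ past z r = decisionOf hML hLN σ r z := by
    simp only [dlfSchedule, withPast, Int.toNat_natCast]
    rw [if_neg (by omega)]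
  rw [hA] at hns
  by_contra hcon
  refine hns ⟨hr.acquires hwin m, ?_⟩
  rw [hd]
  simpa using hcon

end Exploration

/-! ### Independence of the exploration and the best channel -/

section Decoupling

variable {M N L : ℕ} {Ω : Type*} [MeasurableSpace Ω] {P : Measure Ω} [IsProbabilityMeasure P]
  {μ : Fin N → ℝ} {X : ℤ → Fin N → Ω → Bool} {W : ℤ → Fin N → Ω → Finset (Fin M) → Fin M}
  {hM : 0 < M} {hML : M ≤ L} {hLN : L ≤ N} {hMN : M ≤ N}
  {σ : Fin M → ℕ → LocalState N → Fin N} {s₁ : ℕ}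

theorem IsSystem.prob_reward_false (hs : IsSystem P μ X W) (hμ : ∀ n, 0 ≤ μ n) (t : ℤ)
    (n : Fin N) : P {ω | rewards (outcomes X W ω) t n = false} = ENNReal.ofReal (1 - μ n) := by
  have h : {ω | rewards (outcomes X W ω) t n = false} = {ω | X t n ω = true}ᶜ := by
    ext ω
    simp [rewards]
  have hm : MeasurableSet {ω | X t n ω = true} :=
    hs.measurable_X t n (measurableSet_singleton true)
  rw [h, prob_compl_eq_one_sub hm, hs.prob_X,
    ENNReal.ofReal_sub _ (hμ n), ENNReal.ofReal_one]

theorem IsSystem.prob_rewards_false_le (hs : IsSystem P μ X W) (hμ : ∀ n, 0 ≤ μ n) (n : Fin N)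
    (R : Finset ℕ) :
    P {ω | ∀ r ∈ R, rewards (outcomes X W ω) (r : ℤ) n = false}
      ≤ ENNReal.ofReal (1 - μ n) ^ R.card := by
  classical
  induction R using Finset.induction_on with
  | empty => simp
  | insert r R hr ih =>
    have h1 := hs.prob_le_of_past (A := R.image fun r : ℕ => ((r : ℤ), n)) (B := {((r : ℤ), n)})
      (by
        rw [Finset.disjoint_singleton_right, Finset.mem_image]
        rintro ⟨r', hr', h⟩
        have : (r' : ℤ) = r := congrArg Prod.fst h
        exact hr (by rwa [← Int.natCast_inj.mp this]))
      (p := fun z => ∀ r ∈ R, rewards z (r : ℤ) n = false)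
      (by
        intro z z' h
        have : ∀ r ∈ R, z ((r : ℤ), n) = z' ((r : ℤ), n) := fun r hr =>
          h _ (by rw [Finset.mem_coe]; exact Finset.mem_image_of_mem _ hr)
        simp only [rewards, eq_iff_iff]
        exact forall₂_congr fun r hr => by rw [this r hr])
      (E := fun _ z => rewards z (r : ℤ) n = false)
      (by
        intro _ z z' h
        simp only [rewards, h ((r : ℤ), n) (by simp)])
      (fun q => q) (c := ENNReal.ofReal (1 - μ n))
      (fun _ _ => (hs.prob_reward_false hμ r n).le)
    calc P {ω | ∀ r' ∈ insert r R, rewards (outcomes X W ω) (r' : ℤ) n = false}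
        ≤ P {ω | (∀ r ∈ R, rewards (outcomes X W ω) (r : ℤ) n = false) ∧
          rewards (outcomes X W ω) (r : ℤ) n = false} :=
          measure_mono fun ω h => ⟨fun r' hr' => h r' (Finset.mem_insert_of_mem hr'),
            h r (Finset.mem_insert_self _ _)⟩
      _ ≤ _ := h1
      _ ≤ ENNReal.ofReal (1 - μ n) * ENNReal.ofReal (1 - μ n) ^ R.card := by gcongr
      _ = _ := by rw [Finset.card_insert_of_notMem hr, pow_succ, mul_comm]

/-- The exploration is independent of the rewards of the best channel. -/
theorem IsSystem.prob_leavesCapped_and_le (hs : IsSystem P μ X W) (hμ : ∀ n, 0 ≤ μ n)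
    (hM2 : 2 ≤ M) (y k : ℕ) (R : Finset ℕ) (hR : ∀ r ∈ R, s₁ < r) :
    P {ω | LeavesCapped hM hML hLN hMN σ s₁ y k (outcomes X W ω) ∧
        ∀ r ∈ R, rewards (outcomes X W ω) (r : ℤ) ⟨0, by omega⟩ = false}
      ≤ ENNReal.ofReal (1 - μ ⟨0, by omega⟩) ^ R.card *
        P {ω | LeavesCapped hM hML hLN hMN σ s₁ y k (outcomes X W ω)} := by
  classical
  refine hs.prob_le_of_past (A := exploreBox M N s₁ k)
    (B := R.image fun r : ℕ => ((r : ℤ), (⟨0, by omega⟩ : Fin N))) ?_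
    (p := LeavesCapped hM hML hLN hMN σ s₁ y k) (dependsOn_leavesCapped hM hML hLN hMN σ s₁ y k)
    (E := fun _ z => ∀ r ∈ R, rewards z (r : ℤ) ⟨0, by omega⟩ = false) ?_ (fun q => q)
    (fun _ _ => hs.prob_rewards_false_le hμ _ R)
  -- After `s₁` the exploration uses only labels at least `M ≥ 2`, hence never the channel `0`.
  · rw [Finset.disjoint_left]
    intro q hq hq'
    obtain ⟨r, hr, rfl⟩ := Finset.mem_image.mp hq'
    have := hR r hr
    simp only [exploreBox, Finset.mem_union, Finset.mem_filter, mem_box] at hq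
    omega
  · intro _ z z' h
    have : ∀ r ∈ R, z ((r : ℤ), ⟨0, by omega⟩) = z' ((r : ℤ), ⟨0, by omega⟩) := fun r hr =>
      h _ (by rw [Finset.mem_coe]; exact Finset.mem_image_of_mem _ hr)
    simp only [rewards, eq_iff_iff]
    exact forall₂_congr fun r hr => by rw [this r hr]

theorem IsSystem.sum_prob_leavesCapped_le (hs : IsSystem P μ X W) (y k : ℕ) :
    ∑ i ∈ Finset.range k, P {ω | LeavesCapped hM hML hLN hMN σ s₁ y i (outcomes X W ω)} ≤ y := by
  classical
  have hm : ∀ i, MeasurableSet {ω | LeavesCapped hM hML hLN hMN σ s₁ y i (outcomes X W ω)} :=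
    fun i => hs.measurableSet_outcomes (dependsOn_leavesCapped hM hML hLN hMN σ s₁ y i)
  calc ∑ i ∈ Finset.range k, P {ω | LeavesCapped hM hML hLN hMN σ s₁ y i (outcomes X W ω)}
      = ∑ i ∈ Finset.range k, ∫⁻ ω,
        Set.indicator {ω | LeavesCapped hM hML hLN hMN σ s₁ y i (outcomes X W ω)}
          (fun _ => (1 : ℝ≥0∞)) ω ∂P := by
        refine Finset.sum_congr rfl fun i _ => ?_
        rw [lintegral_indicator_const (hm i), one_mul]
    _ = ∫⁻ ω, ∑ i ∈ Finset.range k,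
        Set.indicator {ω | LeavesCapped hM hML hLN hMN σ s₁ y i (outcomes X W ω)}
          (fun _ => (1 : ℝ≥0∞)) ω ∂P := by
        rw [lintegral_finsetSum']
        exact fun i _ => (measurable_const.indicator (hm i)).aemeasurable
    _ ≤ ∫⁻ _ω, (y : ℝ≥0∞) ∂P := by
        refine lintegral_mono fun ω => ?_
        simp only [Set.indicator_apply, Set.mem_ofPred_eq]
        rw [Finset.sum_boole]
        exact_mod_cast card_leavesCapped_le hM hML hLN hMN σ s₁ y k (outcomes X W ω)
    _ = y := by simp

/-- On typical configurations, leaving the round robin is nearly independent of the age. -/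
theorem IsSystem.prob_isBad_and_fails_le (hs : IsSystem P μ X W) (hμ : ∀ n, 0 ≤ μ n)
    (hM2 : 2 ≤ M) (hsN : N < s₁) {T y k h : ℕ} (hh : h ≤ k) (hk : s₁ + (k + 1) ≤ T)
    (past : ℤ → Fin M → Fin N) (m : Fin M) {G : Config M N → Prop}
    (hG : ∀ z, G z → (∀ t n m, winners z t n {m} = m) ∧
      (∀ s, s₁ ≤ s → s ≤ T → IsRegular hML hLN hMN σ s z) ∧
      badCount hML hLN hMN σ T z ≤ y) :
    P {ω | G (outcomes X W ω) ∧ IsBad hML hLN hMN σ (s₁ + (k + 1)) (outcomes X W ω) ∧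
        Fails (dlfSchedule hML hLN σ past) m ((s₁ + (k + 1) : ℕ) - h) h (outcomes X W ω)}
      ≤ ENNReal.ofReal (1 - μ ⟨0, by omega⟩) ^ (h / M) *
        P {ω | LeavesCapped hM hML hLN hMN σ s₁ y k (outcomes X W ω)} := by
  -- The turns of source `m` on the best channel during the `h` failures. As `h ≤ k`, they all come
  -- after `s₁`, and there are at least `h / M` of them.
  set R := (Finset.Ioc (s₁ + k - h) (s₁ + k)).filter fun r => rot M m r = 0 with hR
  have hcard : h / M ≤ R.card := by
    have := le_card_filter_rot m (show 0 < M by omega) (s₁ + k - h) (s₁ + k)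
    rwa [show s₁ + k - (s₁ + k - h) = h by omega] at this
  have hmem : ∀ r ∈ R, (s₁ + k - h < r ∧ r ≤ s₁ + k) ∧ rot M m r = 0 := fun r hr => by
    simpa [hR] using hr
  have hle : ENNReal.ofReal (1 - μ ⟨0, by omega⟩) ≤ 1 := by
    rw [← ENNReal.ofReal_one]
    exact ENNReal.ofReal_le_ofReal (by have := hμ ⟨0, by omega⟩; linarith)
  calc _ ≤ P {ω | LeavesCapped hM hML hLN hMN σ s₁ y k (outcomes X W ω) ∧
        ∀ r ∈ R, rewards (outcomes X W ω) (r : ℤ) ⟨0, by omega⟩ = false} := by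
        refine measure_mono fun ω hω => ?_
        obtain ⟨h1, h2, h3⟩ := hω
        obtain ⟨hwin, hreg, hy⟩ := hG _ h1
        refine ⟨leavesCapped_of_isBad hsN hwin hreg hk hy h2, fun r hr => ?_⟩
        have hr' := hmem r hr
        exact reward_eq_false_of_fails hM2 hsN hwin hreg (by omega) hk h3 (by omega) (by omega)
          hr'.2
    _ ≤ _ := hs.prob_leavesCapped_and_le hμ hM2 y k R fun r hr => by
        have hr' := hmem r hr
        omega
    _ ≤ _ := by
        gcongr ?_ * _
        exact pow_le_pow_of_le_one (zero_le) hle hcard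

end Decoupling

/-! ### Exceptional configurations -/

theorem sum_one_div_cube_le {a : ℕ} (ha : 1 ≤ a) (T : ℕ) :
    ∑ s ∈ Finset.Ioc a T, 1 / (s : ℝ) ^ 3 ≤ 1 / (a : ℝ) := by
  have har : (0 : ℝ) < a := by exact_mod_cast ha
  rcases Nat.lt_or_ge T a with h | h
  · rw [Finset.Ioc_eq_empty (by omega), Finset.sum_empty]
    positivity
  · have key : ∑ s ∈ Finset.Ioc a T, 1 / (s : ℝ) ^ 3 ≤ 1 / (a : ℝ) - 1 / (T : ℝ) := by
      induction T, h using Nat.le_induction with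
      | base => simp
      | succ T hT ih =>
        have hI : Finset.Ioc a (T + 1) = insert (T + 1) (Finset.Ioc a T) := by
          ext r; simp only [Finset.mem_Ioc, Finset.mem_insert]; omega
        rw [hI, Finset.sum_insert (by simp)]
        have hTr : (1 : ℝ) ≤ T := by exact_mod_cast ha.trans hT
        have h1 : 1 / ((T + 1 : ℕ) : ℝ) ^ 3 ≤ 1 / (T : ℝ) - 1 / ((T + 1 : ℕ) : ℝ) := by
          push_cast
          have h0 : (0 : ℝ) < T := by linarith
          rw [div_sub_div _ _ (by positivity) (by positivity),
            div_le_div_iff₀ (by positivity) (by positivity)]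
          nlinarith [sq_nonneg (T : ℝ)]
        linarith
    have : (0 : ℝ) ≤ 1 / T := by positivity
    linarith

/-- The power of `1 - 1 / (2 * M)` has to beat both the power of two and `s ^ 3`; this fixes the
numerator of `C`. Rounding up the exponent of two costs the factor `4`. -/
theorem exists_cap_factor {M : ℕ} (hM : 0 < M) {g : ℝ} (hg : 0 < g) :
    ∃ C : ℝ, 0 ≤ C ∧ ∀ s : ℕ, 1 ≤ s →
      (1 - 1 / (2 * M) : ℝ) ^ ⌈C * Real.log s⌉₊ * 2 ^ (⌈8 * Real.log s / g ^ 2⌉₊ + 1)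
        ≤ 4 / (s : ℝ) ^ 3 := by
  have hMr : (1 : ℝ) ≤ M := by exact_mod_cast hM
  have hκ0 : (0 : ℝ) < 1 - 1 / (2 * M) := by
    have : 1 / (2 * (M : ℝ)) ≤ 1 / 2 := by apply one_div_le_one_div_of_le <;> linarith
    linarith
  have hκ1 : (1 - 1 / (2 * M) : ℝ) < 1 := by
    have : (0 : ℝ) < 1 / (2 * M) := by positivity
    linarith
  set κ : ℝ := 1 - 1 / (2 * M) with hκ
  have hlam : 0 < -Real.log κ := by have := Real.log_neg hκ0 hκ1; linarith
  have hlog2 : 0 < Real.log 2 := Real.log_pos (by norm_num)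
  refine ⟨(8 * Real.log 2 / g ^ 2 + 3) / -Real.log κ, by positivity, fun s hs => ?_⟩
  set C := (8 * Real.log 2 / g ^ 2 + 3) / -Real.log κ with hC
  have hsr : (1 : ℝ) ≤ s := by exact_mod_cast hs
  have hlog : 0 ≤ Real.log s := Real.log_nonneg hsr
  have h1 : κ ^ ⌈C * Real.log s⌉₊ ≤ Real.exp (-((8 * Real.log 2 / g ^ 2 + 3) * Real.log s)) := by
    rw [← Real.rpow_natCast, Real.rpow_def_of_pos hκ0, Real.exp_le_exp]
    have h2 : C * Real.log s ≤ ⌈C * Real.log s⌉₊ := Nat.le_ceil _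
    have h3 : C * -Real.log κ = 8 * Real.log 2 / g ^ 2 + 3 := by rw [hC, div_mul_cancel₀ _ hlam.ne']
    calc Real.log κ * ⌈C * Real.log s⌉₊ = -(-Real.log κ * ⌈C * Real.log s⌉₊) := by ring
      _ ≤ -(-Real.log κ * (C * Real.log s)) := by gcongr
      _ = -((C * -Real.log κ) * Real.log s) := by ring
      _ = _ := by rw [h3]
  have h4 : (2 : ℝ) ^ (⌈8 * Real.log s / g ^ 2⌉₊ + 1)
      ≤ 4 * Real.exp (8 * Real.log 2 / g ^ 2 * Real.log s) := by
    rw [← Real.rpow_natCast, Real.rpow_def_of_pos (by norm_num)]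
    have h5 : (⌈8 * Real.log s / g ^ 2⌉₊ : ℝ) ≤ 8 * Real.log s / g ^ 2 + 1 :=
      (Nat.ceil_lt_add_one (by positivity)).le
    calc Real.exp (Real.log 2 * ((⌈8 * Real.log s / g ^ 2⌉₊ + 1 : ℕ) : ℝ))
        ≤ Real.exp (Real.log 2 * (8 * Real.log s / g ^ 2 + 2)) := by
          rw [Real.exp_le_exp]
          gcongr
          push_cast
          linarith
      _ = Real.exp (Real.log 2) ^ 2 * Real.exp (8 * Real.log 2 / g ^ 2 * Real.log s) := by
          rw [← Real.exp_nat_mul, ← Real.exp_add]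
          congr 1
          push_cast
          ring
      _ = _ := by rw [Real.exp_log (by norm_num)]; norm_num
  calc κ ^ ⌈C * Real.log s⌉₊ * 2 ^ (⌈8 * Real.log s / g ^ 2⌉₊ + 1)
      ≤ Real.exp (-((8 * Real.log 2 / g ^ 2 + 3) * Real.log s))
        * (4 * Real.exp (8 * Real.log 2 / g ^ 2 * Real.log s)) := by gcongr
    _ = 4 * Real.exp (-(((3 : ℕ) : ℝ) * Real.log s)) := by
        rw [mul_left_comm, ← Real.exp_add]
        congr 2
        push_cast
        ring
    _ = _ := by
        rw [Real.exp_neg, Real.exp_nat_mul, Real.exp_log (by linarith)]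
        rfl

section Exceptional

variable {M N L : ℕ} (hML : M ≤ L) (hLN : L ≤ N) (hMN : M ≤ N)
  (σ : Fin M → ℕ → LocalState N → Fin N)

/-- Up to slot `s`, some channel is selected too often while it has been observed rarely. -/
def LowFail (g C : ℝ) (s : ℕ) (z : Config M N) : Prop :=
  ∃ m n, ⌈C * Real.log s⌉₊ ≤ lowCount hML hLN σ ⌈8 * Real.log s / g ^ 2⌉₊ s m n z

/-- The configurations that are not typical. -/
def Exceptional (μ : Fin N → ℝ) (g C τ η : ℝ) (a T : ℕ) (z : Config M N) : Prop :=
  (∃ s, a < s ∧ s ≤ T ∧ (ConfFail hML hLN σ μ s z ∨ LowFail hML hLN σ g C s z)) ∨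
    EstFail hML hLN σ μ τ η T z

theorem stateOf_congr {T : ℕ} {z z' : Config M N}
    (h : ∀ q ∈ (box N 1 (T + 1) : Set (ℤ × Fin N)), z q = z' q) {t : ℕ} (ht : t ≤ T) :
    stateOf hML hLN σ t z = stateOf hML hLN σ t z' :=
  (dependsOn_stateOf hML hLN σ t).mono (box_subset le_rfl (by omega)) h

theorem decisionOf_congr {T : ℕ} {z z' : Config M N}
    (h : ∀ q ∈ (box N 1 (T + 1) : Set (ℤ × Fin N)), z q = z' q) {t : ℕ} (ht : t ≤ T) :
    decisionOf hML hLN σ t z = decisionOf hML hLN σ t z' :=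
  (dependsOn_decisionOf hML hLN σ t).mono (box_subset le_rfl (by omega)) h

theorem dependsOn_confFail (μ : Fin N → ℝ) {s T : ℕ} (hsT : s ≤ T) :
    DependsOn (ConfFail hML hLN σ μ s) (box N 1 (T + 1) : Set (ℤ × Fin N)) := by
  intro z z' h
  simp only [ConfFail, stateOf_congr hML hLN σ h (show s - 1 ≤ T by omega)]

theorem dependsOn_isBad {s T : ℕ} (hsT : s ≤ T) :
    DependsOn (IsBad hML hLN hMN σ s) (box N 1 (T + 1) : Set (ℤ × Fin N)) := by
  intro z z' h
  simp only [IsBad, decisionOf_congr hML hLN σ h hsT]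

theorem dependsOn_lowFail (g C : ℝ) {s T : ℕ} (hsT : s ≤ T) :
    DependsOn (LowFail hML hLN σ g C s) (box N 1 (T + 1) : Set (ℤ × Fin N)) := by
  intro z z' h
  have : ∀ l m n, lowCount hML hLN σ l s m n z = lowCount hML hLN σ l s m n z' := by
    intro l m n
    refine congrArg Finset.card (Finset.filter_congr fun r hr => ?_)
    have hr' := Finset.mem_Ioc.mp hr
    rw [stateOf_congr hML hLN σ h (show r - 1 ≤ T by omega),
      decisionOf_congr hML hLN σ h (show r ≤ T by omega)]
  simp only [LowFail, this]

theorem dependsOn_exceptional (μ : Fin N → ℝ) (g C τ η : ℝ) (a T : ℕ) :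
    DependsOn (Exceptional hML hLN σ μ g C τ η a T) (box N 1 (T + 1) : Set (ℤ × Fin N)) := by
  intro z z' h
  have h1 : EstFail hML hLN σ μ τ η T z = EstFail hML hLN σ μ τ η T z' := by
    simp only [EstFail, eq_iff_iff]
    refine exists_congr fun t => and_congr_right fun _ => and_congr_right fun ht => ?_
    rw [stateOf_congr hML hLN σ h ht]
  simp only [Exceptional, h1, eq_iff_iff]
  refine or_congr_left (exists_congr fun s => and_congr_right fun _ => and_congr_right fun hsT => ?_)
  rw [dependsOn_confFail hML hLN σ μ hsT h, dependsOn_lowFail hML hLN σ g C hsT h]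

variable {hML hLN hMN σ} {μ : Fin N → ℝ} {g C τ η : ℝ} {a b T : ℕ} {z : Config M N}

/-- Confidence can fail only up to slot `a`, which adds at most `a` deviating slots. These and the
rounding term `M * N` are absorbed by `log b`, whence the `+ 1` in the constant. -/
theorem goodPath_of_not_exceptional (hσ : IsRule σ) (hg : 0 < g)
    (hgap : ∀ i j, i < j → g ≤ μ i - μ j) (hC : 0 ≤ C) (hab : a < b)
    (hb : (a + M * N : ℝ) ≤ Real.log b)
    (h : ¬ Exceptional hML hLN σ μ g C τ η a T z) (hwin : ∀ t n m, winners z t n {m} = m) :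
    GoodPath hML hLN hMN σ μ (M * N * C + 1) τ η b T z := by
  classical
  simp only [Exceptional, not_or, not_exists, not_and] at h
  refine ⟨fun s hs hsT => (h.1 s (by omega) hsT).1, fun s hs hsT => ?_, h.2, hwin⟩
  have hb0 : (0 : ℝ) < b := by exact_mod_cast (by omega : 0 < b)
  have hlogs : Real.log b ≤ Real.log s := Real.log_le_log hb0 (by exact_mod_cast hs)
  have hlog0 : 0 ≤ Real.log s := le_trans (by positivity) (hb.trans hlogs)
  have hlow : ∀ m n, lowCount hML hLN σ ⌈8 * Real.log s / g ^ 2⌉₊ s m n z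
      ≤ ⌈C * Real.log s⌉₊ := by
    intro m n
    have := (h.1 s (by omega) hsT).2
    simp only [LowFail, not_exists, not_le] at this
    exact (this m n).le
  have h1 := badCount_le (hMN := hMN) (μ := μ) hσ hg hgap (Nat.le_ceil _) hlow
  have h2 : ((Finset.Ioc N s).filter fun s => ConfFail hML hLN σ μ s z).card ≤ a := by
    calc _ ≤ (Finset.Ioc 0 a).card := by
          refine Finset.card_le_card fun r hr => ?_
          obtain ⟨hr1, hr2⟩ := Finset.mem_filter.mp hr
          rw [Finset.mem_Ioc] at hr1
          refine Finset.mem_Ioc.mpr ⟨by omega, ?_⟩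
          by_contra hcon
          exact (h.1 r (by omega) (by omega)).1 hr2
      _ = a := by simp
  have h3 : (badCount hML hLN hMN σ s z : ℝ) ≤ a + M * N * ⌈C * Real.log s⌉₊ := by
    exact_mod_cast h1.trans (Nat.add_le_add_right h2 _)
  have h4 : (⌈C * Real.log s⌉₊ : ℝ) ≤ C * Real.log s + 1 :=
    (Nat.ceil_lt_add_one (by positivity)).le
  calc (badCount hML hLN hMN σ s z : ℝ) ≤ a + M * N * (C * Real.log s + 1) := by
        refine h3.trans ?_
        gcongr
    _ = a + M * N + M * N * C * Real.log s := by ring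
    _ ≤ Real.log s + M * N * C * Real.log s := by linarith
    _ = _ := by ring

end Exceptional

/-! ### Probability of exceptional configurations -/

section Probabilities

variable {M N L : ℕ} {Ω : Type*} [MeasurableSpace Ω] {P : Measure Ω} [IsProbabilityMeasure P]
  {μ : Fin N → ℝ} {X : ℤ → Fin N → Ω → Bool} {W : ℤ → Fin N → Ω → Finset (Fin M) → Fin M}
  {hML : M ≤ L} {hLN : L ≤ N} {hMN : M ≤ N} {σ : Fin M → ℕ → LocalState N → Fin N} {g C τ η : ℝ}

theorem IsSystem.sum_prob_confFail_le (hs : IsSystem P μ X W) (hμ : ∀ n, 0 ≤ μ n) {a T : ℕ}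
    (ha : 1 ≤ a) (haN : N ≤ a) :
    ∑ s ∈ Finset.Ioc a T, P {ω | ConfFail hML hLN σ μ s (outcomes X W ω)}
      ≤ ENNReal.ofReal (2 * M * N / a) := by
  calc _ ≤ ∑ s ∈ Finset.Ioc a T, ENNReal.ofReal (2 * M * N / (s : ℝ) ^ 3) :=
        Finset.sum_le_sum fun s hs' => hs.prob_confFail_le hML hLN σ hμ (by
          have := Finset.mem_Ioc.mp hs'; omega)
    _ = ENNReal.ofReal (2 * M * N * ∑ s ∈ Finset.Ioc a T, 1 / (s : ℝ) ^ 3) := by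
        rw [← ENNReal.ofReal_sum_of_nonneg fun _ _ => by positivity, Finset.mul_sum]
        congr 1
        exact Finset.sum_congr rfl fun s _ => by ring
    _ ≤ _ := by
        refine ENNReal.ofReal_le_ofReal ?_
        rw [div_eq_mul_one_div]
        gcongr
        exact sum_one_div_cube_le ha T

theorem IsSystem.prob_lowFail_le (hs : IsSystem P μ X W)
    (hC : ∀ s : ℕ, 1 ≤ s →
      (1 - 1 / (2 * M) : ℝ) ^ ⌈C * Real.log s⌉₊ * 2 ^ (⌈8 * Real.log s / g ^ 2⌉₊ + 1)
        ≤ 4 / (s : ℝ) ^ 3) {s : ℕ} (hs1 : 1 ≤ s) :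
    P {ω | LowFail hML hLN σ g C s (outcomes X W ω)} ≤ ENNReal.ofReal (4 * M * N / (s : ℝ) ^ 3) := by
  refine (hs.prob_lowCount_ge_le hML hLN σ _ _ _).trans (ENNReal.ofReal_le_ofReal ?_)
  calc _ ≤ M * N * (4 / (s : ℝ) ^ 3) := by
        gcongr
        exact hC s hs1
    _ = _ := by ring

/-- The bound is uniform in `T` and becomes as small as desired by the choice of `a` and `τ`. -/
theorem IsSystem.prob_exceptional_le (hs : IsSystem P μ X W) (hμ : ∀ n, 0 ≤ μ n) (hη : 0 < η)
    (hC : ∀ s : ℕ, 1 ≤ s →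
      (1 - 1 / (2 * M) : ℝ) ^ ⌈C * Real.log s⌉₊ * 2 ^ (⌈8 * Real.log s / g ^ 2⌉₊ + 1)
        ≤ 4 / (s : ℝ) ^ 3) {a T : ℕ} (ha : 1 ≤ a) (haN : N ≤ a) :
    P {ω | Exceptional hML hLN σ μ g C τ η a T (outcomes X W ω)}
      ≤ ENNReal.ofReal (6 * M * N / a + 2 * M * N * Real.exp (-(2 * η ^ 2 * τ))) := by
  have hsub : {ω | Exceptional hML hLN σ μ g C τ η a T (outcomes X W ω)} ⊆
      (⋃ s ∈ Finset.Ioc a T, ({ω | ConfFail hML hLN σ μ s (outcomes X W ω)} ∪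
        {ω | LowFail hML hLN σ g C s (outcomes X W ω)})) ∪
      {ω | EstFail hML hLN σ μ τ η T (outcomes X W ω)} := by
    intro ω hω
    rcases hω with ⟨s, h1, h2, h3⟩ | h
    · left
      simp only [Set.mem_iUnion]
      exact ⟨s, Finset.mem_Ioc.mpr ⟨h1, h2⟩, h3⟩
    · exact Or.inr h
  have hlow : ∑ s ∈ Finset.Ioc a T, P {ω | LowFail hML hLN σ g C s (outcomes X W ω)}
      ≤ ENNReal.ofReal (4 * M * N / a) := by
    calc _ ≤ ∑ s ∈ Finset.Ioc a T, ENNReal.ofReal (4 * M * N / (s : ℝ) ^ 3) :=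
          Finset.sum_le_sum fun s hs' => hs.prob_lowFail_le hC (by
            have := Finset.mem_Ioc.mp hs'; omega)
      _ = ENNReal.ofReal (4 * M * N * ∑ s ∈ Finset.Ioc a T, 1 / (s : ℝ) ^ 3) := by
          rw [← ENNReal.ofReal_sum_of_nonneg fun _ _ => by positivity, Finset.mul_sum]
          congr 1
          exact Finset.sum_congr rfl fun s _ => by ring
      _ ≤ _ := by
          refine ENNReal.ofReal_le_ofReal ?_
          rw [div_eq_mul_one_div (4 * (M : ℝ) * N)]
          gcongr
          exact sum_one_div_cube_le ha T
  calc _ ≤ _ := measure_mono hsub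
    _ ≤ _ := measure_union_le _ _
    _ ≤ (∑ s ∈ Finset.Ioc a T, (P {ω | ConfFail hML hLN σ μ s (outcomes X W ω)} +
          P {ω | LowFail hML hLN σ g C s (outcomes X W ω)})) +
        ENNReal.ofReal (2 * M * N * Real.exp (-(2 * η ^ 2 * τ))) := by
        gcongr
        · exact (measure_biUnion_finset_le _ _).trans
            (Finset.sum_le_sum fun s _ => measure_union_le _ _)
        · exact hs.prob_estFail_le hML hLN σ hμ hη T
    _ ≤ ENNReal.ofReal (2 * M * N / a) + ENNReal.ofReal (4 * M * N / a) +
        ENNReal.ofReal (2 * M * N * Real.exp (-(2 * η ^ 2 * τ))) := by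
        rw [Finset.sum_add_distrib]
        gcongr
        exact hs.sum_prob_confFail_le hμ ha haN
    _ = _ := by
        rw [← ENNReal.ofReal_add (by positivity) (by positivity),
          ← ENNReal.ofReal_add (by positivity) (by positivity)]
        congr 1
        ring

/-- The mean number of slots in which DLF leaves the round robin, on an event `D`. -/
theorem IsSystem.sum_prob_and_isBad_le (hs : IsSystem P μ X W) (hμ : ∀ n, 0 ≤ μ n)
    (hσ : IsRule σ) (hg : 0 < g) (hgap : ∀ i j, i < j → g ≤ μ i - μ j) (hN : 1 ≤ N)
    (hC : ∀ s : ℕ, 1 ≤ s →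
      (1 - 1 / (2 * M) : ℝ) ^ ⌈C * Real.log s⌉₊ * 2 ^ (⌈8 * Real.log s / g ^ 2⌉₊ + 1)
        ≤ 4 / (s : ℝ) ^ 3) {T : ℕ} (hT : 1 ≤ T) {D : Config M N → Prop}
    (hD : DependsOn D (box N 1 (T + 1) : Set (ℤ × Fin N))) :
    ∑ s ∈ Finset.Ioc N T, P {ω | D (outcomes X W ω) ∧ IsBad hML hLN hMN σ s (outcomes X W ω)}
      ≤ ENNReal.ofReal (6 * M * N) +
        (M * N * ⌈C * Real.log T⌉₊ : ℕ) * P {ω | D (outcomes X W ω)} := by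
  classical
  have hDm : MeasurableSet {ω | D (outcomes X W ω)} := hs.measurableSet_outcomes hD
  have hB : ∀ s ∈ Finset.Ioc N T,
      MeasurableSet {ω | IsBad hML hLN hMN σ s (outcomes X W ω)} := fun s hs' =>
    hs.measurableSet_outcomes (dependsOn_isBad hML hLN hMN σ (Finset.mem_Ioc.mp hs').2)
  have hCm : ∀ s ∈ Finset.Ioc N T,
      MeasurableSet {ω | ConfFail hML hLN σ μ s (outcomes X W ω)} := fun s hs' =>
    hs.measurableSet_outcomes (dependsOn_confFail hML hLN σ μ (Finset.mem_Ioc.mp hs').2)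
  have hLm : MeasurableSet {ω | LowFail hML hLN σ g C T (outcomes X W ω)} :=
    hs.measurableSet_outcomes (dependsOn_lowFail hML hLN σ g C le_rfl)
  have one : ∀ {S : Set Ω}, MeasurableSet S →
      P S = ∫⁻ ω, S.indicator (fun _ => (1 : ℝ≥0∞)) ω ∂P := fun hS => by
    rw [lintegral_indicator_const hS, one_mul]
  have hDB : ∀ s ∈ Finset.Ioc N T, MeasurableSet
      {ω | D (outcomes X W ω) ∧ IsBad hML hLN hMN σ s (outcomes X W ω)} := fun s hs' =>
    hDm.inter (hB s hs')
  calc ∑ s ∈ Finset.Ioc N T, P {ω | D (outcomes X W ω) ∧ IsBad hML hLN hMN σ s (outcomes X W ω)}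
      = ∫⁻ ω, ∑ s ∈ Finset.Ioc N T, Set.indicator
          {ω | D (outcomes X W ω) ∧ IsBad hML hLN hMN σ s (outcomes X W ω)} (fun _ => 1) ω ∂P := by
        rw [lintegral_finsetSum' _ fun s hs' =>
          (measurable_const.indicator (hDB s hs')).aemeasurable]
        exact Finset.sum_congr rfl fun s hs' => one (hDB s hs')
    _ ≤ ∫⁻ ω, ((∑ s ∈ Finset.Ioc N T, Set.indicator
          {ω | ConfFail hML hLN σ μ s (outcomes X W ω)} (fun _ => 1) ω) +
          Set.indicator {ω | LowFail hML hLN σ g C T (outcomes X W ω)} (fun _ => (T : ℝ≥0∞)) ω +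
          Set.indicator {ω | D (outcomes X W ω)}
            (fun _ => ((M * N * ⌈C * Real.log T⌉₊ : ℕ) : ℝ≥0∞)) ω) ∂P := by
        -- If the low counts fail at `T`, the number of deviating slots is bounded by `T`, which is
        -- affordable at probability of order `T ^ (-3)`; otherwise `badCount_le` applies.
        refine lintegral_mono fun ω => ?_
        simp only [Set.indicator_apply, Set.mem_ofPred_eq]
        rw [Finset.sum_boole, Finset.sum_boole]
        by_cases hd : D (outcomes X W ω)
        · rw [if_pos hd]
          simp only [hd, true_and]
          by_cases hl : LowFail hML hLN σ g C T (outcomes X W ω)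
          · rw [if_pos hl]
            have h1 : ((Finset.Ioc N T).filter
                fun s => IsBad hML hLN hMN σ s (outcomes X W ω)).card ≤ T :=
              (Finset.card_filter_le _ _).trans (by simp)
            exact (Nat.cast_le.mpr h1).trans (le_add_self.trans le_self_add)
          · rw [if_neg hl, add_zero]
            have hlow : ∀ m n, lowCount hML hLN σ ⌈8 * Real.log T / g ^ 2⌉₊ T m n (outcomes X W ω)
                ≤ ⌈C * Real.log T⌉₊ := by
              intro m n
              simp only [LowFail, not_exists, not_le] at hl
              exact (hl m n).le
            have h1 := badCount_le (hMN := hMN) (μ := μ) hσ hg hgap (Nat.le_ceil _) hlow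
            exact_mod_cast h1
        · simp [hd]
    _ = (∑ s ∈ Finset.Ioc N T, P {ω | ConfFail hML hLN σ μ s (outcomes X W ω)}) +
        T * P {ω | LowFail hML hLN σ g C T (outcomes X W ω)} +
          (M * N * ⌈C * Real.log T⌉₊ : ℕ) * P {ω | D (outcomes X W ω)} := by
        rw [lintegral_add_right _ (measurable_const.indicator hDm),
          lintegral_add_right _ (measurable_const.indicator hLm),
          lintegral_indicator_const hLm, lintegral_indicator_const hDm,
          lintegral_finsetSum' _ fun s hs' =>
            (measurable_const.indicator (hCm s hs')).aemeasurable]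
        congr 2
        exact Finset.sum_congr rfl fun s hs' => (one (hCm s hs')).symm
    _ ≤ ENNReal.ofReal (2 * M * N) + ENNReal.ofReal (4 * M * N) +
          (M * N * ⌈C * Real.log T⌉₊ : ℕ) * P {ω | D (outcomes X W ω)} := by
        have hTr : (1 : ℝ) ≤ T := by exact_mod_cast hT
        have hNr : (1 : ℝ) ≤ N := by exact_mod_cast hN
        gcongr
        · refine (hs.sum_prob_confFail_le hμ hN le_rfl).trans (ENNReal.ofReal_le_ofReal ?_)
          exact div_le_self (by positivity) hNr
        · calc (T : ℝ≥0∞) * P {ω | LowFail hML hLN σ g C T (outcomes X W ω)}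
              ≤ ENNReal.ofReal T * ENNReal.ofReal (4 * M * N / (T : ℝ) ^ 3) := by
                rw [ENNReal.ofReal_natCast]
                gcongr
                exact hs.prob_lowFail_le hC hT
            _ = ENNReal.ofReal (4 * M * N / (T : ℝ) ^ 2) := by
                rw [← ENNReal.ofReal_mul (by positivity)]
                congr 1
                field_simp
            _ ≤ _ := ENNReal.ofReal_le_ofReal (div_le_self (by positivity) (one_le_pow₀ hTr))
    _ = _ := by
        rw [← ENNReal.ofReal_add (by positivity) (by positivity)]
        congr 2
        ring

end Probabilities

/-! ### The ages in the slots in which DLF leaves the round robin -/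

theorem Fails.mono {M N : ℕ} {A : Config M N → ℤ → Fin M → Fin N} {m : Fin M} {s : ℤ} {h j : ℕ}
    {z : Config M N} (hf : Fails A m (s - j) j z) (hj : h ≤ j) : Fails A m (s - h) h z := by
  intro i hi
  have := hf (j - h + i) (by omega)
  have e : s - j + ((j - h + i : ℕ) : ℤ) = s - h + i := by omega
  rwa [e] at this

section Sum

variable {M N L : ℕ} {Ω : Type*} [MeasurableSpace Ω] {P : Measure Ω} [IsProbabilityMeasure P]
  {μ : Fin N → ℝ} {X : ℤ → Fin N → Ω → Bool} {W : ℤ → Fin N → Ω → Finset (Fin M) → Fin M}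

/-- The series is split at `h` and `H`: runs shorter than `h` cost only the probability of
deviating, runs between contain a run of length `h`, and for longer runs the geometric tail suffices
without the deviation. -/
theorem IsSystem.deviationAge_le (hs : IsSystem P μ X W) {μmin : ℝ} (h0 : 0 ≤ μmin)
    (hμ : ∀ n, μmin ≤ μ n) {A O : Config M N → ℤ → Fin M → Fin N} (hA : IsAdapted A) (m : Fin M)
    (s h H : ℕ) :
    deviationAge P X W A O m s
      ≤ h * P {ω | Deviates A O s (outcomes X W ω)} +
        H * P {ω | Deviates A O s (outcomes X W ω) ∧ Fails A m (s - h) h (outcomes X W ω)} +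
        ENNReal.ofReal (1 - μmin / M) ^ H * (1 - ENNReal.ofReal (1 - μmin / M))⁻¹ := by
  set q := ENNReal.ofReal (1 - μmin / M)
  let f : ℕ → ℝ≥0∞ := fun j =>
    P {ω | Deviates A O s (outcomes X W ω) ∧ Fails A m (s - j) j (outcomes X W ω)}
  have hsplit : deviationAge P X W A O m s = ∑ j ∈ Finset.range H, f j + ∑' j, f (j + H) :=
    (Summable.sum_add_tsum_nat_add' (f := f) ENNReal.summable).symm
  rw [hsplit]
  refine add_le_add ?_ ?_
  · calc ∑ j ∈ Finset.range H, f j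
        ≤ ∑ j ∈ Finset.range H,
          ((if j ∈ Finset.range h then P {ω | Deviates A O s (outcomes X W ω)} else 0) + f h) := by
          refine Finset.sum_le_sum fun j _ => ?_
          split_ifs with hj
          · exact (measure_mono fun ω hω => hω.1).trans le_self_add
          · rw [zero_add]
            rw [Finset.mem_range, not_lt] at hj
            exact measure_mono fun ω hω => ⟨hω.1, hω.2.mono hj⟩
      _ ≤ _ := by
          rw [Finset.sum_add_distrib, ← Finset.sum_filter, Finset.sum_const, Finset.sum_const,
            nsmul_eq_mul, nsmul_eq_mul, Finset.card_range]
          have hc : ((Finset.range H).filter fun j => j ∈ Finset.range h).card ≤ h := by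
            calc _ ≤ (Finset.range h).card := Finset.card_le_card fun j hj =>
                  (Finset.mem_filter.mp hj).2
              _ = h := Finset.card_range h
          gcongr
  · rw [← ENNReal.tsum_geometric, ← ENNReal.tsum_mul_left]
    refine ENNReal.tsum_le_tsum fun j => ?_
    rw [← pow_add, add_comm H j]
    exact (measure_mono fun ω hω => hω.2).trans (hs.prob_fails_le h0 hμ hA m _ (j + H))

variable {hM : 0 < M} {hML : M ≤ L} {hLN : L ≤ N} {hMN : M ≤ N}
  {σ : Fin M → ℕ → LocalState N → Fin N}

theorem deviates_iff_isBad {past past' : ℤ → Fin M → Fin N} {s : ℕ} (hs : 0 < s)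
    {z : Config M N} :
    Deviates (dlfSchedule hML hLN σ past) (oracleSchedule hMN past') s z
      ↔ IsBad hML hLN hMN σ s z := by
  have h0 : ¬ ((s : ℤ) ≤ 0) := by omega
  simp only [Deviates, IsBad, dlfSchedule, oracleSchedule, withPast, if_neg h0,
    Int.toNat_natCast, hs.ne', false_or]

/-- Meant for constant `h` and `H`, `β`, `y` of order `log T`. Only the terms with a factor `H` can
then reach order `log² T`, and these carry either the rarity of `D`, through `β'`, or the small
power of `1 - μ 0`. -/
theorem IsSystem.sum_deviationAge_le (hs : IsSystem P μ X W) {μmin : ℝ} (h0 : 0 ≤ μmin)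
    (hμ : ∀ n, μmin ≤ μ n) (hμ1 : ∀ n, μ n ≤ 1) (hM2 : 2 ≤ M) {s₁ T y : ℕ} (hsN : N < s₁)
    (hT : 1 ≤ T) {D : Config M N → Prop}
    (hD : ∀ z, (∀ t n m, winners z t n {m} = m) → ¬ D z →
      (∀ s, s₁ ≤ s → s ≤ T → IsRegular hML hLN hMN σ s z) ∧ badCount hML hLN hMN σ T z ≤ y)
    (past past' : ℤ → Fin M → Fin N) (m : Fin M) (h H : ℕ) {c β β' : ℝ} (hc : 0 ≤ c)
    (hβ : 0 ≤ β) (hβ' : 0 ≤ β')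
    (hq : ENNReal.ofReal (1 - μmin / M) ^ H * (1 - ENNReal.ofReal (1 - μmin / M))⁻¹
      ≤ ENNReal.ofReal (c / T))
    (hB : ∑ s ∈ Finset.Ioc N T, P {ω | IsBad hML hLN hMN σ s (outcomes X W ω)} ≤ ENNReal.ofReal β)
    (hDB : ∑ s ∈ Finset.Ioc N T,
      P {ω | D (outcomes X W ω) ∧ IsBad hML hLN hMN σ s (outcomes X W ω)} ≤ ENNReal.ofReal β') :
    ∑ s ∈ Finset.range T,
        deviationAge P X W (dlfSchedule hML hLN σ past) (oracleSchedule hMN past') m s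
      ≤ ENNReal.ofReal ((s₁ + 1 + h) * (h + H + c) + h * β +
          H * (β' + (1 - μ ⟨0, by omega⟩) ^ (h / M) * y) + c) := by
  set A := dlfSchedule hML hLN σ past
  set O := oracleSchedule (N := N) hMN past'
  have hM : 0 < M := by omega
  have hTr : (1 : ℝ) ≤ T := by exact_mod_cast hT
  have hp0 : 0 ≤ 1 - μ ⟨0, by omega⟩ := by have := hμ1 ⟨0, by omega⟩; linarith
  set p := ENNReal.ofReal (1 - μ ⟨0, by omega⟩) ^ (h / M) with hp
  set tail := ENNReal.ofReal (1 - μmin / M) ^ H * (1 - ENNReal.ofReal (1 - μmin / M))⁻¹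
  let Bs : ℕ → ℝ≥0∞ := fun s => P {ω | IsBad hML hLN hMN σ s (outcomes X W ω)}
  let Ds : ℕ → ℝ≥0∞ := fun s =>
    P {ω | D (outcomes X W ω) ∧ IsBad hML hLN hMN σ s (outcomes X W ω)}
  let Ls : ℕ → ℝ≥0∞ := fun k => P {ω | LeavesCapped hM hML hLN hMN σ s₁ y k (outcomes X W ω)}
  have hgen : ∀ s : ℕ, deviationAge P X W A O m s
      ≤ h * P {ω | Deviates A O s (outcomes X W ω)} +
        H * P {ω | Deviates A O s (outcomes X W ω) ∧ Fails A m (s - h) h (outcomes X W ω)} + tail :=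
    fun s => hs.deviationAge_le h0 hμ (isAdapted_dlfSchedule hML hLN σ past) m s h H
  clear_value tail
  have hlate : ∀ s ∈ Finset.Ico (s₁ + 1 + h) T, deviationAge P X W A O m s
      ≤ h * Bs s + H * (Ds s + p * Ls (s - (s₁ + 1))) + tail := by
    intro s hs'
    obtain ⟨hs1, hs2⟩ := Finset.mem_Ico.mp hs'
    obtain ⟨k, rfl⟩ : ∃ k, s = s₁ + (k + 1) := ⟨s - (s₁ + 1), by omega⟩
    have hdev : ∀ z, Deviates A O (s₁ + (k + 1)) z ↔ IsBad hML hLN hMN σ (s₁ + (k + 1)) z :=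
      fun z => deviates_iff_isBad (by omega)
    refine (hgen (s₁ + (k + 1))).trans ?_
    simp only [hdev]
    have hk : s₁ + (k + 1) - (s₁ + 1) = k := by omega
    rw [hk]
    refine add_le_add (add_le_add le_rfl (mul_le_mul_right ?_ _)) le_rfl
    have h1 := hs.prob_isBad_and_fails_le (hM := hM) (fun n => h0.trans (hμ n)) hM2 hsN
      (T := T) (y := y) (k := k) (h := h) (by omega) (by omega) past m
      (G := fun z => (∀ t n m, winners z t n {m} = m) ∧ ¬ D z)
      (fun z hz => ⟨hz.1, (hD z hz.1 hz.2).1, (hD z hz.1 hz.2).2⟩)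
    refine le_trans ?_ (add_le_add le_rfl h1)
    refine le_trans (measure_mono_ae ?_) (measure_union_le _ _)
    filter_upwards [hs.ae_winner_singleton] with ω hω hbf
    by_cases hd : D (outcomes X W ω)
    · exact Or.inl ⟨hd, hbf.1⟩
    · exact Or.inr ⟨⟨hω, hd⟩, hbf⟩
  have hearly : ∀ s, deviationAge P X W A O m s ≤ h + H + tail := by
    intro s
    refine (hgen s).trans ?_
    gcongr
    · exact mul_le_of_le_one_right' prob_le_one
    · exact mul_le_of_le_one_right' prob_le_one
  have hsubset : Finset.range T ⊆ Finset.range (s₁ + 1 + h) ∪ Finset.Ico (s₁ + 1 + h) T := by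
    intro s hs'
    simp only [Finset.mem_union, Finset.mem_range, Finset.mem_Ico] at hs' ⊢
    omega
  have hdisj : Disjoint (Finset.range (s₁ + 1 + h)) (Finset.Ico (s₁ + 1 + h) T) := by
    rw [Finset.disjoint_left]
    intro s hs1 hs2
    simp only [Finset.mem_range, Finset.mem_Ico] at hs1 hs2
    omega
  have hIoc : Finset.Ico (s₁ + 1 + h) T ⊆ Finset.Ioc N T := by
    intro s hs'
    simp only [Finset.mem_Ioc, Finset.mem_Ico] at hs' ⊢
    omega
  have hL : ∑ s ∈ Finset.Ico (s₁ + 1 + h) T, Ls (s - (s₁ + 1)) ≤ y := by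
    calc _ ≤ ∑ s ∈ Finset.Ico (s₁ + 1) T, Ls (s - (s₁ + 1)) :=
          Finset.sum_le_sum_of_subset (Finset.Ico_subset_Ico_left (by omega))
      _ = ∑ k ∈ Finset.range (T - (s₁ + 1)), Ls k := by
          rw [Finset.sum_Ico_eq_sum_range]
          exact Finset.sum_congr rfl fun k _ => by rw [Nat.add_sub_cancel_left]
      _ ≤ y := hs.sum_prob_leavesCapped_le y _
  have htail : tail ≤ ENNReal.ofReal c :=
    hq.trans (ENNReal.ofReal_le_ofReal (div_le_self hc hTr))
  have hTtail : (T : ℝ≥0∞) * tail ≤ ENNReal.ofReal c := by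
    calc (T : ℝ≥0∞) * tail ≤ ENNReal.ofReal T * ENNReal.ofReal (c / T) := by
          rw [ENNReal.ofReal_natCast]
          gcongr
      _ = _ := by
          rw [← ENNReal.ofReal_mul (by positivity)]
          congr 1
          field_simp
  calc ∑ s ∈ Finset.range T, deviationAge P X W A O m s
      ≤ ∑ s ∈ Finset.range (s₁ + 1 + h), deviationAge P X W A O m s +
        ∑ s ∈ Finset.Ico (s₁ + 1 + h) T, deviationAge P X W A O m s := by
        rw [← Finset.sum_union hdisj]
        exact Finset.sum_le_sum_of_subset hsubset
    _ ≤ ∑ s ∈ Finset.range (s₁ + 1 + h), (h + H + tail) +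
        ∑ s ∈ Finset.Ico (s₁ + 1 + h) T,
          (h * Bs s + H * (Ds s + p * Ls (s - (s₁ + 1))) + tail) :=
        add_le_add (Finset.sum_le_sum fun s _ => hearly s) (Finset.sum_le_sum hlate)
    _ = (s₁ + 1 + h : ℕ) * (h + H + tail) +
        (h * ∑ s ∈ Finset.Ico (s₁ + 1 + h) T, Bs s +
          H * (∑ s ∈ Finset.Ico (s₁ + 1 + h) T, Ds s +
            p * ∑ s ∈ Finset.Ico (s₁ + 1 + h) T, Ls (s - (s₁ + 1))) +
          (T - (s₁ + 1 + h) : ℕ) * tail) := by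
        rw [Finset.sum_const, nsmul_eq_mul, Finset.card_range, Finset.sum_add_distrib,
          Finset.sum_add_distrib, ← Finset.mul_sum, ← Finset.mul_sum, Finset.sum_add_distrib,
          ← Finset.mul_sum, Finset.sum_const, nsmul_eq_mul, Nat.card_Ico]
    _ ≤ (s₁ + 1 + h : ℕ) * (h + H + ENNReal.ofReal c) +
        (h * ENNReal.ofReal β + H * (ENNReal.ofReal β' + p * y) + ENNReal.ofReal c) := by
        gcongr
        · exact (Finset.sum_le_sum_of_subset hIoc).trans hB
        · exact (Finset.sum_le_sum_of_subset hIoc).trans hDB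
        · refine le_trans ?_ hTtail
          gcongr
          omega
    _ = _ := by
        rw [hp, ← ENNReal.ofReal_pow hp0]
        have hpp : 0 ≤ (1 - μ ⟨0, by omega⟩) ^ (h / M) := pow_nonneg hp0 _
        generalize (1 - μ ⟨0, by omega⟩) ^ (h / M) = p' at hpp
        rw [← ENNReal.ofReal_natCast, ← ENNReal.ofReal_natCast h, ← ENNReal.ofReal_natCast H,
          ← ENNReal.ofReal_natCast y, ← ENNReal.ofReal_mul hpp,
          ← ENNReal.ofReal_add hβ' (by positivity), ← ENNReal.ofReal_mul (by positivity),
          ← ENNReal.ofReal_mul (by positivity), ← ENNReal.ofReal_add (by positivity) (by positivity),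
          ← ENNReal.ofReal_add (by positivity) (by positivity),
          ← ENNReal.ofReal_add (by positivity) (by positivity),
          ← ENNReal.ofReal_add (by positivity) (by positivity),
          ← ENNReal.ofReal_mul (by positivity), ← ENNReal.ofReal_add (by positivity) (by positivity)]
        congr 1
        push_cast
        ring

end Sum

/-! ### Choice of the constants and conclusion -/

theorem exists_quadratic_le (A B C : ℝ) {δ : ℝ} (h : A < δ) :
    ∃ x₀ : ℝ, ∀ x, x₀ ≤ x → A * x ^ 2 + B * x + C ≤ δ * x ^ 2 := by
  refine ⟨max 1 ((|B| + |C|) / (δ - A)), fun x hx => ?_⟩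
  have h1 : 1 ≤ x := (le_max_left _ _).trans hx
  have h2 : (|B| + |C|) / (δ - A) ≤ x := (le_max_right _ _).trans hx
  rw [div_le_iff₀ (by linarith)] at h2
  have h3 : B * x ≤ |B| * x := by gcongr; exact le_abs_self B
  have h4 : C ≤ |C| * x := (le_abs_self C).trans (le_mul_of_one_le_right (abs_nonneg C) h1)
  nlinarith

theorem pow_ceil_log_le {q : ℝ} (h0 : 0 < q) (h1 : q < 1) {T : ℕ} (hT : 1 ≤ T) :
    q ^ ⌈1 / -Real.log q * Real.log T⌉₊ ≤ 1 / T := by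
  have hTr : (0 : ℝ) < T := by exact_mod_cast hT
  have hlam : 0 < -Real.log q := by have := Real.log_neg h0 h1; linarith
  rw [← Real.rpow_natCast, Real.rpow_def_of_pos h0, one_div (T : ℝ), ← Real.exp_log hTr,
    ← Real.exp_neg, Real.exp_le_exp, Real.exp_log hTr]
  have h2 := Nat.le_ceil (1 / -Real.log q * Real.log T)
  calc Real.log q * ⌈1 / -Real.log q * Real.log T⌉₊
      = -(-Real.log q * ⌈1 / -Real.log q * Real.log T⌉₊) := by ring
    _ ≤ -(-Real.log q * (1 / -Real.log q * Real.log T)) := by gcongr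
    _ = -Real.log T := by rw [← mul_assoc, mul_one_div_cancel hlam.ne', one_mul]

/-- The ages in the slots in which DLF leaves the round robin add up to `o(log² T)`. -/
theorem exists_sum_deviationAge_le {M N : ℕ} (hM2 : 2 ≤ M) (hMN : M ≤ N) {μ : Fin N → ℝ}
    {μmin g : ℝ} (h0 : 0 < μmin) (hμ : ∀ n, μmin ≤ μ n) (hμ1 : ∀ n, μ n ≤ 1) (hg : 0 < g)
    (hgap : ∀ i j, i < j → g ≤ μ i - μ j) {δ : ℝ} (hδ : 0 < δ) :
    ∃ T₀ : ℕ, 1 ≤ T₀ ∧ ∀ T : ℕ, T₀ ≤ T → ∀ (L : ℕ) (hML : M ≤ L) (hLN : L ≤ N)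
      (Ω : Type*) [MeasurableSpace Ω] (P : Measure Ω) [IsProbabilityMeasure P]
      (X : ℤ → Fin N → Ω → Bool) (W : ℤ → Fin N → Ω → Finset (Fin M) → Fin M),
      IsSystem P μ X W → ∀ (σ : Fin M → ℕ → LocalState N → Fin N), IsRule σ →
      ∀ (past past' : ℤ → Fin M → Fin N) (m : Fin M),
      ∑ s ∈ Finset.range T,
        deviationAge P X W (dlfSchedule hML hLN σ past) (oracleSchedule hMN past') m s
          ≤ ENNReal.ofReal (δ * Real.log T ^ 2) := by
  have hMr : (2 : ℝ) ≤ M := by exact_mod_cast hM2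
  have hNr : (2 : ℝ) ≤ N := by exact_mod_cast hM2.trans hMN
  have hμ0 : ∀ n, 0 ≤ μ n := fun n => h0.le.trans (hμ n)
  obtain ⟨C, hC0, hC⟩ := exists_cap_factor (show 0 < M by omega) hg
  set K : ℝ := M * N * C + 1 with hK
  have hK0 : 0 ≤ K := by positivity
  set q : ℝ := 1 - μmin / M with hqdef
  have hq1 : q < 1 := by
    have : 0 < μmin / M := by positivity
    linarith
  have hq0 : 0 < q := by
    have h1 : μmin ≤ 1 := (hμ ⟨0, by omega⟩).trans (hμ1 _)
    have : μmin / M < 1 := by rw [div_lt_one (by linarith)]; linarith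
    linarith
  have hlam : 0 < -Real.log q := by have := Real.log_neg hq0 hq1; linarith
  set B : ℝ := 1 / -Real.log q with hB
  have hB0 : 0 ≤ B := by positivity
  set c : ℝ := 1 / (1 - q) with hcdef
  have hc0 : 0 ≤ c := by have : 0 < 1 - q := by linarith
                         positivity
  -- `ε` bounds the probability of exceptional configurations. Together with `h'` below it is chosen
  -- so that the two parts of the coefficient of `log² T` are at most `δ / 4` each.
  set ε : ℝ := δ / (4 * (B * (M * N * C) + 1)) with hε
  have hε0 : 0 < ε := by positivity
  set p : ℝ := 1 - μ ⟨0, by omega⟩ with hp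
  have hp0 : 0 ≤ p := by have := hμ1 ⟨0, by omega⟩; linarith
  have hp1 : p < 1 := by have := hμ ⟨0, by omega⟩; linarith
  obtain ⟨h', hh'⟩ := exists_pow_lt_of_lt_one
    (show 0 < δ / (4 * (B * K + 1)) by positivity) hp1
  set h := M * h' with hh
  have hhM : h / M = h' := Nat.mul_div_cancel_left _ (by omega)
  have hη : 0 < g / 16 := by positivity
  set η := g / 16 with hηdef
  -- With `x = 4 * M * N / ε`, the inequality `exp (-x) ≤ 1 / x` bounds the share of `EstFail` by `ε
  -- / 2`; the bound `12 * M * N / ε ≤ a` does so for the rest.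
  set τ : ℝ := 4 * M * N / ε / (2 * η ^ 2) with hτ
  have hτ0 : 0 < τ := by positivity
  obtain ⟨a, ha⟩ : ∃ a : ℕ, 1 ≤ a ∧ N ≤ a ∧ 12 * M * N / ε ≤ a :=
    ⟨⌈12 * M * N / ε⌉₊ + N + 1, by omega, by omega, by
      push_cast
      have := Nat.le_ceil (12 * M * N / ε)
      have hN : (0 : ℝ) ≤ N := by positivity
      linarith⟩
  obtain ⟨ha1, haN, haε⟩ := ha
  have hexc : 6 * M * N / a + 2 * M * N * Real.exp (-(2 * η ^ 2 * τ)) ≤ ε := by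
    have har : (0 : ℝ) < a := by exact_mod_cast ha1
    have h1 : 6 * (M : ℝ) * N / a ≤ ε / 2 := by
      rw [div_le_iff₀ hε0] at haε
      rw [div_le_iff₀ har]
      linarith
    have h2 : 2 * η ^ 2 * τ = 4 * M * N / ε := by rw [hτ]; field_simp
    have h3 : Real.exp (-(2 * η ^ 2 * τ)) ≤ ε / (4 * M * N) := by
      rw [h2, Real.exp_neg, ← inv_div (4 * (M : ℝ) * N) ε]
      have : (0 : ℝ) < 4 * M * N / ε := by positivity
      gcongr
      linarith [Real.add_one_le_exp (4 * (M : ℝ) * N / ε)]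
    calc _ ≤ ε / 2 + 2 * M * N * (ε / (4 * M * N)) := by gcongr
      _ = ε := by field_simp; ring
  obtain ⟨b, hab, hb⟩ : ∃ b : ℕ, a < b ∧ (a + M * N : ℝ) ≤ Real.log b := by
    have h1 : Filter.Tendsto (fun s : ℕ => Real.log s) Filter.atTop Filter.atTop :=
      Real.tendsto_log_atTop.comp tendsto_natCast_atTop_atTop
    obtain ⟨b, hb⟩ := ((Filter.eventually_gt_atTop a).and
      (h1.eventually_ge_atTop (a + M * N : ℝ))).exists
    exact ⟨b, hb⟩
  obtain ⟨s₁, hsN, hbs, hreg⟩ := exists_isRegular hMN hμ0 hμ1 hη (by rw [hηdef]; linarith) hgap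
    hM2 hK0 hτ0 b
  have hlead : B * (M * N * C * ε + p ^ h' * K) < δ := by
    have h1 : B * (M * N * C) * ε ≤ δ / 4 := by
      rw [hε, mul_div_assoc', div_le_iff₀ (by positivity)]
      have : 0 ≤ B * (M * N * C) := by positivity
      nlinarith
    have h2 : B * K * p ^ h' ≤ δ / 4 := by
      calc B * K * p ^ h' ≤ B * K * (δ / (4 * (B * K + 1))) := by gcongr
        _ ≤ δ / 4 := by
          rw [mul_div_assoc', div_le_iff₀ (by positivity)]
          have : 0 ≤ B * K := by positivity
          nlinarith
    linarith
  set S : ℝ := s₁ + 1 + h with hS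
  -- The total is a quadratic polynomial in `log T` with leading coefficient below `δ`; all other
  -- constants only influence how large `T` must be.
  obtain ⟨x₀, hx₀⟩ := exists_quadratic_le (B * (M * N * C * ε + p ^ h' * K))
    (S * B + h * (M * N * C) + B * (6 * M * N + M * N * ε) + (M * N * C * ε + p ^ h' * K))
    (S * (h + 1 + c) + h * (7 * M * N) + (6 * M * N + M * N * ε) + c) hlead
  obtain ⟨T₁, hT₁⟩ : ∃ T₁ : ℕ, ∀ T : ℕ, T₁ ≤ T → x₀ ≤ Real.log T := by
    have h1 : Filter.Tendsto (fun s : ℕ => Real.log s) Filter.atTop Filter.atTop :=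
      Real.tendsto_log_atTop.comp tendsto_natCast_atTop_atTop
    exact Filter.eventually_atTop.mp (h1.eventually_ge_atTop x₀)
  refine ⟨T₁ + b + 1, by omega, ?_⟩
  intro T hT L hML hLN Ω _ P _ X W hs σ hσ past past' m
  have hT1 : 1 ≤ T := by omega
  have hTr : (1 : ℝ) ≤ T := by exact_mod_cast hT1
  set x := Real.log T with hx
  have hx0 : 0 ≤ x := Real.log_nonneg hTr
  -- This makes `q ^ H ≤ 1 / T`, so that the tails of all `T` slots together are bounded by the
  -- constant `c`.
  set H := ⌈B * x⌉₊ with hH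
  have hHle : (H : ℝ) ≤ B * x + 1 := (Nat.ceil_lt_add_one (by positivity)).le
  have hCle : (⌈C * x⌉₊ : ℝ) ≤ C * x + 1 := (Nat.ceil_lt_add_one (by positivity)).le
  have hyle : (⌊K * x⌋₊ : ℝ) ≤ K * x := Nat.floor_le (by positivity)
  have hqH : ENNReal.ofReal (1 - μmin / M) ^ H * (1 - ENNReal.ofReal (1 - μmin / M))⁻¹
      ≤ ENNReal.ofReal (c / T) := by
    rw [← hqdef, ← ENNReal.ofReal_pow hq0.le, ← ENNReal.ofReal_one,
      ← ENNReal.ofReal_sub _ hq0.le, ← ENNReal.ofReal_inv_of_pos (by linarith),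
      ← ENNReal.ofReal_mul (by positivity)]
    refine ENNReal.ofReal_le_ofReal ?_
    have h1 : q ^ H ≤ 1 / T := pow_ceil_log_le hq0 hq1 hT1
    have h2 : 0 < 1 - q := by linarith
    calc q ^ H * (1 - q)⁻¹ ≤ 1 / T * (1 - q)⁻¹ := by gcongr
      _ = c / T := by rw [hcdef]; ring
  have hbad := hs.sum_prob_and_isBad_le (hML := hML) (hLN := hLN) (hMN := hMN) (C := C) hμ0 hσ hg
    hgap (by omega) hC hT1 (D := fun _ => True) (fun _ _ _ => rfl)
  have hdbad := hs.sum_prob_and_isBad_le (hML := hML) (hLN := hLN) (hMN := hMN) (C := C) hμ0 hσ hg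
    hgap (by omega) hC hT1 (dependsOn_exceptional hML hLN σ μ g C τ η a T)
  have hbad' : ∑ s ∈ Finset.Ioc N T, P {ω | IsBad hML hLN hMN σ s (outcomes X W ω)}
      ≤ ENNReal.ofReal (6 * M * N + (M * N * ⌈C * x⌉₊ : ℕ)) := by
    simp only [true_and, Set.ofPred_true, measure_univ, mul_one] at hbad
    rw [ENNReal.ofReal_add (by positivity) (by positivity), ENNReal.ofReal_natCast]
    exact hbad
  have hdbad' : ∑ s ∈ Finset.Ioc N T, P {ω | Exceptional hML hLN σ μ g C τ η a T (outcomes X W ω) ∧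
      IsBad hML hLN hMN σ s (outcomes X W ω)}
      ≤ ENNReal.ofReal (6 * M * N + (M * N * ⌈C * x⌉₊ : ℕ) * ε) := by
    rw [ENNReal.ofReal_add (by positivity) (by positivity),
      ENNReal.ofReal_mul (p := ((M * N * ⌈C * x⌉₊ : ℕ) : ℝ)) (by positivity),
      ENNReal.ofReal_natCast]
    refine hdbad.trans ?_
    gcongr
    exact (hs.prob_exceptional_le hμ0 hη hC ha1 haN).trans (ENNReal.ofReal_le_ofReal hexc)
  have main := hs.sum_deviationAge_le (hML := hML) (hLN := hLN) (hMN := hMN) (σ := σ) h0.le hμ hμ1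
    hM2 hsN hT1 (y := ⌊K * x⌋₊) (D := Exceptional hML hLN σ μ g C τ η a T)
    (fun z hwin hz => by
      have hG := goodPath_of_not_exceptional (hMN := hMN) hσ hg hgap hC0 hab hb hz hwin
      exact ⟨fun s h1 h2 => hreg L hML hLN σ hσ T z hG s h1 h2,
        Nat.le_floor (hG.bad T (by omega) le_rfl)⟩)
    past past' m h H hc0 (by positivity) (by positivity) hqH hbad' hdbad'
  refine main.trans (ENNReal.ofReal_le_ofReal ?_)
  rw [hhM, ← hp]
  refine le_trans ?_ (hx₀ x (hT₁ T (by omega)))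
  push_cast
  calc _ ≤ S * (h + (B * x + 1) + c) + h * (6 * M * N + M * N * (C * x + 1)) +
        (B * x + 1) * (6 * M * N + M * N * (C * x + 1) * ε + p ^ h' * (K * x)) + c := by
        rw [hS, hh]
        push_cast
        gcongr
    _ = _ := by ring

end AoIBandit

theorem theorem5 (c μmin Δ : ℝ) (hc : 0 < c) (hμmin : 0 < μmin) :
    ∃ K : ℝ, ∀ (M N : ℕ) (hMN : M ≤ N) (μ : Fin N → ℝ),
      StrictAnti μ → (∀ n, μ n ≤ 1) →
      IsLeast (Set.range μ) μmin →
      IsLeast {d : ℝ | ∃ i j : Fin N, i < j ∧ (j : ℕ) < M ∧ d = μ i - μ j} Δ →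
      ∃ T₀ : ℕ, ∀ T : ℕ, T₀ ≤ T →
        ∀ (L : ℕ) (hML : M ≤ L) (hLN : L ≤ N), (L = M ∨ L = N) →
        ∀ (Ω : Type*) [MeasurableSpace Ω] (P : MeasureTheory.Measure Ω)
          [MeasureTheory.IsProbabilityMeasure P]
          (X : ℤ → Fin N → Ω → Bool) (W : ℤ → Fin N → Ω → Finset (Fin M) → Fin M),
          AoIBandit.IsSystem P μ X W →
        ∀ (σ : Fin M → ℕ → AoIBandit.LocalState N → Fin N), AoIBandit.IsRule σ →
        ∀ (past past' : ℤ → Fin M → Fin N),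
          (∀ m, ∀ t ∈ Finset.Icc (1 : ℤ) T,
            MeasureTheory.Integrable (AoIBandit.dlfAge hML hLN X W σ past m t) P ∧
            MeasureTheory.Integrable (AoIBandit.oracleAge hMN X W past' m t) P) ∧
          AoIBandit.regret P (AoIBandit.dlfAge hML hLN X W σ past)
              (AoIBandit.oracleAge hMN X W past') T
            ≤ (M : ℝ) ^ 2 / μmin + (M : ℝ) ^ 2 * c * Real.log T / μmin *
                (1 + ((N : ℝ) - 1) * (8 * Real.log T / Δ ^ 2 + 1 + 2 * Real.pi ^ 2 / 3)) ∧
          AoIBandit.regret P (AoIBandit.dlfAge hML hLN X W σ past)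
              (AoIBandit.oracleAge hMN X W past') T
            ≤ K * ((M : ℝ) ^ 2 * N * Real.log T ^ 2) := by
  -- The regret is o(log² T), so `K = 1` works and `T₀` takes up all dependence on the parameters.
  refine ⟨1, fun M N hMN μ hanti hμ1 hleast hgap => ?_⟩
  obtain ⟨⟨i₀, j₀, hij₀, hj₀, hΔ⟩, -⟩ := hgap
  have hM2 : 2 ≤ M := by have := Fin.lt_def.mp hij₀; omega
  have hMr : (2 : ℝ) ≤ M := by exact_mod_cast hM2
  have hNr : (2 : ℝ) ≤ N := by exact_mod_cast hM2.trans hMN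
  have hΔ0 : 0 < Δ := by have := hanti hij₀; linarith
  have hμ : ∀ n, μmin ≤ μ n := fun n => hleast.2 ⟨n, rfl⟩
  have hμmin1 : μmin ≤ 1 := (hμ i₀).trans (hμ1 i₀)
  have hq : μmin / M ≤ 1 := by rw [div_le_one (by linarith)]; linarith
  -- The confidence argument involves all `N` channels, so it uses their minimal gap `g`, which may
  -- be smaller than `Δ`; this only affects `T₀`.
  obtain ⟨g, hg, hgap⟩ : ∃ g > 0, ∀ i j, i < j → g ≤ μ i - μ j := by
    let S : Finset (Fin N × Fin N) := Finset.univ.filter fun r => r.1 < r.2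
    obtain ⟨r, hr, hmin⟩ := S.exists_min_image (fun r => μ r.1 - μ r.2)
      ⟨(i₀, j₀), by simpa [S] using hij₀⟩
    refine ⟨μ r.1 - μ r.2, ?_, fun i j hij => hmin (i, j) (by simpa [S] using hij)⟩
    have := hanti (show r.1 < r.2 by simpa [S] using hr)
    linarith
  set w := (AoIBandit.deviationWeight (ENNReal.ofReal (1 - μmin / M))).toReal with hw
  have hw0 : 0 ≤ w := ENNReal.toReal_nonneg
  -- The first entry is a lower bound for the coefficient of `log² T` in the first claim, as `N - 1
  -- ≥ 1`; the second serves the bound with `K = 1`.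
  set κ : ℝ := min ((M : ℝ) ^ 2 * c / μmin * (8 / Δ ^ 2)) 1 with hκ
  have hκ0 : 0 < κ := lt_min (by positivity) one_pos
  set δ : ℝ := κ / (M * w + 1) with hδ
  have hδ0 : 0 < δ := by positivity
  obtain ⟨T₀, hT₀, hmain⟩ := AoIBandit.exists_sum_deviationAge_le hM2 hMN hμmin hμ hμ1 hg hgap hδ0
  refine ⟨T₀, ?_⟩
  intro T hT L hML hLN _ Ω _ P _ X W hs σ hσ past past'
  have hA := AoIBandit.isAdapted_dlfSchedule hML hLN σ past
  have hO := AoIBandit.isAdapted_oracleSchedule (N := N) hMN past'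
  have hTr : (1 : ℝ) ≤ T := by exact_mod_cast hT₀.trans hT
  have hlog : 0 ≤ Real.log T := Real.log_nonneg hTr
  have hreg : AoIBandit.regret P (AoIBandit.dlfAge hML hLN X W σ past)
      (AoIBandit.oracleAge hMN X W past') T ≤ κ * Real.log T ^ 2 := by
    have h1 := hs.regret_ageOf_le hμmin hμ hA hO T (B := δ * Real.log T ^ 2) (by positivity) hq
      (fun m => hmain T hT L hML hLN Ω P X W hs σ hσ past past' m)
    refine le_trans h1 ?_
    rw [← hw]
    calc (M : ℝ) * (w * (δ * Real.log T ^ 2)) = κ * (M * w / (M * w + 1)) * Real.log T ^ 2 := by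
          rw [hδ]; ring
      _ ≤ κ * 1 * Real.log T ^ 2 := by
          gcongr
          rw [div_le_one (by positivity)]
          linarith
      _ = _ := by ring
  refine ⟨fun m t _ => ⟨hs.integrable_ageOf hμmin hμ hA m t, hs.integrable_ageOf hμmin hμ hO m t⟩,
    hreg.trans ?_, hreg.trans ?_⟩
  · have hN1 : (1 : ℝ) ≤ N - 1 := by linarith
    calc κ * Real.log T ^ 2 ≤ (M : ℝ) ^ 2 * c / μmin * (8 / Δ ^ 2) * Real.log T ^ 2 := by
          gcongr
          exact min_le_left _ _
      _ = (M : ℝ) ^ 2 * c * Real.log T / μmin * (1 * (8 * Real.log T / Δ ^ 2)) := by ring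
      _ ≤ (M : ℝ) ^ 2 * c * Real.log T / μmin *
            (1 + ((N : ℝ) - 1) * (8 * Real.log T / Δ ^ 2 + 1 + 2 * Real.pi ^ 2 / 3)) := by
          gcongr
          have h1 : 0 ≤ 8 * Real.log T / Δ ^ 2 := by positivity
          have h2 : 0 ≤ 1 + 2 * Real.pi ^ 2 / 3 := by positivity
          nlinarith
      _ ≤ _ := by
          have : 0 ≤ (M : ℝ) ^ 2 / μmin := by positivity
          linarith
  · have h1 : κ ≤ 1 := min_le_right _ _
    have h2 : (1 : ℝ) ≤ (M : ℝ) ^ 2 * N := by nlinarith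
    calc κ * Real.log T ^ 2 ≤ 1 * Real.log T ^ 2 := by gcongr
      _ ≤ (M : ℝ) ^ 2 * N * Real.log T ^ 2 := by gcongr
      _ = _ := by ring
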